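/- Let $k=-\tfrac32$ and let $\widehat{\mathfrak{sl}}(2)=\mathfrak{sl}(2)\otimes\mathbb C[t,t^{-1}]\oplus\mathbb C K$ be the affine Lie algebra, with $[x t^m,y t^n]=[x,y]t^{m+n}+m\,\delta_{m+n,0}\operatorname{tr}(xy)K$; write $x(n)$ for the action of $xt^n$ on a module. For an integer $j\ge 0$ let $V^k(j\omega_1)$ be the generalized Verma module of level $k$ induced from the $(j+1)$-dimensional irreducible $\mathfrak{sl}(2)$-module (on which $xt^n$, $n>0$, acts by $0$ and $K$ acts by $k$), and let $$N^k(j)=\{v\in V^k(j\omega_1)\;:\;h(n)v=0\ \text{ for all } n\ge 0\},$$ where $e,f,h$ is the Chevalley basis of $\mathfrak{sl}(2)$. Let $L(0)$ be the operator on $N^k(j)$ given by the conformal vector of the parafermion vertex algebra $N^k(\mathfrak{sl}(2))$, that is, the difference of the Sugawara operator $L(0)$ of $\widehat{\mathfrak{sl}}(2)$ at level $k$ and the operator $L(0)$ of the Heisenberg subalgebra generated by $h$; let $\mathrm{ch}[N^k(j)](q)=\mathrm{tr}_{N^k(j)}\,q^{L(0)}$. Put $$F_{m,n}=q^{\frac23m^2+\frac23n^2+\frac23mn-m-n}(1-q^m)(1-q^n)(1-q^{m+n}),$$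 $(q;q)_\infty=\prod_{n\ge1}(1-q^n)$, and, for $m\le 0$, $\Phi_m(q)=\sum_{r\ge0}(-1)^r q^{\frac{r(r+1)}2+mr}$. All series are formal series in $q$. Then for every integer $s\ge0$: $L(0)$ is diagonalizable on $N^k(2s)$, with eigenvalues in $\mathbb Z_{\ge0}$ and finite-dimensional eigenspaces; all the sums below converge as formal series; and $$G_s(q):=\sum_{m\ge s+1}F_{m,m}+\sum_{i=1}^{s}\ \sum_{m\ge i}\bigl(F_{m,\,m+3(s+1-i)}+F_{m+3(s+1-i),\,m}\bigr)=(q;q)_\infty^2\,\mathrm{ch}[N^k(2s)](q).$$ In terms of the false theta functions $\Phi_m$, $$G_s(q)=q^{2s(s+1)}\bigl(\Phi_0(q)+\Phi_{-1}(q)-2\Phi_{-s-1}(q)\bigr).$$ -/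

import Mathlib

open scoped TensorProduct PowerSeries.WithPiTopology

noncomputable section

namespace ParafermionSl2

/-! ### The Lie algebra `sl(2)` and its finite-dimensional irreducible modules -/

/-- The Lie algebra `sl(2)` of traceless complex `2 × 2` matrices. -/
abbrev sl2 : Type := LieAlgebra.SpecialLinear.sl (Fin 2) ℂ

/-- The Chevalley generator `e`. -/
def e : sl2 := ⟨!![0, 1; 0, 0], by
  change Matrix.traceLinearMap (Fin 2) ℂ ℂ _ = 0
  simp [Matrix.trace_fin_two]⟩

/-- The Chevalley generator `f`. -/
def f : sl2 := ⟨!![0, 0; 1, 0], by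
  change Matrix.traceLinearMap (Fin 2) ℂ ℂ _ = 0
  simp [Matrix.trace_fin_two]⟩

/-- The Chevalley generator `h = [e, f]`. -/
def h : sl2 := ⟨!![1, 0; 0, -1], by
  change Matrix.traceLinearMap (Fin 2) ℂ ℂ _ = 0
  simp [Matrix.trace_fin_two]⟩

/-- The normalized invariant form `(x, y) = tr (x y)` of `sl(2)`. -/
def form : LinearMap.BilinForm ℂ sl2 :=
  LinearMap.mk₂ ℂ (fun x y => Matrix.trace (x.val * y.val))
    (fun x y z => by simp [add_mul]) (fun c x y => by simp)
    (fun x y z => by simp [mul_add]) (fun c x y => by simp)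

lemma form_apply (x y : sl2) : form x y = Matrix.trace (x.val * y.val) := rfl

lemma form_isSymm : form.IsSymm :=
  ⟨fun x y => by simp [form_apply, Matrix.trace_mul_comm x.val y.val]⟩

lemma form_lieInvariant : form.lieInvariant sl2 := by
  intro x y z
  simp only [form_apply, LieAlgebra.SpecialLinear.sl_bracket, sub_mul, mul_sub, Matrix.trace_sub]
  rw [← Matrix.mul_assoc y.val x.val z.val, ← Matrix.mul_assoc y.val z.val x.val,
    Matrix.trace_mul_comm (y.val * z.val) x.val, ← Matrix.mul_assoc x.val y.val z.val]
  ring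

/-- The matrix of `e` on the irreducible module with basis `v₀, …, v_j`:
`e v_k = k (j + 1 - k) v_{k-1}`. -/
def matE (j : ℕ) : Matrix (Fin (j + 1)) (Fin (j + 1)) ℂ :=
  Matrix.of fun i k => if (i : ℕ) + 1 = k then (k : ℂ) * (j + 1 - k) else 0

/-- The matrix of `f`: `f v_k = v_{k+1}` for `k < j` and `f v_j = 0`. -/
def matF (j : ℕ) : Matrix (Fin (j + 1)) (Fin (j + 1)) ℂ :=
  Matrix.of fun i k => if (i : ℕ) = k + 1 then 1 else 0

/-- The matrix of `h`: `h v_k = (j - 2 k) v_k`. -/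
def matH (j : ℕ) : Matrix (Fin (j + 1)) (Fin (j + 1)) ℂ :=
  Matrix.diagonal fun k => (j : ℂ) - 2 * k

lemma matEF (j : ℕ) : matE j * matF j - matF j * matE j = matH j := by
  ext i k
  simp only [matE, matF, matH, Matrix.sub_apply, Matrix.mul_apply, Matrix.of_apply,
    Matrix.diagonal_apply]
  have h1 : ∑ l : Fin (j + 1), (if (i : ℕ) + 1 = l then (l : ℂ) * (j + 1 - l) else 0) *
      (if (l : ℕ) = k + 1 then 1 else 0) =
      if i = k then ((k : ℂ) + 1) * (j - k) else 0 := by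
    by_cases hik : i = k
    · subst hik
      by_cases hi : (i : ℕ) + 1 < j + 1
      · rw [Finset.sum_eq_single (⟨i + 1, hi⟩ : Fin (j + 1))]
        · simp
        · intro b _ hb
          have : ¬ ((i : ℕ) + 1 = b) := fun hc => hb (Fin.ext hc.symm)
          simp [this]
        · simp
      · have hij : (i : ℂ) = j := by
          have := i.isLt
          exact_mod_cast (by omega : (i : ℕ) = j)
        rw [Finset.sum_eq_zero]
        · simp [hij]
        · intro b _
          have := b.isLt
          have : ¬ ((i : ℕ) + 1 = b) := by omega
          simp [this]
    · rw [Finset.sum_eq_zero, if_neg hik]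
      intro b _
      by_cases hb : (i : ℕ) + 1 = b
      · have : ¬ ((b : ℕ) = k + 1) := fun hc => hik (Fin.ext (by omega))
        simp [this]
      · simp [hb]
  have h2 : ∑ l : Fin (j + 1), (if (i : ℕ) = l + 1 then (1 : ℂ) else 0) *
      (if (l : ℕ) + 1 = k then (k : ℂ) * (j + 1 - k) else 0) =
      if i = k then (k : ℂ) * (j + 1 - k) else 0 := by
    by_cases hik : i = k
    · subst hik
      by_cases hi : 0 < (i : ℕ)
      · have hlt : (i : ℕ) - 1 < j + 1 := by have := i.isLt; omega
        rw [Finset.sum_eq_single (⟨i - 1, hlt⟩ : Fin (j + 1))]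
        · have : (i : ℕ) - 1 + 1 = i := by omega
          simp [this]
        · intro b _ hb
          have : ¬ ((i : ℕ) = b + 1) := fun hc => hb (Fin.ext (by simp [hc]))
          simp [this]
        · simp
      · have hi0 : (i : ℕ) = 0 := by omega
        rw [Finset.sum_eq_zero]
        · simp [hi0]
        · intro b _
          simp [hi0]
    · rw [Finset.sum_eq_zero, if_neg hik]
      intro b _
      by_cases hb : (i : ℕ) = b + 1
      · have : ¬ ((b : ℕ) + 1 = k) := fun hc => hik (Fin.ext (by omega))
        simp [this]
      · simp [hb]
  rw [h1, h2]
  split_ifs with hik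
  · subst hik; ring
  · simp

lemma matHE (j : ℕ) : matH j * matE j - matE j * matH j = (2 : ℂ) • matE j := by
  ext i k
  simp only [matH, matE, Matrix.sub_apply, Matrix.diagonal_mul, Matrix.mul_diagonal,
    Matrix.of_apply, Matrix.smul_apply, smul_eq_mul]
  split_ifs with hik
  · have : (k : ℂ) = i + 1 := by exact_mod_cast hik.symm
    rw [this]; ring
  · simp

lemma matHF (j : ℕ) : matH j * matF j - matF j * matH j = (-2 : ℂ) • matF j := by
  ext i k
  simp only [matH, matF, Matrix.sub_apply, Matrix.diagonal_mul, Matrix.mul_diagonal,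
    Matrix.of_apply, Matrix.smul_apply, smul_eq_mul]
  split_ifs with hik
  · have : ((i : ℕ) : ℂ) = k + 1 := by exact_mod_cast hik
    rw [this]; ring
  · simp

/-- The matrix of an element `!![a, b; c, -a] = a h + b e + c f` of `sl(2)`. -/
def repMat (j : ℕ) : sl2 →ₗ[ℂ] Matrix (Fin (j + 1)) (Fin (j + 1)) ℂ where
  toFun x := x.val 0 0 • matH j + x.val 0 1 • matE j + x.val 1 0 • matF j
  map_add' x y := by simp [add_smul]; abel
  map_smul' c x := by simp [mul_smul]

lemma repMat_lie (j : ℕ) (x y : sl2) :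
    repMat j ⁅x, y⁆ = repMat j x * repMat j y - repMat j y * repMat j x := by
  have hx : x.val 1 1 = -x.val 0 0 := by
    have : Matrix.trace x.val = 0 := x.property
    rw [Matrix.trace_fin_two] at this
    linear_combination this
  have hy : y.val 1 1 = -y.val 0 0 := by
    have : Matrix.trace y.val = 0 := y.property
    rw [Matrix.trace_fin_two] at this
    linear_combination this
  have e1 := matEF j
  have e2 := matHE j
  have e3 := matHF j
  simp only [repMat, LinearMap.coe_mk, AddHom.coe_mk, LieAlgebra.SpecialLinear.sl_bracket,
    Matrix.sub_apply, Matrix.mul_apply, Fin.sum_univ_two, hx, hy]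
  rw [sub_eq_iff_eq_add] at e1 e2 e3
  simp only [mul_add, add_mul, smul_mul_assoc, mul_smul_comm, e1, e2, e3]
  module

/-- The underlying space of the irreducible `sl(2)`-module with highest weight `j ω₁`. -/
abbrev V (j : ℕ) : Type := Fin (j + 1) → ℂ

/-- The action of `sl(2)` on the irreducible module with highest weight `j ω₁`. -/
def rep (j : ℕ) : sl2 →ₗ[ℂ] Module.End ℂ (V j) :=
  (Matrix.toLin' (R := ℂ)).toLinearMap ∘ₗ repMat j

lemma rep_lie (j : ℕ) (x y : sl2) :
    rep j ⁅x, y⁆ = rep j x * rep j y - rep j y * rep j x := by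
  simp [rep, repMat_lie, Matrix.toLin'_mul, Module.End.mul_eq_comp]

/-! ### The affine Lie algebra -/

/-- The affine Lie algebra `sl(2) ⊗ ℂ[t, t⁻¹] ⊕ ℂ K`, the central extension of the loop algebra
with `[x tᵐ, y tⁿ] = [x, y] tᵐ⁺ⁿ + m δ_{m+n,0} (x, y) K`. -/
abbrev Affine : Type :=
  LieAlgebra.ofTwoCocycle (R := ℂ)
    (LieAlgebra.LoopAlgebra.twoCocycleOfBilinear ℂ ℤ sl2 form form_lieInvariant form_isSymm)

/-- The element `x tⁿ`. -/
def loop (x : sl2) (n : ℤ) : Affine :=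
  LieAlgebra.ofProd _ ((AddMonoidAlgebra.single n 1 : AddMonoidAlgebra ℂ ℤ) ⊗ₜ[ℂ] x, 0)

/-- The central element `K`. Mathlib's cocycle on `(x tᵐ, y tⁿ)` is `n δ_{m+n,0} (x, y)`, which is
`-m δ_{m+n,0} (x, y)`, hence the sign. -/
def central : Affine :=
  LieAlgebra.ofProd _ (0, (TrivialLieModule.equiv ℂ _ ℂ).symm (-1))

lemma loop_lie (x y : sl2) (m n : ℤ) :
    ⁅loop x m, loop y n⁆ =
      loop ⁅x, y⁆ (m + n) + (if m + n = 0 then (m : ℂ) * form x y else 0) • central := by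
  rw [LieAlgebra.bracket_ofTwoCocycle]
  have key : LieAlgebra.LoopAlgebra.residuePairing ℂ ℤ sl2 form
      ((AddMonoidAlgebra.single m 1 : AddMonoidAlgebra ℂ ℤ) ⊗ₜ[ℂ] x)
      ((AddMonoidAlgebra.single n 1 : AddMonoidAlgebra ℂ ℤ) ⊗ₜ[ℂ] y) =
      if m + n = 0 then -((m : ℂ) * form x y) else 0 := by
    rw [LieAlgebra.LoopAlgebra.residuePairing_apply_apply]
    simp only [LieAlgebra.LoopAlgebra.toFinsupp_single_tmul]
    rw [Finsupp.sum_single_index (by simp)]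
    split_ifs with hmn
    · obtain rfl : m = -n := by omega
      simp
    · rw [Finsupp.single_eq_of_ne (by omega)]
      simp
  change LieAlgebra.ofProd _ (_, _) = LieAlgebra.ofProd _ (_, _)
  refine congrArg _ (Prod.ext ?_ ?_)
  · change ⁅_, _⁆ = _ + _ • (0 : LieAlgebra.loopAlgebra ℂ ℤ sl2)
    rw [smul_zero, add_zero]
    change ⁅(AddMonoidAlgebra.single m 1 : AddMonoidAlgebra ℂ ℤ) ⊗ₜ[ℂ] x,
      (AddMonoidAlgebra.single n 1 : AddMonoidAlgebra ℂ ℤ) ⊗ₜ[ℂ] y⁆ = _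
    rw [LieAlgebra.ExtendScalars.bracket_tmul, AddMonoidAlgebra.single_mul_single, one_mul]
    rfl
  · change (TrivialLieModule.equiv ℂ _ ℂ).symm (LieAlgebra.LoopAlgebra.residuePairing ℂ ℤ sl2 form
      ((AddMonoidAlgebra.single m 1 : AddMonoidAlgebra ℂ ℤ) ⊗ₜ[ℂ] x)
      ((AddMonoidAlgebra.single n 1 : AddMonoidAlgebra ℂ ℤ) ⊗ₜ[ℂ] y)) + ⁅_, _⁆ - ⁅_, _⁆ =
      0 + _ • (TrivialLieModule.equiv ℂ _ ℂ).symm (-1)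
    rw [trivial_lie_zero, trivial_lie_zero, key, ← map_smul, add_zero, sub_zero, zero_add]
    congr 1
    split_ifs <;> simp

lemma central_lie (a : Affine) : ⁅central, a⁆ = 0 := by
  rw [LieAlgebra.bracket_ofTwoCocycle]
  refine Eq.trans (b := LieAlgebra.ofProd _ 0) (congrArg _ (Prod.ext ?_ ?_)) rfl
  · simp [LieAlgebra.ofProd, central]
  · simp [LieAlgebra.ofProd, central, trivial_lie_zero]

/-- The universal enveloping algebra of the affine Lie algebra. -/
abbrev U : Type := UniversalEnvelopingAlgebra ℂ Affine

section

attribute [local instance] LieRing.ofAssociativeRing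

/-- The inclusion of the affine Lie algebra into its enveloping algebra. -/
def toU : Affine →ₗ[ℂ] U := (UniversalEnvelopingAlgebra.ι ℂ : Affine →ₗ⁅ℂ⁆ U).toLinearMap

lemma toU_lie (a b : Affine) : toU ⁅a, b⁆ = toU a * toU b - toU b * toU a := by
  rw [← LieRing.of_associative_ring_bracket]
  exact (UniversalEnvelopingAlgebra.ι ℂ : Affine →ₗ⁅ℂ⁆ U).map_lie a b

end

/-! ### Generalized Verma modules -/

/-- The relations `u p ⊗ v = u ⊗ p v` for `p` in the subalgebra `sl(2)[t] ⊕ ℂ K`, which acts on the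
irreducible `sl(2)`-module by `x ↦ x`, `x tⁿ ↦ 0` for `n > 0`, and `K ↦ k`. -/
def inducedRelations (k : ℂ) (j : ℕ) : Submodule U (U ⊗[ℂ] V j) :=
  Submodule.span U
    ({w | ∃ (x : sl2) (v : V j), w = toU (loop x 0) ⊗ₜ v - 1 ⊗ₜ rep j x v} ∪
     {w | ∃ (x : sl2) (n : ℕ) (v : V j), 0 < n ∧ w = toU (loop x n) ⊗ₜ v} ∪
     {w | ∃ v : V j, w = toU central ⊗ₜ v - 1 ⊗ₜ (k • v)})

/-- The generalized Verma module of level `k` induced from the irreducible `sl(2)`-module with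
highest weight `j ω₁`: the tensor product of `U` and that module over `U(sl(2)[t] ⊕ ℂ K)`. -/
def WeylModule (k : ℂ) (j : ℕ) : Type := (U ⊗[ℂ] V j) ⧸ inducedRelations k j

instance (k : ℂ) (j : ℕ) : AddCommGroup (WeylModule k j) :=
  inferInstanceAs (AddCommGroup ((U ⊗[ℂ] V j) ⧸ inducedRelations k j))

instance (k : ℂ) (j : ℕ) : Module U (WeylModule k j) :=
  inferInstanceAs (Module U ((U ⊗[ℂ] V j) ⧸ inducedRelations k j))

instance (k : ℂ) (j : ℕ) : Module ℂ (WeylModule k j) :=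
  inferInstanceAs (Module ℂ ((U ⊗[ℂ] V j) ⧸ inducedRelations k j))

instance (k : ℂ) (j : ℕ) : IsScalarTower ℂ U (WeylModule k j) :=
  inferInstanceAs (IsScalarTower ℂ U ((U ⊗[ℂ] V j) ⧸ inducedRelations k j))

/-- The class `1 ⊗ v` of a vector of the inducing module. -/
def vac (k : ℂ) (j : ℕ) : V j →ₗ[ℂ] WeylModule k j :=
  ((inducedRelations k j).mkQ.restrictScalars ℂ) ∘ₗ TensorProduct.mk ℂ U (V j) 1

lemma loop_zero_smul_vac (k : ℂ) (j : ℕ) (x : sl2) (v : V j) :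
    toU (loop x 0) • vac k j v = vac k j (rep j x v) := by
  refine Eq.trans ((map_smul (inducedRelations k j).mkQ (toU (loop x 0)) (1 ⊗ₜ v)).symm) ?_
  rw [TensorProduct.smul_tmul', smul_eq_mul, mul_one]
  exact (Submodule.Quotient.eq _).mpr (Submodule.subset_span (Or.inl (Or.inl ⟨x, v, rfl⟩)))

lemma loop_pos_smul_vac (k : ℂ) (j : ℕ) (x : sl2) (n : ℕ) (hn : 0 < n) (v : V j) :
    toU (loop x n) • vac k j v = 0 := by
  refine Eq.trans ((map_smul (inducedRelations k j).mkQ (toU (loop x n)) (1 ⊗ₜ v)).symm) ?_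
  rw [TensorProduct.smul_tmul', smul_eq_mul, mul_one]
  exact (Submodule.Quotient.mk_eq_zero _).mpr
    (Submodule.subset_span (Or.inl (Or.inr ⟨x, n, v, hn, rfl⟩)))

lemma central_smul_vac (k : ℂ) (j : ℕ) (v : V j) :
    toU central • vac k j v = k • vac k j v := by
  rw [← map_smul (vac k j) k v]
  refine Eq.trans ((map_smul (inducedRelations k j).mkQ (toU central) (1 ⊗ₜ v)).symm) ?_
  rw [TensorProduct.smul_tmul', smul_eq_mul, mul_one]
  exact (Submodule.Quotient.eq _).mpr (Submodule.subset_span (Or.inr ⟨v, rfl⟩))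

lemma weyl_induction {k : ℂ} {j : ℕ} {P : WeylModule k j → Prop}
    (hadd : ∀ a b, P a → P b → P (a + b)) (hgen : ∀ (u : U) (v : V j), P (u • vac k j v))
    (w : WeylModule k j) : P w := by
  obtain ⟨w, rfl⟩ := (inducedRelations k j).mkQ_surjective w
  induction w using TensorProduct.induction_on with
  | zero =>
    have h0 := hgen 0 0
    rw [zero_smul] at h0
    rw [map_zero]
    exact h0
  | add a b ha hb => rw [map_add]; exact hadd _ _ ha hb
  | tmul u v =>
    have h1 : (inducedRelations k j).mkQ (u ⊗ₜ v) = u • vac k j v := by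
      refine Eq.trans ?_ (map_smul (inducedRelations k j).mkQ u (1 ⊗ₜ v))
      rw [TensorProduct.smul_tmul', smul_eq_mul, mul_one]
    exact h1 ▸ hgen u v

/-- The operator `x(n)`, the action of `x tⁿ`. -/
def mode (k : ℂ) (j : ℕ) (x : sl2) (n : ℤ) : Module.End ℂ (WeylModule k j) :=
  Algebra.lsmul ℂ ℂ (WeylModule k j) (toU (loop x n))

lemma mode_apply (k : ℂ) (j : ℕ) (x : sl2) (n : ℤ) (v : WeylModule k j) :
    mode k j x n v = toU (loop x n) • v := rfl

lemma affine_induction {P : Affine → Prop} (hloop : ∀ x n, P (loop x n)) (hcentral : P central)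
    (hadd : ∀ a b, P a → P b → P (a + b)) (hsmul : ∀ (c : ℂ) a, P a → P (c • a)) (a : Affine) :
    P a := by
  have hzero : P 0 := by simpa using hsmul 0 _ hcentral
  have hloop' : ∀ l : LieAlgebra.loopAlgebra ℂ ℤ sl2, P (LieAlgebra.ofProd _ (l, 0)) := by
    intro l
    induction l using TensorProduct.induction_on with
    | zero => exact hzero
    | tmul p x =>
      induction p using AddMonoidAlgebra.induction_linear with
      | zero => rw [TensorProduct.zero_tmul]; exact hzero
      | add p r hp hr =>
        have := hadd _ _ hp hr
        rwa [← LieAlgebra.of_add, Prod.mk_add_mk, ← TensorProduct.add_tmul, add_zero] at this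
      | single n c =>
        have := hsmul c _ (hloop x n)
        rwa [loop, ← LieAlgebra.of_smul, Prod.smul_mk, TensorProduct.smul_tmul',
          AddMonoidAlgebra.smul_single, smul_eq_mul, mul_one, smul_zero] at this
    | add p r hp hr =>
      have := hadd _ _ hp hr
      rwa [← LieAlgebra.of_add, Prod.mk_add_mk, add_zero] at this
  obtain ⟨l, c⟩ := a
  have h1 := hadd _ _ (hloop' l) (hsmul (-(TrivialLieModule.equiv ℂ _ ℂ c)) _ hcentral)
  convert h1 using 1
  refine congrArg (LieAlgebra.ofProd _) (Prod.ext ?_ ?_)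
  · change l = l + _ • (0 : LieAlgebra.loopAlgebra ℂ ℤ sl2)
    rw [smul_zero, add_zero]
  · change c = 0 + _ • (TrivialLieModule.equiv ℂ _ ℂ).symm (-1)
    rw [← map_smul, zero_add, smul_eq_mul, mul_neg, mul_one, neg_neg, LinearEquiv.symm_apply_apply]

lemma toU_induction {P : U → Prop} (hone : P 1) (hadd : ∀ a b, P a → P b → P (a + b))
    (hsmul : ∀ (c : ℂ) a, P a → P (c • a)) (hmul : ∀ a u, P u → P (toU a * u)) (u : U) : P u := by
  obtain ⟨t, rfl⟩ : ∃ t, UniversalEnvelopingAlgebra.mkAlgHom ℂ Affine t = u :=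
    RingCon.mkₐ_surjective _ u
  have key : ∀ v : U, P v → P (UniversalEnvelopingAlgebra.mkAlgHom ℂ Affine t * v) := by
    induction t using TensorAlgebra.induction with
    | algebraMap c =>
      intro v hv
      rw [AlgHom.commutes, ← Algebra.smul_def]
      exact hsmul c v hv
    | ι a =>
      intro v hv
      have ha : UniversalEnvelopingAlgebra.mkAlgHom ℂ Affine (TensorAlgebra.ι ℂ a) = toU a := rfl
      rw [ha]
      exact hmul a v hv
    | mul x y hx hy => intro v hv; rw [map_mul, mul_assoc]; exact hx _ (hy v hv)
    | add x y hx hy => intro v hv; rw [map_add, add_mul]; exact hadd _ _ (hx v hv) (hy v hv)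
  simpa using key 1 hone

lemma central_smul (k : ℂ) (j : ℕ) (v : WeylModule k j) : toU central • v = k • v := by
  induction v using weyl_induction with
  | hadd a b ha hb => rw [smul_add, ha, hb, smul_add]
  | hgen u v =>
    induction u using toU_induction with
    | hone => rw [one_smul, central_smul_vac]
    | hadd a b ha hb => rw [add_smul, smul_add, ha, hb, smul_add]
    | hsmul c a ha => rw [smul_assoc, smul_comm, ha, smul_comm]
    | hmul a u hu =>
      have hc : toU central * toU a = toU a * toU central := by
        have := toU_lie central a
        rw [central_lie, map_zero] at this
        exact (sub_eq_zero.mp this.symm)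
      rw [mul_smul, ← mul_smul, hc, mul_smul, hu, smul_comm]

/-- Every vector is annihilated by `x(n)` for all large `n`. -/
lemma mode_eventually_zero (k : ℂ) (j : ℕ) (v : WeylModule k j) :
    ∃ B : ℕ, ∀ (x : sl2) (n : ℤ), (B : ℤ) ≤ n → mode k j x n v = 0 := by
  simp only [mode_apply]
  induction v using weyl_induction with
  | hadd a b ha hb =>
    obtain ⟨A, hA⟩ := ha
    obtain ⟨B, hB⟩ := hb
    refine ⟨max A B, fun x n hn => ?_⟩
    rw [smul_add, hA x n (by omega), hB x n (by omega), add_zero]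
  | hgen u v =>
    induction u using toU_induction with
    | hone =>
      refine ⟨1, fun x n hn => ?_⟩
      obtain ⟨m, rfl⟩ := Int.eq_ofNat_of_zero_le (show 0 ≤ n by omega)
      rw [one_smul, loop_pos_smul_vac k j x m (by omega)]
    | hadd a b ha hb =>
      obtain ⟨A, hA⟩ := ha
      obtain ⟨B, hB⟩ := hb
      refine ⟨max A B, fun x n hn => ?_⟩
      rw [add_smul, smul_add, hA x n (by omega), hB x n (by omega), add_zero]
    | hsmul c a ha =>
      obtain ⟨A, hA⟩ := ha
      refine ⟨A, fun x n hn => ?_⟩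
      rw [smul_assoc, smul_comm, hA x n hn, smul_zero]
    | hmul a u hu =>
      obtain ⟨A, hA⟩ := hu
      simp only [mul_smul]
      generalize u • vac k j v = z at hA
      induction a using affine_induction with
      | hloop y m =>
        refine ⟨A + m.natAbs + 1, fun x n hn => ?_⟩
        have h1 := toU_lie (loop x n) (loop y m)
        rw [loop_lie, if_neg (by omega), zero_smul, add_zero, eq_sub_iff_add_eq] at h1
        rw [← mul_smul, ← h1, add_smul, mul_smul, hA _ _ (by omega), hA _ _ (by omega),
          smul_zero, add_zero]
      | hcentral =>
        refine ⟨A, fun x n hn => ?_⟩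
        rw [central_smul, smul_comm, hA x n hn, smul_zero]
      | hadd a b ha hb =>
        obtain ⟨A, hA⟩ := ha
        obtain ⟨B, hB⟩ := hb
        refine ⟨max A B, fun x n hn => ?_⟩
        rw [map_add, add_smul, smul_add, hA x n (by omega), hB x n (by omega), add_zero]
      | hsmul c a ha =>
        obtain ⟨A, hA⟩ := ha
        refine ⟨A, fun x n hn => ?_⟩
        rw [map_smul, smul_assoc, smul_comm, hA x n hn, smul_zero]

/-- The sum of a sequence of operators, of which only finitely many act nontrivially on any given
vector. -/
def locallyFiniteSum {M : Type*} [AddCommGroup M] [Module ℂ M] (T : ℕ → Module.End ℂ M)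
    (hT : ∀ v, {n | T n v ≠ 0}.Finite) : Module.End ℂ M where
  toFun v := ∑ᶠ n, T n v
  map_add' v w := by
    simp only [map_add]
    exact finsum_add_distrib (hT v) (hT w)
  map_smul' c v := by
    simp only [map_smul, RingHom.id_apply]
    rw [smul_finsum]

/-- `h(-n) h(n)`. -/
def heisenbergTerm (k : ℂ) (j : ℕ) (n : ℕ) : Module.End ℂ (WeylModule k j) :=
  mode k j h (-n) * mode k j h n

/-- `∑ a(-n) a'(n)` over the dual bases `e, f, h` and `f, e, h / 2`. -/
def sugawaraTerm (k : ℂ) (j : ℕ) (n : ℕ) : Module.End ℂ (WeylModule k j) :=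
  mode k j e (-n) * mode k j f n + mode k j f (-n) * mode k j e n +
    (1 / 2 : ℂ) • heisenbergTerm k j n

lemma heisenbergTerm_finite (k : ℂ) (j : ℕ) (v : WeylModule k j) :
    {n : ℕ | heisenbergTerm k j (n + 1) v ≠ 0}.Finite := by
  obtain ⟨B, hB⟩ := mode_eventually_zero k j v
  refine (Set.finite_Iio B).subset fun n hn => ?_
  by_contra hc
  have hc : B ≤ n := not_lt.mp hc
  exact hn (by
    simp [heisenbergTerm, Module.End.mul_apply, hB h ((n : ℤ) + 1) (by omega)])

lemma sugawaraTerm_finite (k : ℂ) (j : ℕ) (v : WeylModule k j) :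
    {n : ℕ | sugawaraTerm k j (n + 1) v ≠ 0}.Finite := by
  obtain ⟨B, hB⟩ := mode_eventually_zero k j v
  refine (Set.finite_Iio B).subset fun n hn => ?_
  by_contra hc
  have hc : B ≤ n := not_lt.mp hc
  exact hn (by
    simp [sugawaraTerm, heisenbergTerm, Module.End.mul_apply, hB _ ((n : ℤ) + 1) (by omega)])

/-- The Sugawara operator `L(0)` of the affine vertex algebra, of dual Coxeter number `2`. -/
def sugawaraL0 (k : ℂ) (j : ℕ) : Module.End ℂ (WeylModule k j) :=
  (1 / (2 * (k + 2)) : ℂ) • (sugawaraTerm k j 0 +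
    (2 : ℂ) • locallyFiniteSum (fun n => sugawaraTerm k j (n + 1)) (sugawaraTerm_finite k j))

/-- The operator `L(0)` of the Heisenberg vertex algebra generated by `h`, where `(h, h) = 2`. -/
def heisenbergL0 (k : ℂ) (j : ℕ) : Module.End ℂ (WeylModule k j) :=
  (1 / (4 * k) : ℂ) • (heisenbergTerm k j 0 +
    (2 : ℂ) • locallyFiniteSum (fun n => heisenbergTerm k j (n + 1)) (heisenbergTerm_finite k j))

/-- The operator `L(0)` of the parafermion vertex algebra, whose conformal vector is the difference
of those of the affine and the Heisenberg vertex algebra. -/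
def parafermionL0 (k : ℂ) (j : ℕ) : Module.End ℂ (WeylModule k j) :=
  sugawaraL0 k j - heisenbergL0 k j

/-! ### Parafermion modules and their characters -/

/-- `N^k(j)`: the vectors of the generalized Verma module annihilated by `h(n)` for all `n ≥ 0`. -/
def parafermion (k : ℂ) (j : ℕ) : Submodule ℂ (WeylModule k j) where
  carrier := {v | ∀ n : ℕ, mode k j h n v = 0}
  add_mem' {v w} hv hw n := by rw [map_add, hv n, hw n, add_zero]
  zero_mem' n := map_zero _
  smul_mem' c v hv n := by rw [map_smul, hv n, smul_zero]

/-- The subspace of `N^k(j)` on which `L(0)` is the scalar `n`. -/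
def weightSpace (k : ℂ) (j : ℕ) (n : ℕ) : Submodule ℂ (WeylModule k j) :=
  parafermion k j ⊓ (parafermionL0 k j).eigenspace (n : ℂ)

/-- `L(0)` is diagonalizable on `N^k(j)`, its eigenvalues are natural numbers, and the eigenspaces
are finite-dimensional, so that the trace of `q^{L(0)}` is a power series in `q`. -/
def HasPowerSeriesCharacter (k : ℂ) (j : ℕ) : Prop :=
  (⨆ n : ℕ, weightSpace k j n) = parafermion k j ∧
    ∀ n : ℕ, FiniteDimensional ℂ (weightSpace k j n)

/-- Formal series in `q` with rational exponents. -/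
abbrev QSeries : Type := HahnSeries ℚ ℤ

/-- The character of `N^k(j)`, the trace of `q^{L(0)}`. -/
def ch (k : ℂ) (j : ℕ) : QSeries :=
  HahnSeries.ofPowerSeries ℚ ℤ
    (PowerSeries.mk fun n => (Module.finrank ℂ (weightSpace k j n) : ℤ))

/-! ### `q`-series -/

/-- The monomial `q^r`. -/
def q (r : ℚ) : QSeries := HahnSeries.single r 1

/-- The infinite product `(q; q)_∞ = ∏_{n ≥ 1} (1 - qⁿ)`. -/
def qPoch : QSeries :=
  HahnSeries.ofPowerSeries ℚ ℤ (∏' n : ℕ, (1 - (PowerSeries.X : PowerSeries ℤ) ^ (n + 1)))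

/-- The family can be summed formally: the exponents that occur form a well-ordered set, and every
exponent occurs in finitely many members. -/
def FormallySummable {ι : Type} (a : ι → QSeries) : Prop :=
  ∃ A : HahnSeries.SummableFamily ℚ ℤ ι, ∀ i, A i = a i

open Classical in
/-- The formal sum of a formally summable family (`0` for other families). -/
def formalSum {ι : Type} (a : ι → QSeries) : QSeries :=
  if ha : FormallySummable a then ha.choose.hsum else 0

/-- `F_{m,n}`. -/
def F (m n : ℕ) : QSeries :=
  q (2 / 3 * (m : ℚ) ^ 2 + 2 / 3 * (n : ℚ) ^ 2 + 2 / 3 * (m : ℚ) * n - m - n) *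
    (1 - q m) * (1 - q n) * (1 - q (m + n))

/-- The family `F_{m,m}`, `m ≥ s + 1`. -/
def diagonalTerms (s : ℕ) (m : Set.Ici (s + 1)) : QSeries := F m m

/-- The family `F_{m,m+3(s+1-i)} + F_{m+3(s+1-i),m}`, `m ≥ i`, used for `1 ≤ i ≤ s`. -/
def offDiagonalTerms (s i : ℕ) (m : Set.Ici i) : QSeries :=
  F m (m + 3 * (s + 1 - i)) + F (m + 3 * (s + 1 - i)) m

/-- The series `G_s`. -/
def G (s : ℕ) : QSeries :=
  formalSum (diagonalTerms s) + ∑ i ∈ Finset.Icc 1 s, formalSum (offDiagonalTerms s i)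

/-- The terms `(-1)^r q^{r(r+1)/2 + m r}` of a false theta function. -/
def falseThetaTerms (m : ℤ) (r : ℕ) : QSeries :=
  (-1) ^ r * q ((r : ℚ) * (r + 1) / 2 + m * r)

/-- The false theta function `Φ_m`, where `Φ_m = Φ_{-m}` for `m > 0`. -/
def Φ (m : ℤ) : QSeries :=
  if m ≤ 0 then formalSum (falseThetaTerms m) else formalSum (falseThetaTerms (-m))

end ParafermionSl2

end

/-! Write φ_i = ∑_{n ≥ 0} (-1)^n q^{n(n+1)/2 + (n+1)i} (`falseTheta`). Both (q;q)_∞² ch[N^k(2s)] and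
G_s are computed to be q^{2s(s+1)} (1 - 2 φ_{s+1}). The expression in the Φ_m is the same series,
because Φ_{-M} = φ_M (`formalSum_falseTheta`) and φ_0 + φ_1 = 1.

Character. A Poincaré–Birkhoff–Witt theorem for induced modules (`InducedPBW`, specialised in `pbw`)
gives the generalized Verma module a basis of ordered monomials in h(-n), e(-n), f(-n), times weight
vectors of the inducing module. The Sugawara operator and h(0) are diagonal on this basis. Since the
level is nonzero, the module is the direct sum of its Heisenberg vacuum space and the span of the
images of the h(-n) (`HeisenbergModule.isCompl_vacuum`). That span has as basis the monomials
containing some h(-n), so the remaining monomials project to an eigenbasis of the vacuum space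
(`exists_vacuum_basis`). N^k(2s) is the kernel of h(0) there, and on it the parafermion L(0) agrees
with the Sugawara operator. Hence the character counts pairs of partitions (the modes of e and of f)
whose numbers of parts differ by one of -s, …, s, shifted by the Casimir value 2s(s+1), an integer
because k + 2 = 1/2. Euler's two identities show that (q;q)_∞² times the generating function of
pairs with difference i is φ_i - φ_{i+1} (`qInf_sq_mul_partPairs`), and the sum over the differences
telescopes (`qInf_sq_mul_card`).

The series G_s. For n = m + 3d the exponents of F_{m,n} are integral and F_{m,n} = F_{n,m} is a
signed sum of six monomials (`kernel`). Summed over m ≥ s + 1 - d, the two extreme monomials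
telescope in m, while the middle four cancel between d and d + 1. The remainder
(`kernelSum_partial_sum`) is q^{2s(s+1)} plus twice boundary terms, which are, up to a common sign,
the even and odd terms of q^{2s(s+1)} φ_{s+1} (`X_pow_mul_falseTheta`). -/

noncomputable section

/-! ### A Poincaré–Birkhoff–Witt theorem for induced modules -/


namespace InducedPBW

/-- A Lie algebra `L` with linearly ordered linearly independent elements `b j`, coordinate
functionals `c` of these elements whose common kernel is a subalgebra, and a representation `ρ`
of this subalgebra on `V`. -/
structure Datum (R L J V : Type*) [CommRing R] [LieRing L] [LieAlgebra R L] [AddCommGroup V]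
    [Module R V] where
  b : J → L
  c : L →ₗ[R] (J →₀ R)
  ρ : L →ₗ[R] Module.End R V
  c_b : ∀ j, c (b j) = Finsupp.single j 1
  lie_mem : ∀ x y, c x = 0 → c y = 0 → c ⁅x, y⁆ = 0
  ρ_lie : ∀ x y, c x = 0 → c y = 0 → ρ ⁅x, y⁆ = ρ x * ρ y - ρ y * ρ x

variable {R L J V : Type*} [CommRing R] [LieRing L] [LieAlgebra R L] [AddCommGroup V]
  [Module R V]

/-- Multiplication of a monomial by `b j`. -/
def ins (R : Type*) {J V : Type*} [CommRing R] [AddCommGroup V] [Module R V] (j : J) :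
    Module.End R (Multiset J →₀ V) :=
  Finsupp.lmapDomain V R (fun m => j ::ₘ m)

@[simp]
lemma ins_single (j : J) (m : Multiset J) (v : V) :
    ins R j (Finsupp.single m v) = Finsupp.single (j ::ₘ m) v := by
  simp [ins]

lemma exists_min [LinearOrder J] (m : Multiset J) (hm : m ≠ 0) :
    ∃ (j : J) (t : Multiset J), m = j ::ₘ t ∧ ∀ i ∈ t, j ≤ i := by
  obtain ⟨j, hj, hmin⟩ := m.toFinset.exists_min_image id
    (by simpa [Multiset.toFinset_nonempty] using hm)
  rw [Multiset.mem_toFinset] at hj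
  obtain ⟨t, rfl⟩ := Multiset.exists_cons_of_mem hj
  exact ⟨j, t, rfl, fun i hi => hmin i (by simp [hi])⟩

open Classical in
/-- The smallest index of a monomial together with the remaining monomial. -/
def split [LinearOrder J] (m : Multiset J) : Option (J × Multiset J) :=
  if hm : m ≠ 0 then some ((exists_min m hm).choose, (exists_min m hm).choose_spec.choose)
  else none

@[simp]
lemma split_zero [LinearOrder J] : split (0 : Multiset J) = none := by simp [split]

lemma split_cons [LinearOrder J] (j : J) (m : Multiset J) (h : ∀ i ∈ m, j ≤ i) :
    split (j ::ₘ m) = some (j, m) := by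
  have hne : j ::ₘ m ≠ 0 := Multiset.cons_ne_zero
  have key : ∀ p t, j ::ₘ m = p ::ₘ t → (∀ i ∈ t, p ≤ i) → p = j ∧ t = m := by
    intro p t h1 h2
    have hj : p = j := by
      apply le_antisymm
      · have : j ∈ p ::ₘ t := h1 ▸ Multiset.mem_cons_self j m
        rcases Multiset.mem_cons.mp this with h | h
        · exact h.ge
        · exact h2 _ h
      · have : p ∈ j ::ₘ m := h1 ▸ Multiset.mem_cons_self p t
        rcases Multiset.mem_cons.mp this with h' | h'
        · exact h'.ge
        · exact h _ h'
    rw [hj, Multiset.cons_inj_right] at h1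
    exact ⟨hj, h1.symm⟩
  obtain ⟨h1, h2⟩ := (exists_min _ hne).choose_spec.choose_spec
  obtain ⟨h3, h4⟩ := key _ _ h1 h2
  rw [split, dif_pos hne]
  exact congrArg some (Prod.ext h3 h4)

namespace Datum

/-- Elements of degree less than `n`. -/
def below (R : Type*) {J V : Type*} [CommRing R] [AddCommGroup V] [Module R V] (n : ℕ) :
    Submodule R (Multiset J →₀ V) :=
  Finsupp.supported V R {m | m.card < n}

lemma below_mono {n k : ℕ} (h : n ≤ k) : below (J := J) (V := V) R n ≤ below R k :=
  Finsupp.supported_mono fun _ hm => lt_of_lt_of_le hm h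

lemma single_mem_below {n : ℕ} {m : Multiset J} (h : m.card < n) (v : V) :
    Finsupp.single m v ∈ below R n := Finsupp.single_mem_supported R v h

lemma below_induction {n : ℕ} {P : (Multiset J →₀ V) → Prop}
    (hs : ∀ m v, m.card < n → P (Finsupp.single m v)) (h0 : P 0)
    (hadd : ∀ a b, P a → P b → P (a + b)) {w : Multiset J →₀ V} (hw : w ∈ below R n) : P w := by
  rw [below, Finsupp.mem_supported] at hw
  rw [← Finsupp.sum_single w]
  exact Finset.sum_induction _ P hadd h0 fun m hm => hs m _ (hw hm)

/-! ### The action on monomials, by recursion on degree -/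

variable (D : Datum R L J V)

/-- The leading part of the action of `x`. -/
def mul : L →ₗ[R] Module.End R (Multiset J →₀ V) :=
  (Finsupp.linearCombination R (ins R (V := V))) ∘ₗ D.c

/-- The component of `x` in the subalgebra. -/
def top : L →ₗ[R] L := LinearMap.id - (Finsupp.linearCombination R D.b) ∘ₗ D.c

lemma c_top (x : L) : D.c (D.top x) = 0 := by
  have : ∀ z : J →₀ R, D.c (Finsupp.linearCombination R D.b z) = z := by
    intro z
    induction z using Finsupp.induction_linear with
    | zero => simp
    | add a b ha hb => rw [map_add, map_add, ha, hb]
    | single i r => simp [D.c_b]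
  simp [top, this]

lemma mul_mem {n : ℕ} (x : L) {w : Multiset J →₀ V} (hw : w ∈ below R n) :
    D.mul x w ∈ below R (n + 1) := by
  refine below_induction (P := fun w => D.mul x w ∈ below R (n + 1)) ?_ ?_ ?_ hw
  · intro m v hm
    rw [mul, LinearMap.comp_apply, Finsupp.linearCombination_apply, Finsupp.sum,
      LinearMap.sum_apply]
    refine Submodule.sum_mem _ fun i _ => ?_
    rw [LinearMap.smul_apply, ins_single]
    exact Submodule.smul_mem _ _ (single_mem_below (by simpa using hm) _)
  · simp
  · intro a b ha hb
    rw [map_add]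
    exact Submodule.add_mem _ ha hb

lemma mul_b (j : J) : D.mul (D.b j) = ins R j := by simp [mul, D.c_b]

variable [LinearOrder J]

/-- The part of `x` along the `b i`, `i ≤ j`. -/
def low (j : J) : L →ₗ[R] L :=
  (Finsupp.linearCombination R fun i => if i ≤ j then D.b i else 0) ∘ₗ D.c

/-- The component of `x` beyond the `b i`, `i ≤ j`. -/
def up (j : J) : L →ₗ[R] L := LinearMap.id - D.low j

/-- The recursion step for the action on a monomial. -/
def stepAt (A : L →ₗ[R] Module.End R (Multiset J →₀ V)) (m : Multiset J) :
    L →ₗ[R] V →ₗ[R] (Multiset J →₀ V) :=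
  match split m with
  | none => (LinearMap.lcomp R (Multiset J →₀ V) (Finsupp.lsingle 0)) ∘ₗ D.mul +
      (LinearMap.llcomp R V V (Multiset J →₀ V) (Finsupp.lsingle 0)) ∘ₗ D.ρ ∘ₗ D.top
  -- This encodes x b_j m' = b_j x m' + [x, b_j] m' for the part of x beyond j. The leading part of
  -- x m' is removed inside and restored outside as `mul x`, so `A` is only applied in degrees at
  -- most that of m', which makes the recursion well-founded.
  | some (j, m') => (LinearMap.lcomp R (Multiset J →₀ V) (Finsupp.lsingle m)) ∘ₗ D.mul +
      (LinearMap.llcomp R V (Multiset J →₀ V) (Multiset J →₀ V) (A (D.b j))) ∘ₗ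
        (LinearMap.lcomp R (Multiset J →₀ V) (Finsupp.lsingle m')) ∘ₗ (A - D.mul) ∘ₗ D.up j +
      (LinearMap.lcomp R (Multiset J →₀ V) (Finsupp.lsingle m')) ∘ₗ A ∘ₗ
        ((LieAlgebra.ad R L : L →ₗ[R] Module.End R L) (-D.b j)) ∘ₗ D.up j

lemma stepAt_zero (A : L →ₗ[R] Module.End R (Multiset J →₀ V)) (x : L) (v : V) :
    D.stepAt A 0 x v = D.mul x (Finsupp.single 0 v) + Finsupp.single 0 (D.ρ (D.top x) v) := by
  simp [stepAt]

lemma stepAt_cons (A : L →ₗ[R] Module.End R (Multiset J →₀ V)) (j : J) (m : Multiset J)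
    (h : ∀ i ∈ m, j ≤ i) (x : L) (v : V) :
    D.stepAt A (j ::ₘ m) x v = D.mul x (Finsupp.single (j ::ₘ m) v) +
      A (D.b j) (A (D.up j x) (Finsupp.single m v) - D.mul (D.up j x) (Finsupp.single m v)) +
      A ⁅D.up j x, D.b j⁆ (Finsupp.single m v) := by
  simp only [stepAt, split_cons j m h]
  simp
  rw [← lie_skew, map_neg, LinearMap.neg_apply, neg_neg]

/-- The recursion step for the action. -/
def step (A : L →ₗ[R] Module.End R (Multiset J →₀ V)) :
    L →ₗ[R] Module.End R (Multiset J →₀ V) :=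
  (Finsupp.lsum R (M := V) (N := Multiset J →₀ V)).toLinearMap ∘ₗ LinearMap.pi (D.stepAt A)

lemma step_single (A : L →ₗ[R] Module.End R (Multiset J →₀ V)) (x : L) (m : Multiset J) (v : V) :
    D.step A x (Finsupp.single m v) = D.stepAt A m x v := by
  simp [step]

/-- The approximation of the action which is correct on monomials of degree less than `n`. -/
def approx : ℕ → L →ₗ[R] Module.End R (Multiset J →₀ V)
  | 0 => 0
  | n + 1 => D.step (approx n)

/-- Reordering a product only produces corrections that do not exceed the original degree. This
bound keeps each inner call of the recursion in the range where the previous approximation is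
already correct. -/
lemma approx_sub_mul_mem (n : ℕ) : ∀ (x : L) (k : ℕ) (w : Multiset J →₀ V), k ≤ n →
    w ∈ below R k → D.approx n x w - D.mul x w ∈ below R k := by
  induction n with
  | zero =>
    intro x k w hk hw
    obtain rfl : k = 0 := by omega
    have : w = 0 := by
      refine below_induction (P := fun w => w = 0) ?_ rfl ?_ hw
      · intro m v hm; omega
      · rintro a b rfl rfl; simp
    simp [this]
  | succ n ih =>
    intro x k w hk hw
    refine below_induction (P := fun w => D.approx (n + 1) x w - D.mul x w ∈ below R k) ?_ ?_ ?_ hw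
    · intro m v hm
      rw [approx, step_single]
      by_cases h0 : m = 0
      · subst h0
        rw [stepAt_zero, add_sub_cancel_left]
        exact single_mem_below hm _
      · obtain ⟨j, m', rfl, hj⟩ := exists_min m h0
        rw [Multiset.card_cons] at hm
        rw [stepAt_cons _ _ _ _ hj, add_assoc, add_sub_cancel_left]
        have key : ∀ (y : L) (w : Multiset J →₀ V), w ∈ below R (m'.card + 1) →
            D.approx n y w ∈ below R k := by
          intro y w hw
          have h1 := ih y (m'.card + 1) w (by omega) hw
          have h2 := Submodule.add_mem _ (below_mono (Nat.le_succ _) h1) (D.mul_mem y hw)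
          rw [sub_add_cancel] at h2
          exact below_mono (by omega) h2
        refine Submodule.add_mem _ (key _ _ ?_) (key _ _ (single_mem_below (by omega) _))
        exact ih _ _ _ (by omega) (single_mem_below (by omega) _)
    · simp
    · intro a b ha hb
      rw [map_add, map_add, add_sub_add_comm]
      exact Submodule.add_mem _ ha hb

/-- The approximations stabilise on each degree, since by `approx_sub_mul_mem` the recursion for a
monomial of degree d only consults degrees less than d. Hence `act` is a well-defined limit. -/
lemma approx_succ (n : ℕ) : ∀ (x : L) (w : Multiset J →₀ V), w ∈ below R n →
    D.approx (n + 1) x w = D.approx n x w := by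
  induction n with
  | zero =>
    intro x w hw
    refine below_induction (P := fun w => D.approx 1 x w = D.approx 0 x w) ?_ ?_ ?_ hw
    · intro m v hm; omega
    · simp
    · intro a b ha hb; simp [ha, hb]
  | succ n ih =>
    intro x w hw
    refine below_induction (P := fun w => D.approx (n + 2) x w = D.approx (n + 1) x w) ?_ ?_ ?_ hw
    · intro m v hm
      rw [approx, approx, step_single, step_single]
      by_cases h0 : m = 0
      · subst h0
        rw [stepAt_zero, stepAt_zero]
      · obtain ⟨j, m', rfl, hj⟩ := exists_min m h0
        rw [Multiset.card_cons] at hm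
        have hm' : ∀ v : V, Finsupp.single m' v ∈ below R n := single_mem_below (by omega)
        rw [stepAt_cons _ _ _ _ hj, stepAt_cons _ _ _ _ hj]
        change _ + D.approx (n + 1) _ (D.approx (n + 1) _ _ - _) + D.approx (n + 1) _ _ = _
        rw [ih _ _ (hm' v), ih _ _ (hm' v), ih]
        exact below_mono (by omega)
          (D.approx_sub_mul_mem n _ (m'.card + 1) _ (by omega) (single_mem_below (by omega) _))
    · simp
    · intro a b ha hb; simp [ha, hb]

lemma approx_eq {n k : ℕ} (h : n ≤ k) (x : L) {w : Multiset J →₀ V} (hw : w ∈ below R n) :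
    D.approx k x w = D.approx n x w := by
  induction k, h using Nat.le_induction with
  | base => rfl
  | succ k hk ih => rw [approx_succ _ _ _ _ (below_mono hk hw), ih]

/-- The action of `L` on the induced module. -/
def act : L →ₗ[R] Module.End R (Multiset J →₀ V) :=
  (Finsupp.lsum R (M := V) (N := Multiset J →₀ V)).toLinearMap ∘ₗ
    LinearMap.pi fun m => D.stepAt (D.approx m.card) m

lemma act_eq_approx {n : ℕ} (x : L) {w : Multiset J →₀ V} (hw : w ∈ below R n) :
    D.act x w = D.approx n x w := by
  refine below_induction (P := fun w => D.act x w = D.approx n x w) ?_ ?_ ?_ hw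
  · intro m v hm
    rw [approx_eq _ (show m.card + 1 ≤ n from hm) _ (single_mem_below (by omega) v), approx,
      step_single]
    simp [act]
  · simp
  · intro a b ha hb; simp [ha, hb]

lemma act_zero (x : L) (v : V) : D.act x (Finsupp.single 0 v) =
    D.mul x (Finsupp.single 0 v) + Finsupp.single 0 (D.ρ (D.top x) v) := by
  rw [← stepAt_zero _ (D.approx 0)]
  simp [act]

lemma act_sub_mul_mem (x : L) {n : ℕ} {w : Multiset J →₀ V} (hw : w ∈ below R n) :
    D.act x w - D.mul x w ∈ below R n := by
  rw [D.act_eq_approx x hw]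
  exact D.approx_sub_mul_mem n x n w le_rfl hw

/-- The recursion with all approximations replaced by their limit; together with `act_zero` it is
all that is used about `act` afterwards, apart from the degree bound. -/
lemma act_cons (j : J) (m : Multiset J) (h : ∀ i ∈ m, j ≤ i) (x : L) (v : V) :
    D.act x (Finsupp.single (j ::ₘ m) v) = D.mul x (Finsupp.single (j ::ₘ m) v) +
      D.act (D.b j)
        (D.act (D.up j x) (Finsupp.single m v) - D.mul (D.up j x) (Finsupp.single m v)) +
      D.act ⁅D.up j x, D.b j⁆ (Finsupp.single m v) := by
  have hm : Finsupp.single m v ∈ below R (m.card + 1) := single_mem_below (by omega) v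
  rw [D.act_eq_approx (D.b j) (D.act_sub_mul_mem _ hm), D.act_eq_approx _ hm,
    D.act_eq_approx _ hm]
  simp only [act, LinearMap.comp_apply, LinearEquiv.coe_coe, Finsupp.lsum_single]
  rw [LinearMap.pi_apply, Multiset.card_cons]
  exact D.stepAt_cons _ j m h x v

lemma c_up (j : J) (x : L) : D.c (D.up j x) = (D.c x).filter fun i => ¬ i ≤ j := by
  have : ∀ z : J →₀ R, D.c (Finsupp.linearCombination R
      (fun i => if i ≤ j then D.b i else 0) z) = z.filter fun i => i ≤ j := by
    intro z
    induction z using Finsupp.induction_linear with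
    | zero => rw [map_zero, map_zero, Finsupp.filter_zero]
    | add a b ha hb => rw [map_add, map_add, ha, hb, Finsupp.filter_add]
    | single i r =>
      rw [Finsupp.linearCombination_single]
      split_ifs with hi
      · simp [D.c_b, hi]
      · simp [hi]
  rw [up, LinearMap.sub_apply, map_sub, low, LinearMap.comp_apply, this, LinearMap.id_apply,
    sub_eq_iff_eq_add, add_comm]
  exact (Finsupp.filter_add_filter_not _ _).symm

lemma act_b_of_le (j : J) (m : Multiset J) (h : ∀ i ∈ m, j ≤ i) (v : V) :
    D.act (D.b j) (Finsupp.single m v) = Finsupp.single (j ::ₘ m) v := by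
  by_cases h0 : m = 0
  · subst h0
    rw [act_zero, mul_b, ins_single]
    simp [top, D.c_b]
  · obtain ⟨k, m', rfl, hk⟩ := exists_min m h0
    have hjk : j ≤ k := h k (by simp)
    have hup : D.up k (D.b j) = 0 := by
      simp [up, low, D.c_b, hjk]
    rw [act_cons _ _ _ hk, hup, mul_b, ins_single]
    simp

lemma low_up (j : J) (x : L) : D.low j (D.up j x) = 0 := by
  rw [low, LinearMap.comp_apply, c_up, Finsupp.linearCombination_apply]
  refine Finset.sum_eq_zero fun i hi => ?_
  have : ¬ i ≤ j := by
    rw [Finsupp.support_filter, Finset.mem_filter] at hi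
    exact hi.2
  simp [this]

lemma up_up (j : J) (x : L) : D.up j (D.up j x) = D.up j x := by
  rw [up, LinearMap.sub_apply, LinearMap.id_apply, ← up, low_up, sub_zero]

lemma mul_up_induction {P : (Multiset J →₀ V) → Prop} (j : J) (x : L) (m : Multiset J) (v : V)
    (hs : ∀ i, j ≤ i → P (Finsupp.single (i ::ₘ m) v)) (h0 : P 0)
    (hadd : ∀ a b, P a → P b → P (a + b)) (hsmul : ∀ (r : R) a, P a → P (r • a)) :
    P (D.mul (D.up j x) (Finsupp.single m v)) := by
  rw [mul, LinearMap.comp_apply, c_up, Finsupp.linearCombination_apply, Finsupp.sum,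
    LinearMap.sum_apply]
  refine Finset.sum_induction _ P hadd h0 fun i hi => ?_
  rw [Finsupp.support_filter, Finset.mem_filter, not_le] at hi
  rw [LinearMap.smul_apply, ins_single]
  exact hsmul _ _ (hs i hi.2.le)

lemma act_b_mul_up (j : J) (m : Multiset J) (h : ∀ i ∈ m, j ≤ i) (x : L) (v : V) :
    D.act (D.b j) (D.mul (D.up j x) (Finsupp.single m v)) =
      D.mul (D.up j x) (Finsupp.single (j ::ₘ m) v) := by
  have h1 : D.mul (D.up j x) (Finsupp.single (j ::ₘ m) v) =
      ins R j (D.mul (D.up j x) (Finsupp.single m v)) := by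
    simp only [mul, LinearMap.comp_apply, Finsupp.linearCombination_apply, Finsupp.sum,
      LinearMap.sum_apply, LinearMap.smul_apply, ins_single, map_sum, map_smul]
    simp only [Multiset.cons_swap]
  rw [h1]
  refine D.mul_up_induction (P := fun w => D.act (D.b j) w = ins R j w) j x m v ?_ ?_ ?_ ?_
  · intro i hi
    rw [ins_single]
    exact D.act_b_of_le j _ (fun l hl => (Multiset.mem_cons.mp hl).elim (· ▸ hi) (h l)) v
  · simp
  · intro a b ha hb; simp [ha, hb]
  · intro r a ha; simp [ha]

/-! ### The action respects brackets -/

/-- The failure of `act` to be a representation. -/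
def defect : L →ₗ[R] L →ₗ[R] Module.End R (Multiset J →₀ V) :=
  LinearMap.mk₂ R (fun x y => D.act x * D.act y - D.act y * D.act x - D.act ⁅x, y⁆)
    (fun x y z => by simp [add_mul, mul_add]; abel)
    (fun r x y => by simp [smul_sub])
    (fun x y z => by simp [add_mul, mul_add]; abel)
    (fun r x y => by simp [smul_sub])

lemma defect_apply (x y : L) (w : Multiset J →₀ V) : D.defect x y w =
    D.act x (D.act y w) - D.act y (D.act x w) - D.act ⁅x, y⁆ w := rfl

lemma defect_swap (x y : L) : D.defect x y = - D.defect y x := by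
  refine LinearMap.ext fun w => ?_
  rw [LinearMap.neg_apply, defect_apply, defect_apply, ← lie_skew x y, map_neg,
    LinearMap.neg_apply]
  abel

/-- The recursion `act_cons` was set up to make this case true: b_j times the leading part of x m is
exactly the leading part of x on the longer monomial. -/
lemma defect_up_b (j : J) (m : Multiset J) (h : ∀ i ∈ m, j ≤ i) (x : L) (v : V) :
    D.defect (D.up j x) (D.b j) (Finsupp.single m v) = 0 := by
  rw [defect_apply, D.act_b_of_le j m h, D.act_cons j m h, up_up, map_sub, D.act_b_mul_up j m h]
  abel

/-- Beyond j this is `defect_up_b`. For a component b_i with i < j the roles are exchanged by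
antisymmetry: i is also a lower bound of m, and b_j lies beyond i. -/
lemma defect_b (j : J) (m : Multiset J) (h : ∀ i ∈ m, j ≤ i) (x : L) (v : V) :
    D.defect x (D.b j) (Finsupp.single m v) = 0 := by
  have hx : x = D.low j x + D.up j x := by simp [up]
  have hlow : ∀ z : J →₀ R, D.defect (Finsupp.linearCombination R
      (fun i => if i ≤ j then D.b i else 0) z) (D.b j) (Finsupp.single m v) = 0 := by
    intro z
    induction z using Finsupp.induction_linear with
    | zero => simp
    | add a b ha hb => simp [ha, hb]
    | single i r =>
      rw [Finsupp.linearCombination_single]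
      split_ifs with hi
      · have : D.defect (D.b i) (D.b j) (Finsupp.single m v) = 0 := by
          rcases hi.eq_or_lt with rfl | hlt
          · simp [defect_apply]
          · have h1 := D.defect_up_b i m (fun l hl => hi.trans (h l hl)) (D.b j) v
            have h2 : D.up i (D.b j) = D.b j := by simp [up, low, D.c_b, hlt.not_ge]
            rw [h2, defect_swap, LinearMap.neg_apply, neg_eq_zero] at h1
            exact h1
        simp [this]
      · simp
  rw [hx, map_add, LinearMap.add_apply, LinearMap.add_apply, D.defect_up_b j m h, add_zero]
  exact hlow _

lemma defect_of_low (j : J) (m : Multiset J) (h : ∀ i ∈ m, j ≤ i) (x y : L) (v : V) :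
    D.defect (D.low j x) y (Finsupp.single m v) = 0 := by
  have hlow : ∀ z : J →₀ R, D.defect (Finsupp.linearCombination R
      (fun i => if i ≤ j then D.b i else 0) z) y (Finsupp.single m v) = 0 := by
    intro z
    induction z using Finsupp.induction_linear with
    | zero => simp
    | add a b ha hb => simp [ha, hb]
    | single i r =>
      rw [Finsupp.linearCombination_single]
      split_ifs with hi
      · have := D.defect_b i m (fun l hl => hi.trans (h l hl)) y v
        rw [defect_swap, LinearMap.neg_apply, neg_eq_zero] at this
        simp [this]
      · simp
  exact hlow _

lemma act_of_c_eq_zero {x : L} (hx : D.c x = 0) (v : V) :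
    D.act x (Finsupp.single 0 v) = Finsupp.single 0 (D.ρ x v) := by
  simp [act_zero, mul, top, hx]

lemma defect_zero (x y : L) (v : V) : D.defect x y (Finsupp.single 0 v) = 0 := by
  have hb : ∀ (z : J →₀ R) (y : L),
      D.defect y (Finsupp.linearCombination R D.b z) (Finsupp.single 0 v) = 0 := by
    intro z y
    induction z using Finsupp.induction_linear with
    | zero => simp
    | add a b ha hb => simp [ha, hb]
    | single i r => simp [D.defect_b i 0 (by simp) y v]
  have hdec : ∀ x, x = D.top x + Finsupp.linearCombination R D.b (D.c x) := by
    intro x; simp [top]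
  rw [hdec y, map_add, LinearMap.add_apply, hb, add_zero, defect_swap, hdec x, map_add,
    LinearMap.neg_apply, LinearMap.add_apply, hb, add_zero, neg_eq_zero, defect_apply,
    D.act_of_c_eq_zero (D.c_top x), D.act_of_c_eq_zero (D.c_top y),
    D.act_of_c_eq_zero (D.c_top y), D.act_of_c_eq_zero (D.c_top x),
    D.act_of_c_eq_zero (D.lie_mem _ _ (D.c_top y) (D.c_top x)),
    D.ρ_lie _ _ (D.c_top y) (D.c_top x)]
  simp

/-- Induction on degree. For a monomial b_k u with k minimal, components of x and y along b_i, i ≤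
k, are covered by `defect_of_low`, so both may be taken beyond k. Then b_k is moved to the left of x
and y, where the induction hypothesis applies to u, and the bracket terms cancel by the Jacobi
identity. -/
lemma defect_of_below (n : ℕ) : ∀ (w : Multiset J →₀ V) (x y : L), w ∈ below R n →
    D.defect x y w = 0 := by
  induction n with
  | zero =>
    intro w x y hw
    refine below_induction (P := fun w => D.defect x y w = 0) ?_ ?_ ?_ hw
    · intro m v hm; omega
    · simp
    · intro a b ha hb; simp [ha, hb]
  | succ n ih =>
    intro w x y hw
    refine below_induction (P := fun w => D.defect x y w = 0) ?_ ?_ ?_ hw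
    · intro m v hm
      by_cases h0 : m = 0
      · rw [h0, defect_zero]
      · obtain ⟨k, m', rfl, hk⟩ := exists_min m h0
        have hkm : ∀ i ∈ k ::ₘ m', k ≤ i := fun i hi =>
          (Multiset.mem_cons.mp hi).elim (fun h => h.ge) (hk i)
        have hdec : ∀ x, x = D.low k x + D.up k x := by intro x; simp [up]
        rw [hdec x, map_add, LinearMap.add_apply, LinearMap.add_apply, D.defect_of_low k _ hkm,
          zero_add, defect_swap, LinearMap.neg_apply, neg_eq_zero, hdec y, map_add,
          LinearMap.add_apply, LinearMap.add_apply, D.defect_of_low k _ hkm, zero_add]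
        have hB := D.act_b_of_le k m' hk v
        have hw0 : Finsupp.single m' v ∈ below R n :=
          single_mem_below (by simpa using hm) v
        -- The vector y u may have the same degree as b_k u, so induction alone is not enough. Its
        -- correction part has small degree; its leading part consists of monomials with all indices
        -- ≥ k, for which `defect_b` needs no induction.
        have hB2 : ∀ x y, D.defect x (D.b k) (D.act (D.up k y) (Finsupp.single m' v)) = 0 := by
          intro x y
          rw [← sub_add_cancel (D.act (D.up k y) (Finsupp.single m' v))
            (D.mul (D.up k y) (Finsupp.single m' v)), map_add,
            ih _ _ _ (D.act_sub_mul_mem _ hw0), zero_add]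
          refine D.mul_up_induction (P := fun w => D.defect x (D.b k) w = 0) k y m' v ?_ ?_ ?_ ?_
          · intro i hi
            exact D.defect_b k _
              (fun l hl => (Multiset.mem_cons.mp hl).elim (fun h => h ▸ hi) (hk l)) x v
          · simp
          · intro a b ha hb; simp [ha, hb]
          · intro r a ha; simp [ha]
        generalize hu : Finsupp.single m' v = u at *
        have e1 := ih u (D.up k y) (D.up k x) hw0
        have e2 := D.defect_b k m' hk (D.up k y) v
        have e3 := D.defect_b k m' hk (D.up k x) v
        have e4 := ih u (D.up k y) ⁅D.up k x, D.b k⁆ hw0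
        have e5 := ih u (D.up k x) ⁅D.up k y, D.b k⁆ hw0
        have e6 := ih u ⁅D.up k y, D.up k x⁆ (D.b k) hw0
        have e7 := hB2 (D.up k y) x
        have e8 := hB2 (D.up k x) y
        rw [hu] at e2 e3
        generalize D.up k x = X at *
        generalize D.up k y = Y at *
        rw [← hB, defect_apply]
        rw [defect_apply, sub_sub, sub_eq_zero] at e1 e2 e3 e4 e5 e6 e7 e8
        rw [e2, e3, map_add, map_add, e4, e5, e6, e7, e8, e1, lie_lie, map_sub, map_add,
          LinearMap.sub_apply]
        abel
    · simp
    · intro a b ha hb; simp [ha, hb]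

lemma act_lie (x y : L) : D.act ⁅x, y⁆ = D.act x * D.act y - D.act y * D.act x := by
  ext1 m
  ext1 v
  have := D.defect_of_below (m.card + 1) (Finsupp.single m v) x y (single_mem_below (by omega) v)
  rw [defect_apply, sub_eq_zero] at this
  exact this.symm

end Datum
end InducedPBW

/-! ### Intertwining maps out of the induced module -/

namespace InducedPBW

variable {R L J V : Type*} [CommRing R] [LieRing L] [LieAlgebra R L] [AddCommGroup V]
  [Module R V] [LinearOrder J] (D : Datum R L J V) {W : Type*} [AddCommGroup W] [Module R W]

/-- A map from the induced module which is compatible with ordered products and with the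
subalgebra commutes with the action. -/
lemma Datum.map_act (σ : L →ₗ[R] Module.End R W)
    (hσ : ∀ x y, σ ⁅x, y⁆ = σ x * σ y - σ y * σ x) (ψ : (Multiset J →₀ V) →ₗ[R] W)
    (hcons : ∀ (j : J) (m : Multiset J) (v : V), (∀ i ∈ m, j ≤ i) →
      ψ (Finsupp.single (j ::ₘ m) v) = σ (D.b j) (ψ (Finsupp.single m v)))
    (hzero : ∀ (x : L) (v : V), D.c x = 0 →
      ψ (Finsupp.single 0 (D.ρ x v)) = σ x (ψ (Finsupp.single 0 v)))
    (x : L) (w : Multiset J →₀ V) : ψ (D.act x w) = σ x (ψ w) := by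
  set err : L →ₗ[R] (Multiset J →₀ V) →ₗ[R] W :=
    (LinearMap.llcomp R (Multiset J →₀ V) (Multiset J →₀ V) W ψ) ∘ₗ D.act -
      (LinearMap.lcomp R W ψ) ∘ₗ σ with herr
  have happ : ∀ x w, err x w = ψ (D.act x w) - σ x (ψ w) := fun x w => by simp [herr]
  have hb : ∀ (j : J) (m : Multiset J) (v : V), (∀ i ∈ m, j ≤ i) →
      err (D.b j) (Finsupp.single m v) = 0 := by
    intro j m v hj
    rw [happ, D.act_b_of_le j m hj, hcons j m v hj, sub_self]
  have hlow : ∀ (j : J) (m : Multiset J) (v : V), (∀ i ∈ m, j ≤ i) → ∀ x,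
      err (D.low j x) (Finsupp.single m v) = 0 := by
    intro j m v hj x
    have : ∀ z : J →₀ R, err (Finsupp.linearCombination R
        (fun i => if i ≤ j then D.b i else 0) z) (Finsupp.single m v) = 0 := by
      intro z
      induction z using Finsupp.induction_linear with
      | zero => simp
      | add a b ha hb => rw [map_add, map_add, LinearMap.add_apply, ha, hb, add_zero]
      | single i r =>
        rw [Finsupp.linearCombination_single]
        split_ifs with hi
        · rw [map_smul, LinearMap.smul_apply, hb i m v fun l hl => hi.trans (hj l hl), smul_zero]
        · simp
    exact this _
  have key : ∀ n, ∀ w ∈ Datum.below (J := J) (V := V) R n, ∀ x, err x w = 0 := by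
    intro n
    induction n with
    | zero =>
      intro w hw x
      refine Datum.below_induction (P := fun w => err x w = 0) ?_ ?_ ?_ hw
      · intro m v hm; omega
      · simp
      · intro a b ha hb; simp [ha, hb]
    | succ n ih =>
      intro w hw x
      refine Datum.below_induction (P := fun w => err x w = 0) ?_ ?_ ?_ hw
      · intro m v hm
        by_cases h0 : m = 0
        · subst h0
          have hdec : x = D.top x + Finsupp.linearCombination R D.b (D.c x) := by simp [Datum.top]
          have hz : ∀ z : J →₀ R,
              err (Finsupp.linearCombination R D.b z) (Finsupp.single 0 v) = 0 := by
            intro z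
            induction z using Finsupp.induction_linear with
            | zero => simp
            | add a b ha hb => rw [map_add, map_add, LinearMap.add_apply, ha, hb, add_zero]
            | single i r => simp [hb i 0 v]
          rw [hdec, map_add, LinearMap.add_apply, hz, add_zero, happ,
            D.act_of_c_eq_zero (D.c_top x), hzero _ _ (D.c_top x), sub_self]
        · obtain ⟨k, m', rfl, hk⟩ := exists_min m h0
          have hkm : ∀ i ∈ k ::ₘ m', k ≤ i := fun i hi =>
            (Multiset.mem_cons.mp hi).elim (fun h => h.ge) (hk i)
          have hdec : x = D.low k x + D.up k x := by simp [Datum.up]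
          have hw0 : Finsupp.single m' v ∈ Datum.below R n :=
            Datum.single_mem_below (by simpa using hm) v
          have hB2 : err (D.b k) (D.act (D.up k x) (Finsupp.single m' v)) = 0 := by
            rw [← sub_add_cancel (D.act (D.up k x) (Finsupp.single m' v))
              (D.mul (D.up k x) (Finsupp.single m' v)), map_add,
              ih _ (D.act_sub_mul_mem _ hw0), zero_add]
            refine D.mul_up_induction (P := fun w => err (D.b k) w = 0) k x m' v ?_ ?_ ?_ ?_
            · intro i hi
              exact hb k _ _ fun l hl => (Multiset.mem_cons.mp hl).elim (fun h => h ▸ hi) (hk l)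
            · simp
            · intro a b ha hb; simp [ha, hb]
            · intro r a ha; simp [ha]
          have e1 := ih _ hw0 (D.up k x)
          have e2 := ih _ hw0 ⁅D.up k x, D.b k⁆
          rw [hdec, map_add, LinearMap.add_apply, hlow k _ v hkm, zero_add, happ, hcons k m' v hk,
            ← D.act_b_of_le k m' hk]
          rw [happ, sub_eq_zero] at hB2 e1 e2
          rw [D.act_lie, hσ, LinearMap.sub_apply, LinearMap.sub_apply, map_sub, Module.End.mul_apply,
            Module.End.mul_apply, Module.End.mul_apply, Module.End.mul_apply, hB2, e1,
            sub_left_inj] at e2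
          rw [e2, sub_self]
      · simp
      · intro a b ha hb; simp [ha, hb]
  induction w using Finsupp.induction_linear with
  | zero => simp
  | add a b ha hb => rw [map_add, map_add, ha, hb, map_add, map_add]
  | single m v =>
    have := key (m.card + 1) (Finsupp.single m v) (Datum.single_mem_below (Nat.lt_succ_self _) v) x
    rwa [happ, sub_eq_zero] at this

end InducedPBW

namespace ParafermionSl2

/-! ### The Poincaré–Birkhoff–Witt basis of the generalized Verma modules -/

lemma lie_ef : ⁅e, f⁆ = h := by
  apply Subtype.ext
  rw [LieAlgebra.SpecialLinear.sl_bracket]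
  ext i j; fin_cases i <;> fin_cases j <;> simp [e, f, h]

lemma lie_he : ⁅h, e⁆ = (2 : ℂ) • e := by
  apply Subtype.ext
  rw [LieAlgebra.SpecialLinear.sl_bracket]
  ext i j; fin_cases i <;> fin_cases j <;> simp [e, h]; norm_num

lemma lie_hf : ⁅h, f⁆ = (-2 : ℂ) • f := by
  apply Subtype.ext
  rw [LieAlgebra.SpecialLinear.sl_bracket]
  ext i j; fin_cases i <;> fin_cases j <;> simp [f, h]; norm_num

lemma form_ef : form e f = 1 := by simp [form_apply, e, f, Matrix.trace_fin_two]
lemma form_fe : form f e = 1 := by simp [form_apply, e, f, Matrix.trace_fin_two]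
lemma form_hh : form h h = 2 := by simp [form_apply, h, Matrix.trace_fin_two]; norm_num
lemma form_he : form h e = 0 := by simp [form_apply, e, h, Matrix.trace_fin_two]
lemma form_hf : form h f = 0 := by simp [form_apply, f, h, Matrix.trace_fin_two]
lemma form_ee : form e e = 0 := by simp [form_apply, e, Matrix.trace_fin_two]
lemma form_ff : form f f = 0 := by simp [form_apply, f, Matrix.trace_fin_two]

/-- The basis `h, e, f` of `sl(2)`. -/
def gen : Fin 3 → sl2 := ![h, e, f]

/-- The coordinates with respect to `h, e, f`. -/
def coord (a : Fin 3) : sl2 →ₗ[ℂ] ℂ where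
  toFun x := ![x.val 0 0, x.val 0 1, x.val 1 0] a
  map_add' x y := by fin_cases a <;> simp
  map_smul' r x := by fin_cases a <;> simp

lemma coord_gen (a a' : Fin 3) : coord a (gen a') = if a = a' then 1 else 0 := by
  fin_cases a <;> fin_cases a' <;> simp [coord, gen, e, f, h]

lemma sum_coord_gen (x : sl2) : ∑ a, coord a x • gen a = x := by
  have hx : x.val 1 1 = -x.val 0 0 := by
    have : Matrix.trace x.val = 0 := x.property
    rw [Matrix.trace_fin_two] at this
    linear_combination this
  apply Subtype.ext
  simp only [Fin.sum_univ_three]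
  ext i j; fin_cases i <;> fin_cases j <;> simp [coord, gen, e, f, h, hx]

lemma loop_add (x y : sl2) (n : ℤ) : loop (x + y) n = loop x n + loop y n := by
  rw [loop, loop, loop, ← LieAlgebra.of_add, Prod.mk_add_mk, ← TensorProduct.tmul_add, add_zero]

lemma loop_smul (r : ℂ) (x : sl2) (n : ℤ) : loop (r • x) n = r • loop x n := by
  rw [loop, loop, ← LieAlgebra.of_smul, Prod.smul_mk, TensorProduct.tmul_smul, smul_zero]

/-- `x ↦ x tⁿ` as a linear map. -/
def loopₗ (n : ℤ) : sl2 →ₗ[ℂ] Affine where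
  toFun x := loop x n
  map_add' x y := loop_add x y n
  map_smul' r x := loop_smul r x n

lemma loopₗ_apply (n : ℤ) (x : sl2) : loopₗ n x = loop x n := rfl

variable {N : Type*} [AddCommGroup N] [Module ℂ N]

/-- The linear map on the affine Lie algebra with prescribed values on `x tⁿ` and `K`. -/
def affineLift (g : ℤ → sl2 →ₗ[ℂ] N) (z : N) : Affine →ₗ[ℂ] N where
  toFun a := Finsupp.lsum ℂ g (LieAlgebra.LoopAlgebra.toFinsupp ℂ ℤ sl2
      ((LieAlgebra.ofProd _).symm a).1) -
    (TrivialLieModule.equiv ℂ _ ℂ ((LieAlgebra.ofProd _).symm a).2) • z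
  map_add' a b := by
    rw [LieAlgebra.of_symm_add, Prod.fst_add, Prod.snd_add, map_add, map_add, map_add, add_smul]
    abel
  map_smul' r a := by
    rw [LieAlgebra.of_symm_smul, Prod.smul_fst, Prod.smul_snd, map_smul, map_smul, map_smul,
      smul_assoc, ← smul_sub, RingHom.id_apply]

lemma affineLift_loop (g : ℤ → sl2 →ₗ[ℂ] N) (z : N) (x : sl2) (n : ℤ) :
    affineLift g z (loop x n) = g n x := by
  change Finsupp.lsum ℂ g (LieAlgebra.LoopAlgebra.toFinsupp ℂ ℤ sl2 (_ ⊗ₜ x)) -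
    (TrivialLieModule.equiv ℂ _ ℂ 0) • z = _
  rw [LieAlgebra.LoopAlgebra.toFinsupp_single_tmul, Finsupp.lsum_single, map_zero, zero_smul,
    sub_zero]

lemma affineLift_central (g : ℤ → sl2 →ₗ[ℂ] N) (z : N) : affineLift g z central = z := by
  change Finsupp.lsum ℂ g (LieAlgebra.LoopAlgebra.toFinsupp ℂ ℤ sl2 0) -
    (TrivialLieModule.equiv ℂ _ ℂ ((TrivialLieModule.equiv ℂ _ ℂ).symm (-1))) • z = _
  rw [LinearEquiv.apply_symm_apply, map_zero, map_zero, neg_smul, one_smul, zero_sub, neg_neg]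

/-- The indices of the basis of `t⁻¹ sl(2)[t⁻¹]`: `(a, n)` stands for `gen a t⁻ⁿ⁻¹`. -/
abbrev Idx : Type := Fin 3 ×ₗ ℕ

/-- The basis vector `gen a t⁻ⁿ⁻¹`. -/
def neg (i : Idx) : Affine := loop (gen (ofLex i).1) (-((ofLex i).2 + 1))

/-- The coordinates with respect to the basis of `t⁻¹ sl(2)[t⁻¹]`. -/
def negCoord : Affine →ₗ[ℂ] (Idx →₀ ℂ) :=
  affineLift (fun n => if n < 0 then
    ∑ a, Finsupp.lsingle (toLex (a, (-n - 1).toNat)) ∘ₗ coord a else 0) 0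

/-- The action of `sl(2)[t] ⊕ ℂ K` on the inducing module. -/
def parabolicRep (k : ℂ) (j : ℕ) : Affine →ₗ[ℂ] Module.End ℂ (V j) :=
  affineLift (fun n => if n = 0 then rep j else 0) (k • 1)

lemma negCoord_loop_nonneg (x : sl2) (n : ℤ) (hn : 0 ≤ n) : negCoord (loop x n) = 0 := by
  rw [negCoord, affineLift_loop, if_neg (by omega), LinearMap.zero_apply]

lemma negCoord_central : negCoord central = 0 := affineLift_central _ _

lemma negCoord_loop_neg (x : sl2) (n : ℕ) :
    negCoord (loop x (-(n + 1))) = ∑ a, Finsupp.single (toLex (a, n)) (coord a x) := by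
  rw [negCoord, affineLift_loop, if_pos (by omega), LinearMap.sum_apply]
  simp

lemma negCoord_neg (i : Idx) : negCoord (neg i) = Finsupp.single i 1 := by
  rw [neg, negCoord_loop_neg, Finset.sum_eq_single (ofLex i).1]
  · simp [coord_gen]
  · intro a _ ha
    simp [coord_gen, ha]
  · simp

/-- The subalgebra `sl(2)[t] ⊕ ℂ K`. -/
def parabolic : Submodule ℂ Affine :=
  Submodule.span ℂ ({a | ∃ (x : sl2) (n : ℕ), a = loop x n} ∪ {central})

lemma sub_mem_parabolic (a : Affine) :
    a - Finsupp.linearCombination ℂ neg (negCoord a) ∈ parabolic := by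
  induction a using affine_induction with
  | hloop x n =>
    by_cases hn : 0 ≤ n
    · rw [negCoord_loop_nonneg x n hn, map_zero, sub_zero]
      obtain ⟨m, rfl⟩ := Int.eq_ofNat_of_zero_le hn
      exact Submodule.subset_span (Or.inl ⟨x, m, rfl⟩)
    · obtain ⟨m, rfl⟩ : ∃ m : ℕ, n = -(m + 1) := ⟨(-n - 1).toNat, by omega⟩
      rw [negCoord_loop_neg, map_sum]
      have : ∑ a, Finsupp.linearCombination ℂ neg (Finsupp.single (toLex (a, m)) (coord a x)) =
          loop x (-(m + 1)) := by
        simp only [Finsupp.linearCombination_single, neg, ofLex_toLex, ← loop_smul]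
        simp only [← loopₗ_apply]
        rw [← map_sum, sum_coord_gen]
      rw [this, sub_self]
      exact Submodule.zero_mem _
  | hcentral =>
    rw [negCoord_central, map_zero, sub_zero]
    exact Submodule.subset_span (Or.inr rfl)
  | hadd a b ha hb =>
    rw [map_add, map_add, add_sub_add_comm]
    exact Submodule.add_mem _ ha hb
  | hsmul r a ha =>
    rw [map_smul, map_smul, ← smul_sub]
    exact Submodule.smul_mem _ _ ha

lemma mem_parabolic (a : Affine) (ha : negCoord a = 0) : a ∈ parabolic := by
  simpa [ha] using sub_mem_parabolic a

lemma parabolicRep_lie (k : ℂ) (j : ℕ) (a b : Affine) (ha : a ∈ parabolic) (hb : b ∈ parabolic) :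
    negCoord ⁅a, b⁆ = 0 ∧ parabolicRep k j ⁅a, b⁆ =
      parabolicRep k j a * parabolicRep k j b - parabolicRep k j b * parabolicRep k j a := by
  have hc : parabolicRep k j central = k • 1 := affineLift_central _ _
  have hl : ∀ x n, parabolicRep k j (loop x n) = (if n = 0 then rep j else 0) x :=
    fun x n => affineLift_loop _ _ _ _
  induction ha, hb using Submodule.span_induction₂ with
  | mem_mem a b ha hb =>
    rcases ha with ⟨x, m, rfl⟩ | rfl
    · rcases hb with ⟨y, n, rfl⟩ | rfl
      -- For m, n ≥ 0 the condition m + n = 0 forces m = 0, so the cocycle vanishes on sl(2)[t] and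
      -- K may act by an arbitrary scalar.
      · have h0 : (if (m : ℤ) + n = 0 then ((m : ℤ) : ℂ) * form x y else 0) = 0 := by
          split_ifs with h
          · have : m = 0 := by omega
            simp [this]
          · rfl
        rw [loop_lie, h0, zero_smul, add_zero]
        refine ⟨negCoord_loop_nonneg _ _ (by omega), ?_⟩
        rw [hl, hl, hl]
        by_cases hm : m = 0
        · by_cases hn : n = 0
          · simp [hm, hn, rep_lie]
          · simp [hm, hn]
        · have : (m : ℤ) + n ≠ 0 := by omega
          simp [hm, this]
      · rw [← lie_skew, central_lie, neg_zero, hc]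
        simp
    · rw [central_lie, hc]
      simp
  | zero_left => simp
  | zero_right => simp
  | add_left a b c _ _ _ ha hb =>
    refine ⟨by rw [add_lie, map_add, ha.1, hb.1, add_zero], ?_⟩
    rw [add_lie, map_add, ha.2, hb.2, map_add]; noncomm_ring
  | add_right a b c _ _ _ ha hb =>
    refine ⟨by rw [lie_add, map_add, ha.1, hb.1, add_zero], ?_⟩
    rw [lie_add, map_add, ha.2, hb.2, map_add]; noncomm_ring
  | smul_left r a b _ _ ha =>
    refine ⟨by rw [smul_lie, map_smul, ha.1, smul_zero], ?_⟩
    rw [smul_lie, map_smul, ha.2, map_smul, smul_sub, smul_mul_assoc, mul_smul_comm]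
  | smul_right r a b _ _ ha =>
    refine ⟨by rw [lie_smul, map_smul, ha.1, smul_zero], ?_⟩
    rw [lie_smul, map_smul, ha.2, map_smul, smul_sub, smul_mul_assoc, mul_smul_comm]

/-- The data of the generalized Verma module as an induced module. -/
def datum (k : ℂ) (j : ℕ) : InducedPBW.Datum ℂ Affine Idx (V j) where
  b := neg
  c := negCoord
  ρ := parabolicRep k j
  c_b := negCoord_neg
  -- Closure under brackets does not involve the inducing module, so level 0 and j = 0 serve as
  -- dummy values.
  lie_mem a b ha hb := (parabolicRep_lie 0 0 a b (mem_parabolic a ha) (mem_parabolic b hb)).1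
  ρ_lie a b ha hb := (parabolicRep_lie k j a b (mem_parabolic a ha) (mem_parabolic b hb)).2

/-- The space with basis the ordered monomials. -/
abbrev Model (j : ℕ) : Type := Multiset Idx →₀ V j

section

attribute [local instance] LieRing.ofAssociativeRing

/-- The action of the enveloping algebra on the model. -/
def modelAct (k : ℂ) (j : ℕ) : U →ₐ[ℂ] Module.End ℂ (Model j) :=
  UniversalEnvelopingAlgebra.lift ℂ
    { (datum k j).act with
      map_lie' := fun {x y} => by
        rw [LieRing.of_associative_ring_bracket]
        exact (datum k j).act_lie x y }

lemma modelAct_toU (k : ℂ) (j : ℕ) (a : Affine) : modelAct k j (toU a) = (datum k j).act a :=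
  UniversalEnvelopingAlgebra.lift_ι_apply ℂ _ a

end

lemma act_loop_nonneg (k : ℂ) (j : ℕ) (x : sl2) (n : ℕ) (v : V j) :
    (datum k j).act (loop x n) (Finsupp.single 0 v) =
      Finsupp.single 0 ((if (n : ℤ) = 0 then rep j else 0) x v) := by
  rw [(datum k j).act_of_c_eq_zero (negCoord_loop_nonneg x n (by omega))]
  change Finsupp.single 0 (parabolicRep k j _ v) = _
  rw [parabolicRep, affineLift_loop]

lemma act_central (k : ℂ) (j : ℕ) (v : V j) :
    (datum k j).act central (Finsupp.single 0 v) = Finsupp.single 0 (k • v) := by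
  rw [(datum k j).act_of_c_eq_zero negCoord_central]
  change Finsupp.single 0 (parabolicRep k j _ v) = _
  rw [parabolicRep, affineLift_central]
  simp

/-- The map `u ⊗ v ↦ u v` to the model. -/
def preModel (k : ℂ) (j : ℕ) : U ⊗[ℂ] V j →ₗ[ℂ] Model j :=
  TensorProduct.lift ((LinearMap.lcomp ℂ (Model j) (Finsupp.lsingle 0)) ∘ₗ
    (modelAct k j).toLinearMap)

lemma preModel_tmul (k : ℂ) (j : ℕ) (u : U) (v : V j) :
    preModel k j (u ⊗ₜ v) = modelAct k j u (Finsupp.single 0 v) := by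
  simp [preModel]

lemma preModel_smul (k : ℂ) (j : ℕ) (u : U) (w : U ⊗[ℂ] V j) :
    preModel k j (u • w) = modelAct k j u (preModel k j w) := by
  induction w using TensorProduct.induction_on with
  | zero => simp
  | add a b ha hb => rw [smul_add, map_add, map_add, ha, hb, map_add]
  | tmul u' v =>
    rw [TensorProduct.smul_tmul', smul_eq_mul, preModel_tmul, preModel_tmul, map_mul,
      Module.End.mul_apply]

lemma preModel_relations (k : ℂ) (j : ℕ) (w : U ⊗[ℂ] V j) (hw : w ∈ inducedRelations k j) :
    preModel k j w = 0 := by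
  induction hw using Submodule.span_induction with
  | mem w hw =>
    rcases hw with (⟨x, v, rfl⟩ | ⟨x, n, v, hn, rfl⟩) | ⟨v, rfl⟩
    · rw [map_sub, preModel_tmul, preModel_tmul, modelAct_toU, map_one, Module.End.one_apply]
      have := act_loop_nonneg k j x 0 v
      simp only [Nat.cast_zero, if_true] at this
      rw [this, sub_self]
    · rw [preModel_tmul, modelAct_toU, act_loop_nonneg, if_neg (by omega)]
      simp
    · rw [map_sub, preModel_tmul, preModel_tmul, modelAct_toU, map_one, Module.End.one_apply,
        act_central, sub_self]
  | zero => simp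
  | add a b _ _ ha hb => rw [map_add, ha, hb, add_zero]
  | smul u a _ ha => rw [preModel_smul, ha, map_zero]

/-- The comparison map to the model. -/
def toModel (k : ℂ) (j : ℕ) : WeylModule k j →ₗ[ℂ] Model j :=
  ((inducedRelations k j).restrictScalars ℂ).liftQ (preModel k j)
    (fun w hw => preModel_relations k j w hw)

lemma toModel_smul_vac (k : ℂ) (j : ℕ) (u : U) (v : V j) :
    toModel k j (u • vac k j v) = modelAct k j u (Finsupp.single 0 v) := by
  have h1 : u • vac k j v = (inducedRelations k j).mkQ (u ⊗ₜ v) := by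
    refine ((map_smul (inducedRelations k j).mkQ u (1 ⊗ₜ v)).symm).trans ?_
    rw [TensorProduct.smul_tmul', smul_eq_mul, mul_one]
  rw [h1]
  exact preModel_tmul k j u v

lemma toModel_smul (k : ℂ) (j : ℕ) (u : U) (w : WeylModule k j) :
    toModel k j (u • w) = modelAct k j u (toModel k j w) := by
  induction w using weyl_induction with
  | hadd a b ha hb => rw [smul_add, map_add, map_add, ha, hb, map_add]
  | hgen u' v =>
    rw [smul_smul, toModel_smul_vac, toModel_smul_vac, map_mul, Module.End.mul_apply]

/-- The ordered product of basis vectors applied to a vector of the inducing module. -/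
def ofModel (k : ℂ) (j : ℕ) : Model j →ₗ[ℂ] WeylModule k j :=
  Finsupp.lsum ℂ fun m => (m.sort (· ≤ ·)).foldr (fun i T => mode k j (gen (ofLex i).1)
    (-((ofLex i).2 + 1)) ∘ₗ T) (vac k j)

lemma ofModel_zero (k : ℂ) (j : ℕ) (v : V j) : ofModel k j (Finsupp.single 0 v) = vac k j v := by
  simp [ofModel]

lemma ofModel_cons (k : ℂ) (j : ℕ) (i : Idx) (m : Multiset Idx) (v : V j) (h : ∀ l ∈ m, i ≤ l) :
    ofModel k j (Finsupp.single (i ::ₘ m) v) = toU (neg i) • ofModel k j (Finsupp.single m v) := by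
  have hs : (i ::ₘ m).sort (· ≤ ·) = i :: m.sort (· ≤ ·) := Multiset.sort_cons _ _ _ h
  rw [ofModel, Finsupp.lsum_single, Finsupp.lsum_single, hs, List.foldr_cons]
  rfl

lemma parabolic_smul_vac (k : ℂ) (j : ℕ) (a : Affine) (ha : a ∈ parabolic) (v : V j) :
    toU a • vac k j v = vac k j (parabolicRep k j a v) := by
  induction ha using Submodule.span_induction with
  | mem a ha =>
    rcases ha with ⟨x, n, rfl⟩ | rfl
    · rw [parabolicRep, affineLift_loop]
      by_cases hn : n = 0
      · subst hn
        simpa using loop_zero_smul_vac k j x v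
      · rw [if_neg (by omega), loop_pos_smul_vac k j x n (by omega)]
        simp
    · rw [parabolicRep, affineLift_central, central_smul_vac]
      simp
  | zero => simp
  | add a b _ _ ha hb => rw [map_add, add_smul, ha, hb, map_add, LinearMap.add_apply, map_add]
  | smul r a _ ha => rw [map_smul, smul_assoc, ha, map_smul, LinearMap.smul_apply, map_smul]

/-- The action of the affine Lie algebra on the generalized Verma module. -/
def weylAct (k : ℂ) (j : ℕ) : Affine →ₗ[ℂ] Module.End ℂ (WeylModule k j) :=
  (Algebra.lsmul ℂ ℂ (WeylModule k j)).toLinearMap ∘ₗ toU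

lemma weylAct_apply (k : ℂ) (j : ℕ) (a : Affine) (w : WeylModule k j) :
    weylAct k j a w = toU a • w := rfl

lemma weylAct_lie (k : ℂ) (j : ℕ) (a b : Affine) : weylAct k j ⁅a, b⁆ =
    weylAct k j a * weylAct k j b - weylAct k j b * weylAct k j a := by
  refine LinearMap.ext fun w => ?_
  rw [LinearMap.sub_apply, Module.End.mul_apply, Module.End.mul_apply]
  simp only [weylAct_apply]
  rw [toU_lie, sub_smul, mul_smul, mul_smul]

lemma ofModel_act (k : ℂ) (j : ℕ) (a : Affine) (w : Model j) :
    ofModel k j ((datum k j).act a w) = toU a • ofModel k j w := by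
  refine (datum k j).map_act (weylAct k j) (weylAct_lie k j) (ofModel k j) ?_ ?_ a w
  · exact fun i m v h => ofModel_cons k j i m v h
  · intro x v hx
    rw [ofModel_zero, ofModel_zero]
    exact (parabolic_smul_vac k j x (mem_parabolic x hx) v).symm

lemma ofModel_modelAct (k : ℂ) (j : ℕ) (u : U) (w : Model j) :
    ofModel k j (modelAct k j u w) = u • ofModel k j w := by
  induction u using toU_induction with
  | hone => simp
  | hadd a b ha hb => rw [map_add, LinearMap.add_apply, map_add, ha, hb, add_smul]
  | hsmul r a ha => rw [map_smul, LinearMap.smul_apply, map_smul, ha, smul_assoc]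
  | hmul a u hu =>
    rw [map_mul, Module.End.mul_apply, modelAct_toU, ofModel_act, hu, mul_smul]

lemma ofModel_toModel (k : ℂ) (j : ℕ) (w : WeylModule k j) : ofModel k j (toModel k j w) = w := by
  induction w using weyl_induction with
  | hadd a b ha hb => rw [map_add, map_add, ha, hb]
  | hgen u v => rw [toModel_smul_vac, ofModel_modelAct, ofModel_zero]

/-- This is the linear independence half of the basis theorem: in the model, applying the basis
vectors in order to the vacuum literally builds up the monomial, by `act_b_of_le`. -/
lemma toModel_ofModel (k : ℂ) (j : ℕ) (w : Model j) : toModel k j (ofModel k j w) = w := by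
  induction w using Finsupp.induction_linear with
  | zero => simp
  | add a b ha hb => rw [map_add, map_add, ha, hb]
  | single m v =>
    induction hn : m.card generalizing m with
    | zero =>
      obtain rfl := Multiset.card_eq_zero.mp hn
      have := toModel_smul_vac k j 1 v
      rwa [one_smul, map_one, Module.End.one_apply, ← ofModel_zero] at this
    | succ n ih =>
      obtain ⟨i, m', rfl, hi⟩ := InducedPBW.exists_min m (by rintro rfl; simp at hn)
      rw [Multiset.card_cons, Nat.add_right_cancel_iff] at hn
      rw [ofModel_cons k j i m' v hi, toModel_smul, ih m' hn, modelAct_toU]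
      exact (datum k j).act_b_of_le i m' hi v

/-- The generalized Verma module has a basis of ordered monomials. -/
def pbw (k : ℂ) (j : ℕ) : Model j ≃ₗ[ℂ] WeylModule k j :=
  LinearEquiv.ofLinearMap (ofModel k j) (toModel k j)
    (LinearMap.ext (ofModel_toModel k j)) (LinearMap.ext (toModel_ofModel k j))

lemma pbw_zero (k : ℂ) (j : ℕ) (v : V j) : pbw k j (Finsupp.single 0 v) = vac k j v :=
  ofModel_zero k j v

lemma pbw_cons (k : ℂ) (j : ℕ) (i : Idx) (m : Multiset Idx) (v : V j) (h : ∀ l ∈ m, i ≤ l) :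
    pbw k j (Finsupp.single (i ::ₘ m) v) =
      mode k j (gen (ofLex i).1) (-((ofLex i).2 + 1)) (pbw k j (Finsupp.single m v)) :=
  ofModel_cons k j i m v h

end ParafermionSl2

namespace ParafermionSl2

/-! ### The Sugawara operator -/

section Sugawara

variable {A : Type*} [Ring A] [Algebra ℂ A]

/-- The modes of the Sugawara field, for given modes of `e`, `f`, `h`. -/
def sugTerm (E F H : ℤ → A) (n : ℤ) : A :=
  E (-n) * F n + F (-n) * E n + (1 / 2 : ℂ) • (H (-n) * H n)

/-- The partial sums of the Sugawara operator. -/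
def sugSum (E F H : ℤ → A) (B : ℕ) : A :=
  sugTerm E F H 0 + (2 : ℂ) • ∑ n ∈ Finset.range B, sugTerm E F H (n + 1)

/-- The commutator of one Sugawara term with E m is a difference g(n) - g(n - m) plus a central
term. For m = 0 the difference vanishes, and for m = ±1 the sum over n telescopes, leaving only
terms at the cutoff B. The factor k + 2 consists of k from the central term and 2 from reordering
the terms at n = 0. The modes 0, ±1 suffice since they generate the rest. -/
lemma sugSum_comm {E F H : ℤ → A} {k : ℂ}
    (hEE : ∀ m n, E m * E n = E n * E m)
    (hEF : ∀ m n, E m * F n = F n * E m + H (m + n) + (if m + n = 0 then (m : ℂ) * k else 0) • 1)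
    (hHE : ∀ m n, H m * E n = E n * H m + (2 : ℂ) • E (m + n)) (B : ℕ) (hB : 1 ≤ B) :
    (sugSum E F H B * E 0 - E 0 * sugSum E F H B = 0) ∧
    (sugSum E F H B * E 1 - E 1 * sugSum E F H B = -(2 * (k + 2)) • E 1 +
      (2 : ℂ) • (H (-B) * E (B + 1) - E (-B) * H (B + 1))) ∧
    (sugSum E F H B * E (-1) - E (-1) * sugSum E F H B = (2 * (k + 2)) • E (-1) -
      (2 : ℂ) • (H (-(B + 1 : ℤ)) * E B - E (-(B + 1 : ℤ)) * H B)) := by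
  have key : ∀ n m : ℤ, sugTerm E F H n * E m - E m * sugTerm E F H n =
      (H (-n) * E (n + m) - E (-n) * H (n + m)) - (H (m - n) * E n - E (m - n) * H n) +
      ((if m + n = 0 then (n : ℂ) * k else 0) • E (-n) -
       (if m + -n = 0 then (n : ℂ) * k else 0) • E n) := by
    intro n m
    have h1 : F n * E m = E m * F n - H (m + n) - (if m + n = 0 then (m : ℂ) * k else 0) • 1 := by
      rw [hEF]; abel
    have h2 : F (-n) * E m = E m * F (-n) - H (m - n) -
        (if m + -n = 0 then (m : ℂ) * k else 0) • 1 := by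
      rw [hEF, ← sub_eq_add_neg]; abel
    have c1 : (if m + n = 0 then (m : ℂ) * k else 0) = -(if m + n = 0 then (n : ℂ) * k else 0) := by
      split_ifs with h
      · have : (m : ℂ) = -n := by exact_mod_cast (by omega : m = -n)
        rw [this]; ring
      · simp
    have c2 : (if m + -n = 0 then (m : ℂ) * k else 0) =
        (if m + -n = 0 then (n : ℂ) * k else 0) := by
      split_ifs with h
      · have : (m : ℂ) = n := by exact_mod_cast (by omega : m = n)
        rw [this]
      · simp
    rw [c1, neg_smul, sub_neg_eq_add] at h1
    rw [c2] at h2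
    generalize (if m + n = 0 then (n : ℂ) * k else 0) = r1 at *
    generalize (if m + -n = 0 then (n : ℂ) * k else 0) = r2 at *
    have a1 : E (-n) * F n * E m = E m * E (-n) * F n - E (-n) * H (n + m) + r1 • E (-n) := by
      rw [mul_assoc, h1, add_comm n m, hEE m (-n)]
      simp only [mul_add, mul_sub, mul_smul_comm, mul_one, mul_assoc]
    have a2 : F (-n) * E n * E m = E m * F (-n) * E n - H (m - n) * E n - r2 • E n := by
      rw [mul_assoc, hEE n m, ← mul_assoc, h2]
      simp only [sub_mul, smul_mul_assoc, one_mul]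
    have a3 : H (-n) * H n * E m = E m * H (-n) * H n + (2 : ℂ) • (H (-n) * E (n + m)) +
        (2 : ℂ) • (E (m - n) * H n) := by
      rw [mul_assoc, hHE, mul_add, ← mul_assoc, hHE, add_mul, mul_smul_comm, smul_mul_assoc,
        show -n + m = m - n by ring]
      abel
    simp only [sugTerm, add_mul, mul_add, smul_mul_assoc, mul_smul_comm, a1, a2, a3, ← mul_assoc]
    module
  have tele : ∀ m : ℤ, sugSum E F H B * E m - E m * sugSum E F H B =
      (sugTerm E F H 0 * E m - E m * sugTerm E F H 0) + (2 : ℂ) • ∑ n ∈ Finset.range B,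
        (sugTerm E F H (n + 1) * E m - E m * sugTerm E F H (n + 1)) := by
    intro m
    simp only [sugSum, add_mul, mul_add, smul_mul_assoc, mul_smul_comm, Finset.sum_mul,
      Finset.mul_sum, Finset.sum_sub_distrib, smul_sub]
    abel
  refine ⟨?_, ?_, ?_⟩
  · rw [tele, key]
    simp only [key]
    rw [Finset.sum_eq_zero]
    · simp
    · intro n _
      have h1 : ¬ (0 + ((n : ℤ) + 1) = 0) := by omega
      have h2 : ¬ (0 + -((n : ℤ) + 1) = 0) := by omega
      rw [if_neg h1, if_neg h2]
      simp
  · rw [tele, key]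
    simp only [key]
    have hs : ∑ n ∈ Finset.range B,
        ((H (-((n : ℤ) + 1)) * E (n + 1 + 1) - E (-((n : ℤ) + 1)) * H (n + 1 + 1)) -
          (H (1 - (n + 1)) * E (n + 1) - E (1 - (n + 1)) * H (n + 1)) +
          ((if (1 : ℤ) + (n + 1) = 0 then (((n : ℤ) + 1 : ℤ) : ℂ) * k else 0) • E (-(n + 1)) -
          (if (1 : ℤ) + -(n + 1) = 0 then (((n : ℤ) + 1 : ℤ) : ℂ) * k else 0) • E (n + 1))) =
        (H (-B) * E (B + 1) - E (-B) * H (B + 1)) - (H 0 * E 1 - E 0 * H 1) - k • E 1 := by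
      clear tele
      induction B, hB using Nat.le_induction with
      | base => simp [sub_eq_add_neg]
      | succ B hB ih =>
        rw [Finset.sum_range_succ, ih, if_neg (by omega), if_neg (by omega)]
        push_cast
        rw [show (1 : ℤ) - (B + 1) = -B by ring]
        simp only [zero_smul]
        abel
    rw [hs]
    have e1 := hHE 0 1
    have e2 := hHE 1 0
    simp only [zero_add, add_zero, neg_zero, sub_zero] at *
    rw [e1, e2]
    module
  · rw [tele, key]
    simp only [key]
    have hs : ∑ n ∈ Finset.range B,
        ((H (-((n : ℤ) + 1)) * E (n + 1 + -1) - E (-((n : ℤ) + 1)) * H (n + 1 + -1)) -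
          (H (-1 - (n + 1)) * E (n + 1) - E (-1 - (n + 1)) * H (n + 1)) +
          ((if (-1 : ℤ) + (n + 1) = 0 then (((n : ℤ) + 1 : ℤ) : ℂ) * k else 0) • E (-(n + 1)) -
          (if (-1 : ℤ) + -(n + 1) = 0 then (((n : ℤ) + 1 : ℤ) : ℂ) * k else 0) • E (n + 1))) =
        (H (-1) * E 0 - E (-1) * H 0) -
          (H (-(B + 1 : ℤ)) * E B - E (-(B + 1 : ℤ)) * H B) + k • E (-1) := by
      clear tele
      induction B, hB using Nat.le_induction with
      | base => simp [sub_eq_add_neg]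
      | succ B hB ih =>
        rw [Finset.sum_range_succ, ih, if_neg (by omega), if_neg (by omega)]
        push_cast
        rw [show (-1 : ℤ) - (B + 1) = -(B + 1 + 1) by ring, show (B : ℤ) + 1 + -1 = B by ring]
        simp only [zero_smul]
        abel
    rw [hs]
    have e1 := hHE 0 (-1)
    have e2 := hHE (-1) 0
    simp only [zero_add, add_zero, neg_zero, sub_zero] at *
    rw [e1, e2]
    module

end Sugawara

/-! ### Degrees of the modes with respect to L(0) -/

lemma mode_comm (k : ℂ) (j : ℕ) (x y : sl2) (m n : ℤ) :
    mode k j x m * mode k j y n = mode k j y n * mode k j x m + mode k j ⁅x, y⁆ (m + n) +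
      (if m + n = 0 then (m : ℂ) * (form x y * k) else 0) • 1 := by
  refine LinearMap.ext fun w => ?_
  have h1 := congrArg (fun u => u • w) (toU_lie (loop x m) (loop y n))
  simp only [loop_lie, map_add, map_smul, add_smul, sub_smul, mul_smul, smul_assoc,
    central_smul] at h1
  simp only [LinearMap.add_apply, Module.End.mul_apply, mode_apply, LinearMap.smul_apply,
    Module.End.one_apply]
  rw [eq_sub_iff_add_eq] at h1
  rw [← h1, smul_smul]
  have : (if m + n = 0 then (m : ℂ) * form x y else 0) * k =
      if m + n = 0 then (m : ℂ) * (form x y * k) else 0 := by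
    split_ifs <;> ring
  rw [this]
  abel

lemma mode_smul (k : ℂ) (j : ℕ) (r : ℂ) (x : sl2) (n : ℤ) :
    mode k j (r • x) n = r • mode k j x n := by
  refine LinearMap.ext fun w => ?_
  simp only [LinearMap.smul_apply, mode_apply, loop_smul, map_smul, smul_assoc]

lemma mode_neg (k : ℂ) (j : ℕ) (x : sl2) (n : ℤ) : mode k j (-x) n = - mode k j x n := by
  have := mode_smul k j (-1) x n
  rwa [neg_one_smul, neg_one_smul] at this

lemma mode_zero (k : ℂ) (j : ℕ) (n : ℤ) : mode k j 0 n = 0 := by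
  have := mode_smul k j 0 0 n
  rwa [zero_smul, zero_smul] at this

lemma locallyFiniteSum_eq_sum {M : Type*} [AddCommGroup M] [Module ℂ M] (T : ℕ → Module.End ℂ M)
    (hT : ∀ v, {n | T n v ≠ 0}.Finite) (v : M) (B : ℕ) (hB : ∀ n, B ≤ n → T n v = 0) :
    locallyFiniteSum T hT v = ∑ n ∈ Finset.range B, T n v := by
  change ∑ᶠ n, T n v = _
  refine finsum_eq_sum_of_support_subset _ fun n hn => ?_
  by_contra hc
  rw [Finset.coe_range, Set.mem_Iio, not_lt] at hc
  exact hn (hB n hc)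

/-- The Sugawara operator is given by its partial sums on every vector. -/
lemma sugawaraL0_apply (k : ℂ) (j : ℕ) (w : WeylModule k j) (B : ℕ)
    (hB : ∀ (x : sl2) (n : ℤ), (B : ℤ) ≤ n → mode k j x n w = 0) :
    sugawaraL0 k j w = (1 / (2 * (k + 2)) : ℂ) •
      sugSum (mode k j e) (mode k j f) (mode k j h) B w := by
  have hterm : ∀ n : ℕ, sugawaraTerm k j n = sugTerm (mode k j e) (mode k j f) (mode k j h) n :=
    fun n => rfl
  rw [sugawaraL0, LinearMap.smul_apply, LinearMap.add_apply, LinearMap.smul_apply,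
    locallyFiniteSum_eq_sum _ _ _ B, sugSum, LinearMap.add_apply, LinearMap.smul_apply,
    LinearMap.sum_apply]
  · congr 3
  · intro n hn
    have h1 : (B : ℤ) ≤ ((n + 1 : ℕ) : ℤ) := by push_cast; omega
    rw [hterm, sugTerm]
    simp only [LinearMap.add_apply, Module.End.mul_apply, LinearMap.smul_apply, hB _ _ h1,
      map_zero, smul_zero, add_zero]

/-- The statement that `x(m)` has degree `-m` for the Sugawara operator. -/
def HasDegree (k : ℂ) (j : ℕ) (x : sl2) (m : ℤ) : Prop :=
  sugawaraL0 k j * mode k j x m - mode k j x m * sugawaraL0 k j = -(m : ℂ) • mode k j x m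

/-- On a given vector w the cutoff can be chosen so large that the partial sum is exact on both w
and x(m) w and the boundary term `r` vanishes. -/
lemma hasDegree_of_sugSum (k : ℂ) (hk : k + 2 ≠ 0) (j : ℕ) (x : sl2) (m : ℤ)
    (r : ℕ → WeylModule k j → WeylModule k j)
    (hs : ∀ B : ℕ, 1 ≤ B → ∀ w, (sugSum (mode k j e) (mode k j f) (mode k j h) B * mode k j x m -
      mode k j x m * sugSum (mode k j e) (mode k j f) (mode k j h) B) w =
        (-(m : ℂ) * (2 * (k + 2))) • mode k j x m w + r B w)
    (hr : ∀ w (B : ℕ), (∀ (x : sl2) (n : ℤ), (B : ℤ) ≤ n → mode k j x n w = 0) → r B w = 0) :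
    HasDegree k j x m := by
  refine LinearMap.ext fun w => ?_
  obtain ⟨B1, hB1⟩ := mode_eventually_zero k j w
  obtain ⟨B2, hB2⟩ := mode_eventually_zero k j (mode k j x m w)
  set B := max (max B1 B2) 1 with hBdef
  have h1 : ∀ (x : sl2) (n : ℤ), (B : ℤ) ≤ n → mode k j x n w = 0 :=
    fun x n hn => hB1 x n (by omega)
  have h2 := hs B (by omega) w
  rw [hr w B h1, add_zero] at h2
  rw [LinearMap.sub_apply, Module.End.mul_apply, Module.End.mul_apply, sugawaraL0_apply k j w B h1,
    sugawaraL0_apply k j _ B (fun x n hn => hB2 x n (by omega)), map_smul, ← smul_sub]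
  rw [LinearMap.sub_apply, Module.End.mul_apply, Module.End.mul_apply] at h2
  rw [h2, smul_smul, LinearMap.smul_apply]
  congr 1
  field_simp

lemma mode_comm_ee (k : ℂ) (j : ℕ) (x : sl2) (hx : form x x = 0) (m n : ℤ) :
    mode k j x m * mode k j x n = mode k j x n * mode k j x m := by
  rw [mode_comm, lie_self, mode_zero, hx]
  simp

/-- The symmetry e ↔ f, h ↦ -h preserves the Sugawara sums, so the computation for e also yields the
one for f. -/
lemma sugSum_swap {A : Type*} [Ring A] [Algebra ℂ A] (E F H : ℤ → A) (B : ℕ) :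
    sugSum F E (-H) B = sugSum E F H B := by
  have : ∀ n, sugTerm F E (-H) n = sugTerm E F H n := by
    intro n
    simp only [sugTerm, Pi.neg_apply, neg_mul_neg]
    rw [add_comm (F (-n) * E n)]
  simp only [sugSum, this]

lemma hasDegree_base (k : ℂ) (hk : k + 2 ≠ 0) (j : ℕ) (x : sl2) (H : ℤ → Module.End ℂ _)
    (hH : ∀ w (B : ℕ), (∀ (x : sl2) (n : ℤ), (B : ℤ) ≤ n → mode k j x n w = 0) →
      ∀ n : ℤ, (B : ℤ) ≤ n → H n w = 0)
    (hs : ∀ B : ℕ, 1 ≤ B → 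
      (sugSum (mode k j e) (mode k j f) (mode k j h) B * mode k j x 0 -
        mode k j x 0 * sugSum (mode k j e) (mode k j f) (mode k j h) B = 0) ∧
      (sugSum (mode k j e) (mode k j f) (mode k j h) B * mode k j x 1 -
        mode k j x 1 * sugSum (mode k j e) (mode k j f) (mode k j h) B =
        -(2 * (k + 2)) • mode k j x 1 +
        (2 : ℂ) • (H (-B) * mode k j x (B + 1) - mode k j x (-B) * H (B + 1))) ∧
      (sugSum (mode k j e) (mode k j f) (mode k j h) B * mode k j x (-1) -
        mode k j x (-1) * sugSum (mode k j e) (mode k j f) (mode k j h) B =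
        (2 * (k + 2)) • mode k j x (-1) -
        (2 : ℂ) • (H (-(B + 1 : ℤ)) * mode k j x B - mode k j x (-(B + 1 : ℤ)) * H B))) :
    HasDegree k j x 0 ∧ HasDegree k j x 1 ∧ HasDegree k j x (-1) := by
  refine ⟨?_, ?_, ?_⟩
  · refine hasDegree_of_sugSum k hk j x 0 (fun _ _ => 0) (fun B hB w => ?_) (fun _ _ _ => rfl)
    rw [(hs B hB).1]
    simp
  · refine hasDegree_of_sugSum k hk j x 1 (fun B w => (2 : ℂ) • (H (-B) (mode k j x (B + 1) w) -
      mode k j x (-B) (H (B + 1) w))) (fun B hB w => ?_) (fun w B hB => ?_)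
    · rw [(hs B hB).2.1]
      simp
    · rw [hB x _ (by omega), hH w B hB _ (by omega)]
      simp
  · refine hasDegree_of_sugSum k hk j x (-1) (fun B w => -((2 : ℂ) • (H (-(B + 1 : ℤ))
      (mode k j x B w) - mode k j x (-(B + 1 : ℤ)) (H B w)))) (fun B hB w => ?_) (fun w B hB => ?_)
    · rw [(hs B hB).2.2]
      simp [sub_eq_add_neg]
    · rw [hB x _ (by omega), hH w B hB _ (by omega)]
      simp

lemma hasDegree_e (k : ℂ) (hk : k + 2 ≠ 0) (j : ℕ) :
    HasDegree k j e 0 ∧ HasDegree k j e 1 ∧ HasDegree k j e (-1) := by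
  refine hasDegree_base k hk j e (mode k j h) (fun w B hB n hn => hB h n hn) fun B hB => ?_
  refine sugSum_comm (k := k) (mode_comm_ee k j e form_ee) ?_ ?_ B hB
  · intro m n
    rw [mode_comm, lie_ef, form_ef, one_mul]
  · intro m n
    rw [mode_comm, lie_he, form_he, mode_smul]
    simp

lemma hasDegree_f (k : ℂ) (hk : k + 2 ≠ 0) (j : ℕ) :
    HasDegree k j f 0 ∧ HasDegree k j f 1 ∧ HasDegree k j f (-1) := by
  refine hasDegree_base k hk j f (-mode k j h)
    (fun w B hB n hn => by rw [Pi.neg_apply, LinearMap.neg_apply, hB h n hn, neg_zero])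
    fun B hB => ?_
  rw [← sugSum_swap]
  refine sugSum_comm (k := k) (mode_comm_ee k j f form_ff) ?_ ?_ B hB
  · intro m n
    rw [mode_comm, ← lie_skew, lie_ef, form_fe, one_mul, mode_neg, Pi.neg_apply]
  · intro m n
    rw [Pi.neg_apply, neg_mul, mode_comm, lie_hf, form_hf, mode_smul]
    simp
    abel

lemma HasDegree.lie {k : ℂ} {j : ℕ} {x y : sl2} {m n : ℤ} (hx : HasDegree k j x m)
    (hy : HasDegree k j y n) : HasDegree k j ⁅x, y⁆ (m + n) := by
  have hc := mode_comm k j x y m n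
  -- The central term of the bracket is a scalar, hence of degree 0; this is consistent because it
  -- only occurs when m + n = 0.
  have h0 : ((m + n : ℤ) : ℂ) * (if m + n = 0 then (m : ℂ) * (form x y * k) else 0) = 0 := by
    split_ifs with h
    · simp [h]
    · simp
  rw [HasDegree] at *
  have hb : mode k j ⁅x, y⁆ (m + n) = mode k j x m * mode k j y n - mode k j y n * mode k j x m -
      (if m + n = 0 then (m : ℂ) * (form x y * k) else 0) • 1 := by
    rw [hc]; abel
  generalize (if m + n = 0 then (m : ℂ) * (form x y * k) else 0) = r at *
  generalize mode k j x m = X at *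
  generalize mode k j y n = Y at *
  generalize sugawaraL0 k j = L at *
  rw [sub_eq_iff_eq_add'] at hx hy
  have e1 : L * (X * Y) = X * Y * L - ((m + n : ℤ) : ℂ) • (X * Y) := by
    rw [← mul_assoc, hx, add_mul, mul_assoc, hy]
    simp only [mul_add, smul_mul_assoc, mul_smul_comm, mul_assoc]
    push_cast
    module
  have e2 : L * (Y * X) = Y * X * L - ((m + n : ℤ) : ℂ) • (Y * X) := by
    rw [← mul_assoc, hy, add_mul, mul_assoc, hx]
    simp only [mul_add, smul_mul_assoc, mul_smul_comm, mul_assoc]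
    push_cast
    module
  rw [hb]
  simp only [mul_sub, sub_mul, e1, e2, mul_smul_comm, smul_mul_assoc, mul_one, one_mul, smul_sub,
    smul_smul, neg_mul, h0]
  module

lemma HasDegree.smul {k : ℂ} {j : ℕ} {x : sl2} {m : ℤ} (r : ℂ) (hx : HasDegree k j x m) :
    HasDegree k j (r • x) m := by
  rw [HasDegree] at *
  rw [mode_smul, mul_smul_comm, smul_mul_assoc, ← smul_sub, hx, smul_comm]

/-- The elements e t^r and f t^r with r = 0, ±1 generate all modes under brackets: h(n + r) comes
from [e(n), f(r)], and e(n + r), f(n + r) come from bracketing h(n) with e(r), f(r). Degrees add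
under brackets. -/
lemma hasDegree_gen (k : ℂ) (hk : k + 2 ≠ 0) (j : ℕ) (a : Fin 3) (m : ℤ) :
    HasDegree k j (gen a) m := by
  obtain ⟨e0, e1, e1'⟩ := hasDegree_e k hk j
  obtain ⟨f0, f1, f1'⟩ := hasDegree_f k hk j
  have step : ∀ r n : ℤ, HasDegree k j e r → HasDegree k j f r →
      (HasDegree k j h n ∧ HasDegree k j e n ∧ HasDegree k j f n) →
      (HasDegree k j h (n + r) ∧ HasDegree k j e (n + r) ∧ HasDegree k j f (n + r)) := by
    rintro r n er fr ⟨hn, en, fn⟩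
    refine ⟨?_, ?_, ?_⟩
    · rw [← lie_ef]
      exact en.lie fr
    · have := (hn.lie er).smul (1 / 2)
      rwa [lie_he, smul_smul, show (1 / 2 : ℂ) * 2 = 1 by norm_num, one_smul] at this
    · have := (hn.lie fr).smul (-1 / 2)
      rwa [lie_hf, smul_smul, show (-1 / 2 : ℂ) * -2 = 1 by norm_num, one_smul] at this
  have h0 : HasDegree k j h 0 := by
    have := e0.lie f0
    rwa [lie_ef] at this
  have all : HasDegree k j h m ∧ HasDegree k j e m ∧ HasDegree k j f m := by
    induction m using Int.induction_on with
    | zero => exact ⟨h0, e0, f0⟩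
    | succ n ih => exact step 1 n e1 f1 ih
    | pred n ih => exact step (-1) _ e1' f1' ih
  fin_cases a
  · exact all.1
  · exact all.2.1
  · exact all.2.2

lemma sugawaraL0_mode (k : ℂ) (hk : k + 2 ≠ 0) (j : ℕ) (a : Fin 3) (m : ℤ)
    (w : WeylModule k j) : sugawaraL0 k j (mode k j (gen a) m w) =
      mode k j (gen a) m (sugawaraL0 k j w) - (m : ℂ) • mode k j (gen a) m w := by
  have := congrArg (fun T => T w) (hasDegree_gen k hk j a m)
  simp only [LinearMap.sub_apply, Module.End.mul_apply, neg_smul, LinearMap.neg_apply,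
    LinearMap.smul_apply] at this
  rw [sub_eq_iff_eq_add'] at this
  rw [this, sub_eq_add_neg]

lemma matFE (j : ℕ) : matF j * matE j = 
    Matrix.diagonal fun k : Fin (j + 1) => (k : ℂ) * (j + 1 - k) := by
  ext i k
  simp only [matE, matF, Matrix.mul_apply, Matrix.of_apply, Matrix.diagonal_apply]
  by_cases hik : i = k
  · subst hik
    by_cases hi : 0 < (i : ℕ)
    · have hlt : (i : ℕ) - 1 < j + 1 := by have := i.isLt; omega
      rw [Finset.sum_eq_single (⟨i - 1, hlt⟩ : Fin (j + 1))]
      · have : (i : ℕ) - 1 + 1 = i := by omega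
        simp [this]
      · intro b _ hb
        have : ¬ ((i : ℕ) = b + 1) := fun hc => hb (Fin.ext (by simp [hc]))
        simp [this]
      · simp
    · have hi0 : (i : ℕ) = 0 := by omega
      rw [Finset.sum_eq_zero]
      · simp [hi0]
      · intro b _
        simp [hi0]
  · rw [Finset.sum_eq_zero, if_neg hik]
    intro b _
    by_cases hb : (i : ℕ) = b + 1
    · have : ¬ ((b : ℕ) + 1 = k) := fun hc => hik (Fin.ext (by omega))
      simp [this]
    · simp [hb]

/-- The Casimir eigenvalue on the inducing module. -/
lemma sugawaraL0_vac (k : ℂ) (j : ℕ) (v : V j) : sugawaraL0 k j (vac k j v) =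
    ((j : ℂ) * (j + 2) / (4 * (k + 2))) • vac k j v := by
  have hpos : ∀ (x : sl2) (n : ℤ), ((1 : ℕ) : ℤ) ≤ n → mode k j x n (vac k j v) = 0 := by
    intro x n hn
    obtain ⟨m, rfl⟩ := Int.eq_ofNat_of_zero_le (show 0 ≤ n by omega)
    exact loop_pos_smul_vac k j x m (by omega) v
  have hz : ∀ (x : sl2) (v : V j), mode k j x 0 (vac k j v) = vac k j (rep j x v) :=
    loop_zero_smul_vac k j
  have hs0 : sugSum (mode k j e) (mode k j f) (mode k j h) 1 (vac k j v) =
      vac k j ((rep j e * rep j f + rep j f * rep j e +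
        (1 / 2 : ℂ) • (rep j h * rep j h)) v) := by
    have h1 : mode k j e 1 (vac k j v) = 0 := hpos e 1 (by simp)
    have h2 : mode k j f 1 (vac k j v) = 0 := hpos f 1 (by simp)
    have h3 : mode k j h 1 (vac k j v) = 0 := hpos h 1 (by simp)
    simp [sugSum, sugTerm, hz, h1, h2, h3]
  have hcas : rep j e * rep j f + rep j f * rep j e + (1 / 2 : ℂ) • (rep j h * rep j h) =
      ((j : ℂ) * (j + 2) / 2) • 1 := by
    have hm : matE j * matF j + matF j * matE j + (1 / 2 : ℂ) • (matH j * matH j) =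
        ((j : ℂ) * (j + 2) / 2) • 1 := by
      rw [sub_eq_iff_eq_add.mp (matEF j), matFE]
      ext i l
      simp only [Matrix.add_apply, Matrix.smul_apply, matH, Matrix.diagonal_mul_diagonal,
        Matrix.diagonal_apply, Matrix.one_apply, smul_eq_mul]
      split_ifs
      · ring
      · simp
    have he : rep j e = Matrix.toLin' (matE j) := by simp [rep, repMat, e]
    have hf : rep j f = Matrix.toLin' (matF j) := by simp [rep, repMat, f]
    have hh : rep j h = Matrix.toLin' (matH j) := by simp [rep, repMat, h]
    have := congrArg Matrix.toLin' hm
    simp only [map_add, map_smul, Matrix.toLin'_mul, Matrix.toLin'_one] at this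
    rw [he, hf, hh]
    exact this
  rw [sugawaraL0_apply k j _ 1 hpos, hs0, hcas, LinearMap.smul_apply, Module.End.one_apply,
    map_smul, smul_smul]
  rw [div_mul_div_comm, one_mul]
  congr 2
  ring

end ParafermionSl2

/-! ### Modules over the Heisenberg algebra -/

namespace HeisenbergModule

variable {M : Type*} [AddCommGroup M] [Module ℂ M]

section Single

variable {a a' : Module.End ℂ M} {c : ℂ}

lemma ann_mul_pow (h : a * a' = a' * a + c • 1) (k : ℕ) :
    a * a' ^ (k + 1) = a' ^ (k + 1) * a + ((k + 1 : ℂ) * c) • a' ^ k := by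
  induction k with
  | zero => simp [h]
  | succ k ih =>
    rw [pow_succ a' (k + 1), ← mul_assoc, ih, add_mul, mul_assoc, h, mul_add, smul_mul_assoc,
      ← pow_succ, ← mul_assoc, mul_smul_comm, mul_one]
    push_cast
    module

lemma pow_mul_cre (h : a * a' = a' * a + c • 1) (k : ℕ) :
    a ^ (k + 1) * a' = a' * a ^ (k + 1) + ((k + 1 : ℂ) * c) • a ^ k := by
  induction k with
  | zero => simp [h]
  | succ k ih =>
    rw [pow_succ' a (k + 1), mul_assoc, ih, mul_add, ← mul_assoc, h, add_mul, mul_smul_comm,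
      ← pow_succ', smul_mul_assoc, one_mul, mul_assoc, ← pow_succ']
    push_cast
    module

lemma pow_pow_apply (h : a * a' = a' * a + c • 1) (k : ℕ) {u : M} (hu : a u = 0) :
    (a ^ k) ((a' ^ k) u) = ((k.factorial : ℂ) * c ^ k) • u := by
  induction k with
  | zero => simp
  | succ k ih =>
    have h1 := congrArg (fun T => T u) (ann_mul_pow h k)
    simp only [Module.End.mul_apply, LinearMap.add_apply, LinearMap.smul_apply, hu, map_zero,
      zero_add] at h1
    rw [pow_succ a, Module.End.mul_apply, h1, map_smul, ih, smul_smul, Nat.factorial_succ]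
    congr 1
    push_cast
    ring

/-- If u is the last nonzero power of a applied to w, then a multiple of a'^k u has the same k-th
image u (`pow_pow_apply`); subtracting it lowers the order of nilpotency. The subspace S lets
several oscillators be treated in turn without losing what was already achieved. -/
lemma exists_decomposition (h : a * a' = a' * a + c • 1) (hc : c ≠ 0) (S : Submodule ℂ M)
    (ha : ∀ w ∈ S, a w ∈ S) (ha' : ∀ w ∈ S, a' w ∈ S) (k : ℕ) :
    ∀ w ∈ S, (a ^ k) w = 0 → ∃ s ∈ S, ∃ t ∈ S, a s = 0 ∧ w = s + a' t := by
  have hpow : ∀ (b : Module.End ℂ M), (∀ w ∈ S, b w ∈ S) → ∀ n : ℕ, ∀ w ∈ S, (b ^ n) w ∈ S := by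
    intro b hb n
    induction n with
    | zero => intro w hw; simpa using hw
    | succ n ih =>
      intro w hw
      rw [pow_succ, Module.End.mul_apply]
      exact ih _ (hb _ hw)
  induction k with
  | zero =>
    intro w hw h0
    exact ⟨0, S.zero_mem, 0, S.zero_mem, by simp, by simpa using h0⟩
  | succ k ih =>
    intro w hw h0
    rcases k with _ | k
    · exact ⟨w, hw, 0, S.zero_mem, by simpa using h0, by simp⟩
    · set u := (a ^ (k + 1)) w with hu
      have hau : a u = 0 := by rw [hu, ← Module.End.mul_apply, ← pow_succ', h0]
      set r : ℂ := ((k + 1).factorial : ℂ) * c ^ (k + 1) with hr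
      have hr0 : r ≠ 0 := mul_ne_zero (by exact_mod_cast Nat.factorial_ne_zero _) (pow_ne_zero _ hc)
      have huS : u ∈ S := hpow a ha _ _ hw
      obtain ⟨s, hs, t, ht, has, hst⟩ := ih (w - r⁻¹ • (a' ^ (k + 1)) u)
        (S.sub_mem hw (S.smul_mem _ (hpow a' ha' _ _ huS))) (by
          rw [map_sub, map_smul, pow_pow_apply h _ hau, smul_smul, inv_mul_cancel₀ hr0, one_smul,
            ← hu, sub_self])
      refine ⟨s, hs, t + r⁻¹ • (a' ^ k) u, S.add_mem ht (S.smul_mem _ (hpow a' ha' _ _ huS)), has,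
        ?_⟩
      rw [sub_eq_iff_eq_add] at hst
      rw [hst, map_add, map_smul, pow_succ' a' k, Module.End.mul_apply, add_assoc]

/-- By `pow_mul_cre`, applying a^k to a a' z = 0 gives a multiple of a^k z, with nonzero factor (k +
1) c, as soon as a^{k+1} z = 0. So the order of nilpotency descends to zero. -/
lemma cre_eq_zero (h : a * a' = a' * a + c • 1) (hc : c ≠ 0) {z : M} (hz : a (a' z) = 0)
    (hnil : ∃ k : ℕ, (a ^ k) z = 0) : z = 0 := by
  obtain ⟨k, hk⟩ := hnil
  induction k with
  | zero => simpa using hk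
  | succ k ih =>
    apply ih
    have h1 := congrArg (fun T => T z) (pow_mul_cre h k)
    simp only [Module.End.mul_apply, LinearMap.add_apply, LinearMap.smul_apply, hk, map_zero,
      zero_add] at h1
    rw [pow_succ, Module.End.mul_apply, hz, map_zero] at h1
    have h2 : ((k + 1 : ℂ) * c) ≠ 0 := mul_ne_zero (by exact_mod_cast Nat.succ_ne_zero k) hc
    exact (smul_eq_zero.mp h1.symm).resolve_left h2

end Single

variable {a a' : ℕ → Module.End ℂ M} {c : ℕ → ℂ}

/-- A locally nilpotent module over the Heisenberg algebra is the direct sum of its vacuum space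
and of the sum of the images of the creation operators. -/
lemma isCompl_vacuum (hc : ∀ n, c n ≠ 0) (haa : ∀ m n, a m * a n = a n * a m)
    (haa' : ∀ m n, a' m * a' n = a' n * a' m) (hmix : ∀ m n, m ≠ n → a m * a' n = a' n * a m)
    (hself : ∀ n, a n * a' n = a' n * a n + c n • 1)
    (hnil : ∀ n w, ∃ k : ℕ, (a n ^ k) w = 0) (hfin : ∀ w, ∃ C : ℕ, ∀ n, C ≤ n → a n w = 0) :
    IsCompl (⨅ n, LinearMap.ker (a n)) (⨆ n, LinearMap.range (a' n)) := by
  have eaa : ∀ m n w, a m (a n w) = a n (a m w) := fun m n w => congrArg (fun T => T w) (haa m n)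
  have eaa' : ∀ m n w, a' m (a' n w) = a' n (a' m w) :=
    fun m n w => congrArg (fun T => T w) (haa' m n)
  have emix : ∀ m n w, m ≠ n → a m (a' n w) = a' n (a m w) :=
    fun m n w h => congrArg (fun T => T w) (hmix m n h)
  constructor
  · rw [Submodule.disjoint_def]
    intro w hw hR
    rw [Submodule.mem_iInf] at hw
    obtain ⟨g, hg, rfl⟩ := (Submodule.mem_iSup_iff_exists_finsupp _ _).mp hR
    choose z hz using hg
    -- Induction on the set of creation operators that occur. Everything divisible by a'_n is
    -- collected into one term a'_n z, the other terms being killed by a_n. Applying a_n and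
    -- `cre_eq_zero` then shows z = 0, which removes the index n.
    have key : ∀ (F : Finset ℕ) (z : ℕ → M), (∀ n, a n (∑ m ∈ F, a' m (z m)) = 0) →
        ∑ m ∈ F, a' m (z m) = 0 := by
      intro F
      induction F using Finset.induction_on with
      | empty => simp
      | insert n F hn ih =>
        intro z hz
        have hdec : ∀ w, ∃ s t, a n s = 0 ∧ w = s + a' n t := by
          intro w
          obtain ⟨k, hk⟩ := hnil n w
          obtain ⟨s, -, t, -, h1, h2⟩ := exists_decomposition (hself n) (hc n) ⊤ (by simp) (by simp)
            k w (by simp) hk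
          exact ⟨s, t, h1, h2⟩
        choose s t hs hst using hdec
        have hsum : ∑ m ∈ insert n F, a' m (z m) =
            a' n (z n + ∑ m ∈ F, a' m (t (z m))) + ∑ m ∈ F, a' m (s (z m)) := by
          rw [Finset.sum_insert hn, map_add, add_assoc, map_sum, ← Finset.sum_add_distrib]
          congr 1
          refine Finset.sum_congr rfl fun m _ => ?_
          rw [eaa' n m, ← map_add, add_comm (a' n _), ← hst]
        have hF : a n (∑ m ∈ F, a' m (s (z m))) = 0 := by
          rw [map_sum]
          refine Finset.sum_eq_zero fun m hm => ?_
          rw [emix n m _ (by rintro rfl; exact hn hm), hs, map_zero]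
        have h1 := hz n
        rw [hsum, map_add, hF, add_zero] at h1
        have h2 := cre_eq_zero (hself n) (hc n) h1 (hnil n _)
        rw [h2, map_zero, zero_add] at hsum
        rw [hsum]
        refine ih _ fun l => ?_
        rw [← hsum]
        exact hz l
    have hsum : g.sum (fun _ x => x) = ∑ m ∈ g.support, a' m (z m) :=
      Finset.sum_congr rfl fun m _ => (hz m).symm
    rw [hsum] at hw ⊢
    exact key _ _ hw
  · rw [codisjoint_iff, Submodule.eq_top_iff']
    intro w
    obtain ⟨C, hC⟩ := hfin w
    -- The vector is corrected for one oscillator at a time. Those beyond C already kill w, so the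
    -- process stops after C steps.
    have key : ∀ B : ℕ, ∃ s, (∀ n, n < B ∨ C ≤ n → a n s = 0) ∧
        w - s ∈ ⨆ n, LinearMap.range (a' n) := by
      intro B
      induction B with
      | zero => exact ⟨w, fun n hn => hC n (by omega), by simp⟩
      | succ B ih =>
        obtain ⟨s, hs, hws⟩ := ih
        by_cases hBC : C ≤ B
        · exact ⟨s, fun n hn => hs n (by omega), hws⟩
        -- Since B itself is excluded, S is stable under both a_B and a'_B, so the decomposition for
        -- B preserves the vanishing already obtained.
        · let S : Submodule ℂ M := ⨅ n : {n // n < B ∨ C ≤ n}, LinearMap.ker (a n)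
          have hS : ∀ x, x ∈ S ↔ ∀ n, n < B ∨ C ≤ n → a n x = 0 := by
            intro x
            simp [S, Submodule.mem_iInf]
          obtain ⟨k, hk⟩ := hnil B s
          obtain ⟨s', hs', t, -, h1, h2⟩ := exists_decomposition (hself B) (hc B) S
            (fun x hx => by
              rw [hS] at hx ⊢
              intro n hn
              rw [eaa, hx n hn, map_zero])
            (fun x hx => by
              rw [hS] at hx ⊢
              intro n hn
              rw [emix n B _ (by omega), hx n hn, map_zero]) k s ((hS s).mpr hs) hk
          refine ⟨s', fun n hn => ?_, ?_⟩
          · by_cases hnB : n = B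
            · rw [hnB, h1]
            · exact (hS s').mp hs' n (by omega)
          · have : w - s' = (w - s) + a' B t := by rw [h2]; abel
            rw [this]
            exact Submodule.add_mem _ hws (Submodule.mem_iSup_of_mem B ⟨t, rfl⟩)
    obtain ⟨s, hs, hws⟩ := key C
    rw [← add_sub_cancel s w]
    exact Submodule.add_mem_sup (Submodule.mem_iInf _ |>.mpr fun n => hs n (by omega)) hws

end HeisenbergModule

/-! ### Joint eigenspaces of diagonal operators -/

section Diagonal

variable {W ι : Type*} [AddCommGroup W] [Module ℂ W] {N : Submodule ℂ W}
  (β : Module.Basis ι ℂ N) {T H : Module.End ℂ W} {μ lam : ι → ℂ}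

/-- An eigenvector only involves basis vectors with its own eigenvalue; T need not preserve N as a
hypothesis, because it does so on the basis. -/
lemma diag_repr {T : Module.End ℂ W} {μ : ι → ℂ} (hT : ∀ i, T (β i) = μ i • (β i : W)) (r : ℂ)
    (w : N) (hw : T w = r • (w : W)) (i : ι) (hi : β.repr w i ≠ 0) : μ i = r := by
  have h1 : (w : W) = (β.repr w).sum fun i x => x • (β i : W) := by
    conv_lhs => rw [← β.linearCombination_repr w]
    simp [Finsupp.linearCombination_apply, Finsupp.sum]
  have h2 : (β.repr w).sum (fun i x => (x * (μ i - r)) • β i) = 0 := by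
    apply Subtype.ext
    rw [h1, Finsupp.sum, map_sum, Finset.smul_sum, ← sub_eq_zero, ← Finset.sum_sub_distrib] at hw
    rw [Finsupp.sum, Submodule.coe_sum, Submodule.coe_zero, ← hw]
    refine Finset.sum_congr rfl fun i _ => ?_
    rw [map_smul, hT, Submodule.coe_smul]
    module
  have h3 := linearIndependent_iff'.mp β.linearIndependent _ _ h2 i
    (Finsupp.mem_support_iff.mpr hi)
  exact sub_eq_zero.mp ((mul_eq_zero.mp h3).resolve_left hi)

lemma joint_eigenspace_eq_span (hT : ∀ i, T (β i) = μ i • (β i : W))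
    (hH : ∀ i, H (β i) = lam i • (β i : W)) (r : ℂ) :
    N ⊓ LinearMap.ker H ⊓ T.eigenspace r =
      Submodule.span ℂ (Set.range fun i : {i // lam i = 0 ∧ μ i = r} => (β i : W)) := by
  apply le_antisymm
  · rintro w ⟨⟨hN, hHw⟩, hTw⟩
    rw [SetLike.mem_coe, Module.End.mem_eigenspace_iff] at hTw
    rw [SetLike.mem_coe, LinearMap.mem_ker] at hHw
    have h1 : w = (β.repr ⟨w, hN⟩).sum fun i x => x • (β i : W) := by
      have := congrArg Subtype.val (β.linearCombination_repr ⟨w, hN⟩)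
      simpa [Finsupp.linearCombination_apply, Finsupp.sum] using this.symm
    rw [h1]
    refine Submodule.sum_mem _ fun i hi => Submodule.smul_mem _ _ (Submodule.subset_span ?_)
    rw [Finsupp.mem_support_iff] at hi
    exact ⟨⟨i, diag_repr β hH 0 ⟨w, hN⟩ (by simpa using hHw) i hi,
      diag_repr β hT r ⟨w, hN⟩ hTw i hi⟩, rfl⟩
  · rw [Submodule.span_le]
    rintro _ ⟨⟨i, h1, h2⟩, rfl⟩
    refine ⟨⟨(β i).2, ?_⟩, ?_⟩
    · simp [hH, h1]
    · rw [SetLike.mem_coe, Module.End.mem_eigenspace_iff]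
      simp [hT, h2]

lemma finrank_joint_eigenspace (hT : ∀ i, T (β i) = μ i • (β i : W))
    (hH : ∀ i, H (β i) = lam i • (β i : W)) (r : ℂ) (hfin : Finite {i // lam i = 0 ∧ μ i = r}) :
    FiniteDimensional ℂ ↥(N ⊓ LinearMap.ker H ⊓ T.eigenspace r) ∧
    Module.finrank ℂ ↥(N ⊓ LinearMap.ker H ⊓ T.eigenspace r) =
      Nat.card {i // lam i = 0 ∧ μ i = r} := by
  have := Fintype.ofFinite {i // lam i = 0 ∧ μ i = r}
  rw [joint_eigenspace_eq_span β hT hH]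
  refine ⟨FiniteDimensional.span_of_finite ℂ (Set.finite_range _), ?_⟩
  rw [finrank_span_eq_card, Nat.card_eq_fintype_card]
  have h1 := β.linearIndependent.map' N.subtype (Submodule.ker_subtype N)
  exact h1.comp _ Subtype.val_injective

lemma iSup_joint_eigenspace (hT : ∀ i, T (β i) = μ i • (β i : W))
    (hH : ∀ i, H (β i) = lam i • (β i : W)) (hμ : ∀ i, ∃ n : ℕ, μ i = n) :
    ⨆ n : ℕ, N ⊓ LinearMap.ker H ⊓ T.eigenspace (n : ℂ) = N ⊓ LinearMap.ker H := by
  apply le_antisymm (iSup_le fun n => inf_le_left)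
  rintro w ⟨hN, hHw⟩
  rw [SetLike.mem_coe, LinearMap.mem_ker] at hHw
  have h1 : w = (β.repr ⟨w, hN⟩).sum fun i x => x • (β i : W) := by
    have := congrArg Subtype.val (β.linearCombination_repr ⟨w, hN⟩)
    simpa [Finsupp.linearCombination_apply, Finsupp.sum] using this.symm
  rw [h1]
  refine Submodule.sum_mem _ fun i hi => Submodule.smul_mem _ _ ?_
  rw [Finsupp.mem_support_iff] at hi
  obtain ⟨n, hn⟩ := hμ i
  refine Submodule.mem_iSup_of_mem n ?_
  rw [joint_eigenspace_eq_span β hT hH]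
  exact Submodule.subset_span
    ⟨⟨i, diag_repr β hH 0 ⟨w, hN⟩ (by simpa using hHw) i hi, hn⟩, rfl⟩

end Diagonal

namespace ParafermionSl2

/-! ### The parafermion modules -/

/-- The degree of a monomial. -/
def deg (m : Multiset Idx) : ℕ := (m.map fun i => (ofLex i).2 + 1).sum

/-- The `h`-weight of `gen a`. -/
def genWeight : Fin 3 → ℂ := ![0, 2, -2]

/-- The `h`-weight of a monomial. -/
def weight (m : Multiset Idx) : ℂ := (m.map fun i => genWeight (ofLex i).1).sum

lemma deg_cons (i : Idx) (m : Multiset Idx) : deg (i ::ₘ m) = (ofLex i).2 + 1 + deg m := by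
  simp [deg]

lemma weight_cons (i : Idx) (m : Multiset Idx) :
    weight (i ::ₘ m) = genWeight (ofLex i).1 + weight m := by
  simp [weight]

lemma monomial_induction {P : Multiset Idx → Prop} (h0 : P 0)
    (hcons : ∀ i m, (∀ l ∈ m, i ≤ l) → P m → P (i ::ₘ m)) (m : Multiset Idx) : P m := by
  induction hn : m.card generalizing m with
  | zero =>
    obtain rfl := Multiset.card_eq_zero.mp hn
    exact h0
  | succ n ih =>
    obtain ⟨i, m', rfl, hi⟩ := InducedPBW.exists_min m (by rintro rfl; simp at hn)
    rw [Multiset.card_cons, Nat.add_right_cancel_iff] at hn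
    exact hcons i m' hi (ih m' hn)

lemma mode_h_comm (k : ℂ) (j : ℕ) (m n : ℤ) : mode k j h m * mode k j h n =
    mode k j h n * mode k j h m + (if m + n = 0 then (m : ℂ) * (2 * k) else 0) • 1 := by
  rw [mode_comm, lie_self, mode_zero, form_hh, add_zero]

lemma mode_h_comm_apply (k : ℂ) (j : ℕ) {m n : ℤ} (hmn : m + n ≠ 0) (w : WeylModule k j) :
    mode k j h m (mode k j h n w) = mode k j h n (mode k j h m w) := by
  have := congrArg (fun T => T w) (mode_h_comm k j m n)
  simpa [hmn] using this

/-- The creation operators of the Heisenberg subalgebra act by multiplication. -/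
lemma pbw_cons_h (k : ℂ) (j : ℕ) (n : ℕ) (m : Multiset Idx) (v : V j) :
    pbw k j (Finsupp.single (toLex ((0 : Fin 3), n) ::ₘ m) v) =
      mode k j h (-(n + 1)) (pbw k j (Finsupp.single m v)) := by
  induction m using monomial_induction with
  | h0 => exact pbw_cons k j (toLex ((0 : Fin 3), n)) 0 v (by simp)
  | hcons i m hi ih =>
    by_cases hn : toLex ((0 : Fin 3), n) ≤ i
    · exact pbw_cons k j (toLex ((0 : Fin 3), n)) _ v fun l hl =>
        (Multiset.mem_cons.mp hl).elim (fun h => h ▸ hn) fun h => hn.trans (hi l h)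
    · have hlt : i < toLex ((0 : Fin 3), n) := not_le.mp hn
      -- In the lexicographic order the h-modes precede all others, so an index smaller than an
      -- h-mode is an h-mode, and h(-l - 1) commutes with h(-n - 1).
      obtain ⟨l, rfl⟩ : ∃ l : ℕ, i = toLex ((0 : Fin 3), l) := by
        rw [Prod.Lex.lt_iff] at hlt
        rcases hlt with h | h
        · exact absurd h (by simp)
        · exact ⟨(ofLex i).2, by rw [← toLex_ofLex i]; exact congrArg toLex (Prod.ext h.1 rfl)⟩
      rw [Multiset.cons_swap, pbw_cons k j _ (_ ::ₘ m) v fun l' hl' =>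
        (Multiset.mem_cons.mp hl').elim (fun h => h ▸ hlt.le) (hi l'), ih, pbw_cons k j _ m v hi]
      exact mode_h_comm_apply k j (by omega) _

lemma sugawaraL0_pbw (k : ℂ) (hk : k + 2 ≠ 0) (j : ℕ) (m : Multiset Idx) (v : V j) :
    sugawaraL0 k j (pbw k j (Finsupp.single m v)) =
      ((deg m : ℂ) + (j : ℂ) * (j + 2) / (4 * (k + 2))) • pbw k j (Finsupp.single m v) := by
  induction m using monomial_induction with
  | h0 => rw [pbw_zero, sugawaraL0_vac]; simp [deg]
  | hcons i m hi ih =>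
    rw [pbw_cons k j i m v hi, sugawaraL0_mode k hk, ih, map_smul, ← sub_smul, deg_cons]
    congr 1
    push_cast
    ring

lemma mode_h_zero_gen (k : ℂ) (j : ℕ) (a : Fin 3) (m : ℤ) (w : WeylModule k j) :
    mode k j h 0 (mode k j (gen a) m w) =
      mode k j (gen a) m (mode k j h 0 w) + genWeight a • mode k j (gen a) m w := by
  have h1 : ⁅h, gen a⁆ = genWeight a • gen a := by
    fin_cases a
    · simp [gen, genWeight]
    · exact lie_he
    · exact lie_hf
  have := congrArg (fun T => T w) (mode_comm k j h (gen a) 0 m)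
  rw [h1, mode_smul] at this
  simpa using this

lemma mode_h_zero_pbw (k : ℂ) (j : ℕ) (m : Multiset Idx) (i : Fin (j + 1)) :
    mode k j h 0 (pbw k j (Finsupp.single m (Pi.single i 1))) =
      (weight m + ((j : ℂ) - 2 * i)) • pbw k j (Finsupp.single m (Pi.single i 1)) := by
  induction m using monomial_induction with
  | h0 =>
    have h1 : rep j h (Pi.single i 1) = ((j : ℂ) - 2 * i) • Pi.single i 1 := by
      have hh : rep j h = Matrix.toLin' (matH j) := by simp [rep, repMat, h]
      rw [hh, Matrix.toLin'_apply, matH, Matrix.mulVec_single_one]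
      ext l
      by_cases hl : l = i
      · subst hl; simp
      · simp [hl, Matrix.diagonal_apply_ne]
    rw [pbw_zero, mode_apply, loop_zero_smul_vac, h1, map_smul]
    simp [weight]
  | hcons l m hl ih =>
    rw [pbw_cons k j l m _ hl, mode_h_zero_gen, ih, map_smul, ← add_smul, weight_cons]
    congr 1
    ring

/-- The basis of ordered monomials. -/
def pbwBasis (k : ℂ) (j : ℕ) :
    Module.Basis (Σ _ : Multiset Idx, Fin (j + 1)) ℂ (WeylModule k j) :=
  (Finsupp.basis fun _ => Pi.basisFun ℂ (Fin (j + 1))).map (pbw k j)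

lemma pbwBasis_apply (k : ℂ) (j : ℕ) (t : Σ _ : Multiset Idx, Fin (j + 1)) :
    pbwBasis k j t = pbw k j (Finsupp.single t.1 (Pi.single t.2 1)) := by
  simp [pbwBasis, Finsupp.coe_basis]

/-! ### The Heisenberg vacuum space and its eigenbasis -/

/-- The vectors annihilated by `h(n)`, `n > 0`. -/
def vacuumSpace (k : ℂ) (j : ℕ) : Submodule ℂ (WeylModule k j) :=
  ⨅ n : ℕ, LinearMap.ker (mode k j h (n + 1))

/-- The sum of the images of `h(-n)`, `n > 0`. -/
def creationSpace (k : ℂ) (j : ℕ) : Submodule ℂ (WeylModule k j) :=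
  ⨆ n : ℕ, LinearMap.range (mode k j h (-(n + 1)))

lemma mem_vacuumSpace {k : ℂ} {j : ℕ} {w : WeylModule k j} :
    w ∈ vacuumSpace k j ↔ ∀ n : ℕ, mode k j h (n + 1) w = 0 := by
  simp [vacuumSpace, Submodule.mem_iInf]

lemma eq_zero_of_sugawaraL0 (k : ℂ) (hk : k + 2 ≠ 0) (j : ℕ) (r : ℂ) (w : WeylModule k j)
    (hw : sugawaraL0 k j w = r • w)
    (hr : ∀ n : ℕ, (n : ℂ) + (j : ℂ) * (j + 2) / (4 * (k + 2)) ≠ r) : w = 0 := by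
  set b := (pbwBasis k j).map Submodule.topEquiv.symm with hb
  have hT : ∀ t, sugawaraL0 k j (b t) =
      ((deg t.1 : ℂ) + (j : ℂ) * (j + 2) / (4 * (k + 2))) • (b t : WeylModule k j) := by
    intro t
    have : (b t : WeylModule k j) = pbwBasis k j t := by simp [hb]
    rw [this, pbwBasis_apply, sugawaraL0_pbw k hk]
  have h1 : b.repr ⟨w, Submodule.mem_top⟩ = 0 := by
    ext t
    by_contra hne
    exact hr _ (diag_repr b hT r ⟨w, Submodule.mem_top⟩ hw t hne)
  have h2 := b.repr.map_eq_zero_iff.mp h1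
  exact congrArg Subtype.val h2

lemma mode_h_pow_nilpotent (k : ℂ) (hk : k + 2 ≠ 0) (j : ℕ) (n : ℕ) (w : WeylModule k j) :
    ∃ l : ℕ, ((mode k j h (n + 1)) ^ l) w = 0 := by
  obtain ⟨w, rfl⟩ := (pbw k j).surjective w
  induction w using Finsupp.induction_linear with
  | zero => exact ⟨0, by simp⟩
  | add a b ha hb =>
    obtain ⟨p, hp⟩ := ha
    obtain ⟨r, hr⟩ := hb
    refine ⟨p + r, ?_⟩
    rw [map_add, map_add, pow_add, Module.End.mul_apply, Module.End.mul_apply, hr, map_zero,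
      add_zero, ← Module.End.mul_apply, ← pow_add, add_comm p r, pow_add, Module.End.mul_apply, hp,
      map_zero]
  | single m v =>
    have key : ∀ l : ℕ, sugawaraL0 k j
        (((mode k j h (n + 1)) ^ l) (pbw k j (Finsupp.single m v))) =
        ((deg m : ℂ) + (j : ℂ) * (j + 2) / (4 * (k + 2)) - l * (n + 1)) •
          ((mode k j h (n + 1)) ^ l) (pbw k j (Finsupp.single m v)) := by
      intro l
      induction l with
      | zero => simp [sugawaraL0_pbw k hk]
      | succ l ih =>
        rw [pow_succ', Module.End.mul_apply]
        refine (sugawaraL0_mode k hk j 0 (n + 1) _).trans ?_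
        rw [ih, map_smul, ← sub_smul]
        congr 1
        push_cast
        ring
    -- Each application of h(n + 1) lowers the L(0)-eigenvalue by n + 1 ≥ 1, so deg m + 1
    -- applications lead below the lowest eigenvalue, that of the inducing module.
    refine ⟨deg m + 1, eq_zero_of_sugawaraL0 k hk j _ _ (key _) fun l hl => ?_⟩
    have h1 : (l : ℂ) + (deg m + 1) * (n + 1) = deg m := by
      push_cast at hl
      linear_combination hl
    have h2 : l + (deg m + 1) * (n + 1) = deg m := by exact_mod_cast h1
    nlinarith

lemma isCompl_vacuumSpace (k : ℂ) (hk0 : k ≠ 0) (hk : k + 2 ≠ 0) (j : ℕ) :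
    IsCompl (vacuumSpace k j) (creationSpace k j) := by
  refine HeisenbergModule.isCompl_vacuum (a := fun n : ℕ => mode k j h (n + 1))
    (a' := fun n : ℕ => mode k j h (-(n + 1))) (c := fun n => ((n : ℂ) + 1) * (2 * k))
    (fun n => ?_) (fun m n => ?_) (fun m n => ?_) (fun m n hmn => ?_) (fun n => ?_)
    (mode_h_pow_nilpotent k hk j) (fun w => ?_)
  · exact mul_ne_zero (by exact_mod_cast Nat.succ_ne_zero n) (mul_ne_zero two_ne_zero hk0)
  · rw [mode_h_comm, if_neg (by omega), zero_smul, add_zero]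
  · rw [mode_h_comm, if_neg (by omega), zero_smul, add_zero]
  · rw [mode_h_comm, if_neg (by omega), zero_smul, add_zero]
  · rw [mode_h_comm, if_pos (by omega)]
    push_cast
    rfl
  · obtain ⟨B, hB⟩ := mode_eventually_zero k j w
    exact ⟨B, fun n hn => hB h _ (by omega)⟩

/-- Stated for a general operator that rescales the h(m) under commutation, so that it covers L(0),
with factor -m, and h(0), with factor 0. Both then commute with the projection to the vacuum space.
-/
lemma vacuumSpace_invariant (k : ℂ) (j : ℕ) (T : Module.End ℂ (WeylModule k j)) (r : ℤ → ℂ)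
    (hT : ∀ (m : ℤ) (w : WeylModule k j), m ≠ 0 →
      T (mode k j h m w) = mode k j h m (T w) + r m • mode k j h m w) :
    (∀ w ∈ vacuumSpace k j, T w ∈ vacuumSpace k j) ∧
      ∀ w ∈ creationSpace k j, T w ∈ creationSpace k j := by
  constructor
  · intro w hw
    rw [mem_vacuumSpace] at hw ⊢
    intro n
    have := hT (n + 1) w (by omega)
    rw [hw n, map_zero, smul_zero, add_zero] at this
    exact this.symm
  · intro w hw
    rw [creationSpace] at hw ⊢
    induction hw using Submodule.iSup_induction' with
    | mem n x hx =>
      obtain ⟨y, rfl⟩ := hx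
      rw [hT _ _ (by omega), ← map_smul, ← map_add]
      exact Submodule.mem_iSup_of_mem n ⟨_, rfl⟩
    | zero => simp
    | add x y _ _ hx hy => rw [map_add]; exact Submodule.add_mem _ hx hy

lemma projectionOnto_comm {W : Type*} [AddCommGroup W] [Module ℂ W] {p q : Submodule ℂ W}
    (hpq : IsCompl p q) (T : Module.End ℂ W) (hp : ∀ w ∈ p, T w ∈ p) (hq : ∀ w ∈ q, T w ∈ q)
    (w : W) : T (p.projectionOnto q hpq w) = p.projectionOnto q hpq (T w) := by
  obtain ⟨x, hx, y, hy, rfl⟩ := Submodule.mem_sup.mp (hpq.sup_eq_top ▸ Submodule.mem_top (x := w))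
  rw [map_add, map_add, map_add, Submodule.projectionOnto_apply_of_mem_left hpq hx,
    Submodule.projectionOnto_apply_of_mem_left hpq (hp x hx),
    (Submodule.projectionOnto_apply_eq_zero_iff hpq).mpr hy,
    (Submodule.projectionOnto_apply_eq_zero_iff hpq).mpr (hq y hy)]
  simp

/-- The indices of the basis vectors of the vacuum space: ordered monomials without `h(-n)`. -/
abbrev VacIdx (j : ℕ) : Type :=
  {t : Σ _ : Multiset Idx, Fin (j + 1) // ∀ i ∈ t.1, (ofLex i).1 ≠ 0}

/-- By `pbw_cons_h` the operator h(-n) sends basis monomials to basis monomials, by adjoining one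
factor, so its image is visible in the basis. -/
lemma creationSpace_eq_span (k : ℂ) (j : ℕ) : creationSpace k j =
    Submodule.span ℂ (pbwBasis k j '' {t | ∃ i ∈ t.1, (ofLex i).1 = 0}) := by
  apply le_antisymm
  · refine iSup_le fun n => ?_
    rintro _ ⟨w, rfl⟩
    have hw := (pbwBasis k j).mem_span w
    induction hw using Submodule.span_induction with
    | mem w hw =>
      obtain ⟨t, rfl⟩ := hw
      rw [pbwBasis_apply, ← pbw_cons_h]
      exact Submodule.subset_span ⟨⟨toLex ((0 : Fin 3), n) ::ₘ t.1, t.2⟩,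
        ⟨toLex ((0 : Fin 3), n), by simp, rfl⟩, pbwBasis_apply k j _⟩
    | zero => simp
    | add x y _ _ hx hy => rw [map_add]; exact Submodule.add_mem _ hx hy
    | smul r x _ hx => rw [map_smul]; exact Submodule.smul_mem _ _ hx
  · rw [Submodule.span_le]
    rintro _ ⟨⟨m, l⟩, ⟨i, hi, h0⟩, rfl⟩
    obtain ⟨m', rfl⟩ := Multiset.exists_cons_of_mem hi
    have hi' : i = toLex ((0 : Fin 3), (ofLex i).2) := by
      rw [← h0]; rfl
    rw [pbwBasis_apply]
    dsimp only
    rw [hi', pbw_cons_h]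
    exact Submodule.mem_iSup_of_mem (ofLex i).2 ⟨_, rfl⟩

/-- The basis of the vacuum space obtained by projecting the ordered monomials. -/
lemma exists_vacuum_basis (k : ℂ) (hk0 : k ≠ 0) (hk : k + 2 ≠ 0) (j : ℕ) :
    ∃ β : Module.Basis (VacIdx j) ℂ (vacuumSpace k j),
      (∀ t, sugawaraL0 k j (β t) =
        ((deg t.1.1 : ℂ) + (j : ℂ) * (j + 2) / (4 * (k + 2))) • (β t : WeylModule k j)) ∧
      (∀ t, mode k j h 0 (β t) =
        (weight t.1.1 + ((j : ℂ) - 2 * t.1.2)) • (β t : WeylModule k j)) := by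
  have hcompl := isCompl_vacuumSpace k hk0 hk j
  set π := (vacuumSpace k j).projectionOnto (creationSpace k j) hcompl with hπ
  have hker : ∀ w, π w = 0 ↔ w ∈ creationSpace k j :=
    fun w => Submodule.projectionOnto_apply_eq_zero_iff hcompl
  -- A relation after projection is a combination of monomials without h-modes lying in the kernel,
  -- the span of the monomials with h-modes; these are disjoint parts of one basis.
  have hli : LinearIndependent ℂ fun t : VacIdx j => π (pbwBasis k j t.1) := by
    rw [linearIndependent_iff']
    intro s g hg t ht
    have h1 : ∑ i ∈ s, g i • pbwBasis k j i.1 ∈ creationSpace k j := by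
      rw [← hker, map_sum, ← hg]
      exact Finset.sum_congr rfl fun i _ => map_smul _ _ _
    rw [creationSpace_eq_span, Module.Basis.mem_span_image] at h1
    by_contra hne
    have h2 : (pbwBasis k j).repr (∑ i ∈ s, g i • pbwBasis k j i.1) t.1 = g t := by
      rw [map_sum, Finsupp.finsetSum_apply, Finset.sum_eq_single t]
      · simp
      · intro i _ hi
        have : i.1 ≠ t.1 := fun h => hi (Subtype.ext h)
        simp [this]
      · exact fun h => absurd ht h
    obtain ⟨i, hi, h0⟩ := h1 (Finsupp.mem_support_iff.mpr (h2 ▸ hne))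
    exact t.2 i hi h0
  have hspan : ⊤ ≤ Submodule.span ℂ (Set.range fun t : VacIdx j => π (pbwBasis k j t.1)) := by
    rintro x -
    obtain ⟨w, rfl⟩ := Submodule.projectionOnto_surjective hcompl x
    rw [← hπ]
    have hw := (pbwBasis k j).mem_span w
    induction hw using Submodule.span_induction with
    | mem w hw =>
      obtain ⟨t, rfl⟩ := hw
      by_cases ht : ∀ i ∈ t.1, (ofLex i).1 ≠ 0
      · exact Submodule.subset_span ⟨⟨t, ht⟩, rfl⟩
      · push Not at ht
        have : π (pbwBasis k j t) = 0 := by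
          rw [hker, creationSpace_eq_span]
          exact Submodule.subset_span ⟨t, ht, rfl⟩
        rw [this]
        exact Submodule.zero_mem _
    | zero => simp
    | add x y _ _ hx hy => rw [map_add]; exact Submodule.add_mem _ hx hy
    | smul r x _ hx => rw [map_smul]; exact Submodule.smul_mem _ _ hx
  refine ⟨Module.Basis.mk hli hspan, fun t => ?_, fun t => ?_⟩
  · obtain ⟨h1, h2⟩ := vacuumSpace_invariant k j (sugawaraL0 k j) (fun m => -(m : ℂ))
      (fun m w _ => by
        rw [neg_smul, ← sub_eq_add_neg]
        exact sugawaraL0_mode k hk j 0 m w)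
    rw [Module.Basis.mk_apply, projectionOnto_comm hcompl _ h1 h2, pbwBasis_apply,
      sugawaraL0_pbw k hk, map_smul]
    rfl
  · obtain ⟨h1, h2⟩ := vacuumSpace_invariant k j (mode k j h 0) (fun m => 0)
      (fun m w hm => by
        rw [zero_smul, add_zero]
        exact mode_h_comm_apply k j (by omega) w)
    rw [Module.Basis.mk_apply, projectionOnto_comm hcompl _ h1 h2, pbwBasis_apply,
      mode_h_zero_pbw, map_smul]
    rfl

lemma parafermion_eq (k : ℂ) (j : ℕ) :
    parafermion k j = vacuumSpace k j ⊓ LinearMap.ker (mode k j h 0) := by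
  ext w
  rw [Submodule.mem_inf, mem_vacuumSpace, LinearMap.mem_ker]
  constructor
  · intro hw
    exact ⟨fun n => by exact_mod_cast hw (n + 1), hw 0⟩
  · rintro ⟨h1, h2⟩ n
    rcases n with _ | n
    · exact h2
    · exact_mod_cast h1 n

/-- Each Heisenberg term ends with h(n), n ≥ 0, on the right, so the Heisenberg L(0) vanishes on
this space. -/
lemma parafermionL0_apply (k : ℂ) (j : ℕ) (w : WeylModule k j) (hw : w ∈ parafermion k j) :
    parafermionL0 k j w = sugawaraL0 k j w := by
  have h1 : ∀ n : ℕ, heisenbergTerm k j n w = 0 := by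
    intro n
    rw [heisenbergTerm, Module.End.mul_apply, hw n, map_zero]
  have h2 : heisenbergL0 k j w = 0 := by
    rw [heisenbergL0, LinearMap.smul_apply, LinearMap.add_apply, LinearMap.smul_apply,
      locallyFiniteSum_eq_sum _ _ _ 0 (fun n _ => h1 (n + 1)), h1]
    simp
  rw [parafermionL0, LinearMap.sub_apply, h2, sub_zero]

lemma weightSpace_eq (k : ℂ) (j n : ℕ) : weightSpace k j n =
    vacuumSpace k j ⊓ LinearMap.ker (mode k j h 0) ⊓ (sugawaraL0 k j).eigenspace (n : ℂ) := by
  rw [weightSpace, ← parafermion_eq]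
  ext w
  simp only [Submodule.mem_inf, Module.End.mem_eigenspace_iff]
  exact and_congr_right fun hw => by rw [parafermionL0_apply k j w hw]

lemma finite_deg_le (n : ℕ) : {m : Multiset Idx | deg m ≤ n}.Finite := by
  induction n with
  | zero =>
    refine (Set.finite_singleton 0).subset fun m hm => ?_
    induction m using Multiset.induction_on with
    | empty => rfl
    | cons i m _ => rw [Set.mem_ofPred_eq, deg_cons] at hm; omega
  | succ n ih =>
    have hI : {i : Idx | (ofLex i).2 ≤ n}.Finite := by
      refine ((Set.finite_univ (α := Fin 3)).prod (Set.finite_Iic n)).preimage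
        (f := (ofLex : Idx → Fin 3 × ℕ)) (ofLex.injective.injOn) |>.subset fun i hi => ?_
      exact ⟨Set.mem_univ _, hi⟩
    refine ((Set.finite_singleton 0).union (hI.image2 (· ::ₘ ·) ih)).subset fun m hm => ?_
    induction m using Multiset.induction_on with
    | empty => exact Or.inl rfl
    | cons i m _ =>
      rw [Set.mem_ofPred_eq, deg_cons] at hm
      exact Or.inr ⟨i, by simp only [Set.mem_ofPred_eq]; omega, m,
        by simp only [Set.mem_ofPred_eq]; omega, rfl⟩

/-- The character of the parafermion module counts monomials in `e(-n)`, `f(-n)` of weight `0`. -/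
lemma parafermion_character (k : ℂ) (hk0 : k ≠ 0) (hk : k + 2 ≠ 0) (j d : ℕ)
    (hd : (j : ℂ) * (j + 2) / (4 * (k + 2)) = d) :
    HasPowerSeriesCharacter k j ∧ ∀ n : ℕ, Module.finrank ℂ (weightSpace k j n) =
      Nat.card {t : VacIdx j // weight t.1.1 + ((j : ℂ) - 2 * t.1.2) = 0 ∧ deg t.1.1 + d = n} := by
  obtain ⟨β, hT, hH⟩ := exists_vacuum_basis k hk0 hk j
  rw [hd] at hT
  have hiff : ∀ (t : VacIdx j) (n : ℕ), ((deg t.1.1 : ℂ) + d = n) ↔ (deg t.1.1 + d = n) :=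
    fun t n => by exact_mod_cast Iff.rfl
  have hfin : ∀ n : ℕ, Finite {t : VacIdx j //
      weight t.1.1 + ((j : ℂ) - 2 * t.1.2) = 0 ∧ (deg t.1.1 : ℂ) + d = n} := by
    intro n
    have h1 := (finite_deg_le n).prod (Set.finite_univ (α := Fin (j + 1)))
    have := h1.to_subtype
    refine Finite.of_injective (fun t => (⟨(t.1.1.1, t.1.1.2), ?_, Set.mem_univ _⟩ :
      ({m : Multiset Idx | deg m ≤ n} ×ˢ (Set.univ : Set (Fin (j + 1))) : Set _))) ?_
    · have := (hiff t.1 n).mp t.2.2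
      change deg t.1.1.1 ≤ n
      omega
    · rintro ⟨⟨⟨m, l⟩, h1⟩, h2⟩ ⟨⟨⟨m', l'⟩, h1'⟩, h2'⟩ h
      obtain ⟨rfl, rfl⟩ := Prod.mk.injEq _ _ _ _ ▸ congrArg Subtype.val h
      rfl
  refine ⟨⟨?_, fun n => ?_⟩, fun n => ?_⟩
  · simp only [weightSpace_eq]
    rw [parafermion_eq]
    exact iSup_joint_eigenspace β hT hH fun t => ⟨deg t.1.1 + d, by push_cast; rfl⟩
  · rw [weightSpace_eq]
    exact (finrank_joint_eigenspace β hT hH n (hfin n)).1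
  · rw [weightSpace_eq, (finrank_joint_eigenspace β hT hH n (hfin n)).2]
    simp only [hiff]

end ParafermionSl2

/-! ### Infinite sums of power series -/

namespace QSeriesTools

open PowerSeries

variable {ι : Type*}

lemma summable_of_finite {f : ι → PowerSeries ℤ}
    (hf : ∀ n, {i | coeff n (f i) ≠ 0}.Finite) : Summable f := by
  rw [PowerSeries.WithPiTopology.summable_iff_summable_coeff]
  intro n
  exact summable_of_hasFiniteSupport (hf n)

/-- A family whose members are divisible by powers of `X` with finite fibres is summable. -/
lemma summable_X_pow_mul (e : ι → ℕ) (he : ∀ n, {i | e i ≤ n}.Finite) (g : ι → PowerSeries ℤ) :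
    Summable fun i => X ^ e i * g i := by
  refine summable_of_finite fun n => (he n).subset fun i hi => ?_
  by_contra hc
  apply hi
  rw [coeff_X_pow_mul', if_neg (show ¬ e i ≤ n from hc)]

lemma summable_nat (e : ℕ → ℕ) (he : ∀ n, n ≤ e n) (g : ℕ → PowerSeries ℤ) :
    Summable fun i => X ^ e i * g i :=
  summable_X_pow_mul e (fun n => (Set.finite_Iic n).subset fun i hi => (he i).trans hi) g

lemma hasSum_X_pow (e : ι → ℕ) (he : ∀ n, {i | e i = n}.Finite) :
    HasSum (fun i => (X : PowerSeries ℤ) ^ e i) (mk fun n => (Nat.card {i // e i = n} : ℤ)) := by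
  rw [PowerSeries.WithPiTopology.hasSum_iff_hasSum_coeff]
  intro n
  have h1 : (fun i => coeff n ((X : PowerSeries ℤ) ^ e i)) =
      Set.indicator {i | e i = n} fun _ => 1 := by
    ext i
    by_cases hi : e i = n
    · simp [coeff_X_pow, hi]
    · simp [coeff_X_pow, hi, Ne.symm hi]
  rw [h1, coeff_mk]
  have h2 : HasSum (Set.indicator {i | e i = n} fun _ => (1 : ℤ))
      (∑ b ∈ (he n).toFinset, Set.indicator {i | e i = n} (fun _ => (1 : ℤ)) b) :=
    hasSum_sum_of_ne_finset_zero (by simp +contextual)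
  have h3 : (∑ b ∈ (he n).toFinset, Set.indicator {i | e i = n} (fun _ => (1 : ℤ)) b) =
      Nat.card {i // e i = n} := by
    rw [Finset.sum_congr rfl (g := fun _ => (1 : ℤ)) (by simp +contextual), Finset.sum_const,
      nsmul_eq_mul, mul_one, ← Nat.card_eq_card_finite_toFinset]
    rfl
  rw [← h3]
  exact h2

lemma tendsto_one {f : ℕ → PowerSeries ℤ} (g : ℕ → PowerSeries ℤ)
    (hf : ∀ n, f n = 1 + X ^ (n + 1) * g n) : Filter.Tendsto f Filter.atTop (nhds 1) := by
  rw [PowerSeries.WithPiTopology.tendsto_iff_coeff_tendsto]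
  intro d
  refine tendsto_const_nhds.congr' ?_
  filter_upwards [Filter.eventually_ge_atTop d] with n hn
  rw [hf, map_add, coeff_X_pow_mul', if_neg (by omega), add_zero]

/-! ### Euler's identities -/

/-- `(q; q)_a`. -/
def qFac (a : ℕ) : PowerSeries ℤ := ∏ l ∈ Finset.range a, (1 - X ^ (l + 1))

/-- `(q; q)_∞`. -/
def qInf : PowerSeries ℤ := ∏' n : ℕ, (1 - (X : PowerSeries ℤ) ^ (n + 1))

/-- `1 / (q; q)_a`. -/
def qFacInv (a : ℕ) : PowerSeries ℤ := invOfUnit (qFac a) 1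

lemma qFac_succ (a : ℕ) : qFac (a + 1) = qFac a * (1 - X ^ (a + 1)) := by
  rw [qFac, Finset.prod_range_succ, ← qFac]

lemma qFac_zero : qFac 0 = 1 := by simp [qFac]

lemma qFac_mul_inv (a : ℕ) : qFac a * qFacInv a = 1 := by
  refine mul_invOfUnit _ _ ?_
  rw [qFac, map_prod]
  simp

lemma qFacInv_zero : qFacInv 0 = 1 := by
  have := qFac_mul_inv 0
  rwa [qFac_zero, one_mul] at this

lemma qFacInv_succ (a : ℕ) : (1 - X ^ (a + 1)) * qFacInv (a + 1) = qFacInv a := by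
  have h1 := qFac_mul_inv (a + 1)
  rw [qFac_succ] at h1
  calc _ = (qFac a * qFacInv a) * ((1 - X ^ (a + 1)) * qFacInv (a + 1)) := by
        rw [qFac_mul_inv, one_mul]
    _ = qFacInv a * (qFac a * (1 - X ^ (a + 1)) * qFacInv (a + 1)) := by ring
    _ = _ := by rw [h1, mul_one]

lemma tendsto_qFac : Filter.Tendsto qFac Filter.atTop (nhds qInf) :=
  (PowerSeries.WithPiTopology.multipliable_one_sub_X_pow (R := ℤ)).hasProd.tendsto_prod_nat

/-- `∑_b q^{b (m + 1)} / (q; q)_b`. -/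
def eulerE (m : ℕ) : PowerSeries ℤ := ∑' b : ℕ, X ^ (b * (m + 1)) * qFacInv b

lemma summable_eulerE (m : ℕ) : Summable fun b : ℕ => X ^ (b * (m + 1)) * qFacInv b :=
  summable_nat _ (fun n => by nlinarith) _

lemma eulerE_eq_one_add (m : ℕ) :
    eulerE m = 1 + X ^ (m + 1) * ∑' b : ℕ, X ^ (b * (m + 1)) * qFacInv (b + 1) := by
  have hs : Summable fun b : ℕ => X ^ (b * (m + 1)) * qFacInv (b + 1) :=
    summable_nat _ (fun n => by nlinarith) _
  rw [eulerE, (summable_eulerE m).tsum_eq_zero_add, ← hs.tsum_mul_left]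
  simp only [zero_mul, pow_zero, qFacInv_zero, one_mul]
  congr 2
  ext1 b
  ring

lemma eulerE_succ (m : ℕ) : eulerE (m + 1) = (1 - X ^ (m + 1)) * eulerE m := by
  have h1 : eulerE m - eulerE (m + 1) = X ^ (m + 1) * eulerE m := by
    rw [eulerE, eulerE, ← (summable_eulerE m).tsum_sub (summable_eulerE (m + 1)),
      ((summable_eulerE m).sub (summable_eulerE (m + 1))).tsum_eq_zero_add,
      ← (summable_eulerE m).tsum_mul_left]
    simp only [zero_mul, sub_self, zero_add]
    congr 1
    ext1 b
    rw [← qFacInv_succ b]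
    ring
  linear_combination -h1

/-- Euler's ∑ z^b / (q;q)_b = 1 / (z;q)_∞ at z = q^{m+1}. The functional equation `eulerE_succ`
determines the series up to a constant, which is fixed by letting m tend to infinity, where the
series tends to 1. -/
lemma eulerE_mul_qInf (m : ℕ) : eulerE m * qInf = qFac m := by
  have h1 : ∀ m, eulerE m = eulerE 0 * qFac m := by
    intro m
    induction m with
    | zero => rw [qFac_zero, mul_one]
    | succ m ih => rw [eulerE_succ, ih, qFac_succ]; ring
  have h2 : eulerE 0 * qInf = 1 := by
    refine tendsto_nhds_unique (tendsto_qFac.const_mul (eulerE 0)) ?_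
    simp only [← h1]
    exact tendsto_one _ eulerE_eq_one_add
  rw [h1, mul_right_comm, h2, one_mul]

/-- The triangular numbers. -/
def tri (n : ℕ) : ℕ := n * (n + 1) / 2

lemma two_mul_tri (n : ℕ) : 2 * tri n = n * (n + 1) :=
  Nat.mul_div_cancel' (Nat.even_mul_succ_self n).two_dvd

lemma tri_succ (n : ℕ) : tri (n + 1) = tri n + n + 1 := by
  have h1 := two_mul_tri n
  have h2 := two_mul_tri (n + 1)
  nlinarith

lemma le_tri (n : ℕ) : n ≤ tri n := by
  induction n with
  | zero => simp
  | succ n ih => rw [tri_succ]; omega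

/-- `∑_n (-1)^n q^{n (n + 1) / 2 + n a} / (q; q)_n`. -/
def eulerH (a : ℕ) : PowerSeries ℤ := ∑' n : ℕ, X ^ (tri n + n * a) * ((-1) ^ n * qFacInv n)

lemma summable_eulerH (a : ℕ) :
    Summable fun n : ℕ => X ^ (tri n + n * a) * ((-1) ^ n * qFacInv n) :=
  summable_nat _ (fun n => (le_tri n).trans (Nat.le_add_right _ _)) _

lemma eulerH_eq_one_add (a : ℕ) : eulerH a = 1 + X ^ (a + 1) *
    ∑' n : ℕ, X ^ (tri n + n + n * a) * ((-1) ^ (n + 1) * qFacInv (n + 1)) := by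
  have hs : Summable fun n : ℕ => X ^ (tri n + n + n * a) * ((-1) ^ (n + 1) * qFacInv (n + 1)) :=
    summable_nat _ (fun n => by have := le_tri n; nlinarith) _
  rw [eulerH, (summable_eulerH a).tsum_eq_zero_add, ← hs.tsum_mul_left]
  have h0 : tri 0 = 0 := rfl
  simp only [h0, zero_mul, pow_zero, qFacInv_zero, one_mul, add_zero]
  congr 2
  ext1 n
  rw [tri_succ]
  ring

lemma eulerH_succ (a : ℕ) : eulerH a = (1 - X ^ (a + 1)) * eulerH (a + 1) := by
  have h1 : eulerH a - eulerH (a + 1) = -X ^ (a + 1) * eulerH (a + 1) := by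
    rw [eulerH, eulerH, ← (summable_eulerH a).tsum_sub (summable_eulerH (a + 1)),
      ((summable_eulerH a).sub (summable_eulerH (a + 1))).tsum_eq_zero_add,
      ← (summable_eulerH (a + 1)).tsum_mul_left]
    simp only [zero_mul, sub_self, zero_add]
    congr 1
    ext1 n
    rw [← qFacInv_succ n, tri_succ]
    ring
  linear_combination h1

/-- Euler's second identity, an expansion of (z;q)_∞ at z = q^{a+1}, by the same method: functional
equation and limit. -/
lemma eulerH_eq (a : ℕ) : eulerH a = qInf * qFacInv a := by
  have h1 : ∀ a, eulerH 0 = qFac a * eulerH a := by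
    intro a
    induction a with
    | zero => rw [qFac_zero, one_mul]
    | succ a ih => rw [ih, eulerH_succ, qFac_succ]; ring
  have h2 : eulerH 0 = qInf := by
    refine tendsto_nhds_unique (l := Filter.atTop) (f := fun _ : ℕ => eulerH 0) tendsto_const_nhds ?_
    have := tendsto_qFac.mul (tendsto_one _ eulerH_eq_one_add)
    rw [mul_one] at this
    exact this.congr fun a => (h1 a).symm
  rw [← h2, h1 a, mul_right_comm, qFac_mul_inv, one_mul]

/-! ### False theta functions and pairs of partitions -/

/-- The series `∑_{n ≥ 0} (-1)^n q^{n (n + 1) / 2 + (n + 1) i}`. -/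
def falseTheta (i : ℕ) : PowerSeries ℤ := ∑' n : ℕ, X ^ (tri n + (n + 1) * i) * (-1) ^ n

lemma summable_falseTheta (i : ℕ) : Summable fun n : ℕ =>
    (X : PowerSeries ℤ) ^ (tri n + (n + 1) * i) * (-1) ^ n :=
  summable_nat _ (fun n => (le_tri n).trans (Nat.le_add_right _ _)) _

/-- Term b + 1 of the first series cancels term b of the second, since T(b + 1) = T(b) + b + 1 for
triangular numbers; only the leading 1 survives. -/
lemma falseTheta_zero_add_one : falseTheta 0 + falseTheta 1 = 1 := by
  rw [falseTheta, falseTheta, (summable_falseTheta 0).tsum_eq_zero_add, add_assoc]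
  have hs := (summable_nat_add_iff 1).mpr (summable_falseTheta 0)
  rw [← hs.tsum_add (summable_falseTheta 1)]
  have h0 : tri 0 = 0 := rfl
  have : ∀ b : ℕ, (X : PowerSeries ℤ) ^ (tri (b + 1) + (b + 1 + 1) * 0) * (-1) ^ (b + 1) +
      X ^ (tri b + (b + 1) * 1) * (-1) ^ b = 0 := by
    intro b
    rw [tri_succ]
    ring
  simp only [this, tsum_zero, h0]
  simp

/-- The generating function of partitions with exactly `a` parts. -/
def parts (a : ℕ) : PowerSeries ℤ := X ^ a * qFacInv a

/-- The generating function of pairs of partitions whose numbers of parts differ by `i`. -/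
def partPairs (i : ℕ) : PowerSeries ℤ := ∑' b : ℕ, parts (b + i) * parts b

/-- One factor (q;q)_∞ turns 1 / (q;q)_{b+i} into the alternating series `eulerH`. After exchanging
the two summations, the sum over b is `eulerE (n + 1)`, which the second factor (q;q)_∞ turns into
(q;q)_{n+1}. Dividing by (q;q)_n leaves 1 - q^{n+1}, whose two terms give the two false theta
series. -/
lemma qInf_sq_mul_partPairs (i : ℕ) :
    qInf ^ 2 * partPairs i = falseTheta i - falseTheta (i + 1) := by
  set u : ℕ × ℕ → PowerSeries ℤ := fun p =>
    X ^ (i + 2 * p.1 + (tri p.2 + p.2 * (p.1 + i))) * ((-1) ^ p.2 * qFacInv p.2 * qFacInv p.1)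
    with hu
  have hsum : Summable u := by
    refine summable_X_pow_mul (fun p : ℕ × ℕ => i + 2 * p.1 + (tri p.2 + p.2 * (p.1 + i)))
      (fun n => ?_) _
    refine ((Set.finite_Iic n).prod (Set.finite_Iic n)).subset fun p hp => ?_
    have h1 : i + 2 * p.1 + (tri p.2 + p.2 * (p.1 + i)) ≤ n := hp
    have h2 := le_tri p.2
    have h3 : 0 ≤ p.2 * (p.1 + i) := Nat.zero_le _
    exact ⟨by simp only [Set.mem_Iic]; omega, by simp only [Set.mem_Iic]; omega⟩
  have hb : ∀ b, HasSum (fun n => u (b, n)) (X ^ (i + 2 * b) * qFacInv b * eulerH (b + i)) := by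
    intro b
    have h1 := (summable_eulerH (b + i)).hasSum.mul_left (X ^ (i + 2 * b) * qFacInv b)
    refine h1.congr_fun ?_
    intro n
    simp only [hu]
    ring
  have hn : ∀ n, HasSum (fun b => u (b, n))
      (X ^ (tri n + (n + 1) * i) * (-1) ^ n * qFacInv n * eulerE (n + 1)) := by
    intro n
    have h1 := (summable_eulerE (n + 1)).hasSum.mul_left
      (X ^ (tri n + (n + 1) * i) * (-1) ^ n * qFacInv n)
    refine h1.congr_fun ?_
    intro b
    simp only [hu]
    ring
  have e1 : qInf * partPairs i = ∑' p, u p := by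
    have h1 := (hsum.hasSum.prod_fiberwise hb).tsum_eq
    have hs : Summable fun b => parts (b + i) * parts b := by
      have := summable_nat (fun b => b) (fun n => le_rfl)
        (fun b => X ^ (b + i) * qFacInv (b + i) * qFacInv b)
      refine this.congr fun b => ?_
      simp only [parts]
      ring
    rw [← h1, partPairs, ← hs.tsum_mul_left]
    congr 1
    ext1 b
    rw [eulerH_eq, parts, parts]
    ring
  have e2 : qInf * ∑' p, u p = falseTheta i - falseTheta (i + 1) := by
    have hswap : HasSum (fun p : ℕ × ℕ => u p.swap) (∑' p, u p) :=
      (Equiv.prodComm ℕ ℕ).hasSum_iff.mpr hsum.hasSum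
    have h1 := hswap.prod_fiberwise hn
    have h2 := (h1.mul_left qInf).tsum_eq
    rw [← h2, falseTheta, falseTheta,
      ← (summable_falseTheta i).tsum_sub (summable_falseTheta (i + 1))]
    congr 1
    ext1 n
    have h3 : qFacInv n * qFac (n + 1) = 1 - X ^ (n + 1) := by
      rw [qFac_succ, ← mul_assoc, mul_comm (qFacInv n), qFac_mul_inv, one_mul]
    have h4 := eulerE_mul_qInf (n + 1)
    calc _ = X ^ (tri n + (n + 1) * i) * (-1) ^ n * qFacInv n * (eulerE (n + 1) * qInf) := by ring
      _ = X ^ (tri n + (n + 1) * i) * (-1) ^ n * (qFacInv n * qFac (n + 1)) := by rw [h4]; ring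
      _ = _ := by rw [h3]; ring
  rw [← e2, ← e1]
  ring

end QSeriesTools

/-! ### Generating functions of multisets -/

namespace QSeriesTools

open PowerSeries ParafermionSl2

/-- The number partitioned by the parts `n + 1`, `n ∈ m`. -/
def size (m : Multiset ℕ) : ℕ := (m.map fun n => n + 1).sum

lemma size_cons (n : ℕ) (m : Multiset ℕ) : size (n ::ₘ m) = n + 1 + size m := by simp [size]

lemma size_map_succ (m : Multiset ℕ) : size (m.map Nat.succ) = size m + m.card := by
  induction m using Multiset.induction with
  | empty => simp [size]
  | cons a m ih => rw [Multiset.map_cons, size_cons, size_cons, ih, Multiset.card_cons]; omega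

lemma deg_map_toLex (c : Fin 3) (m : Multiset ℕ) :
    deg (m.map fun n => toLex (c, n)) = size m := by
  rw [deg, Multiset.map_map]
  rfl

lemma map_toLex_injective (c : Fin 3) :
    Function.Injective (Multiset.map fun n : ℕ => (toLex (c, n) : Idx)) :=
  Multiset.map_injective fun _ _ hab => (Prod.mk.inj (toLex.injective hab)).2

lemma finite_size_le (n : ℕ) : {m : Multiset ℕ | size m ≤ n}.Finite := by
  refine Set.Finite.of_finite_image ((finite_deg_le n).subset ?_)
    (map_toLex_injective 0).injOn
  rintro _ ⟨m, hm, rfl⟩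
  exact (deg_map_toLex 0 m).le.trans hm

/-- The partitions with `a` parts. -/
abbrev PartsOf (a : ℕ) := {m : Multiset ℕ // m.card = a}

/-- Splitting the partitions with `a + 1` parts according to whether `1` is a part. -/
def splitParts (a : ℕ) : PartsOf a ⊕ PartsOf (a + 1) → PartsOf (a + 1)
  | Sum.inl m => ⟨0 ::ₘ m.1, by simp [m.2]⟩
  | Sum.inr m => ⟨m.1.map Nat.succ, by simp [m.2]⟩

lemma splitParts_bijective (a : ℕ) : Function.Bijective (splitParts a) := by
  constructor
  · rintro (m | m) (m' | m') hm
    · have := congrArg Subtype.val hm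
      simp only [splitParts, Multiset.cons_inj_right] at this
      rw [Subtype.ext this]
    · have h0 : (0 : ℕ) ∈ m'.1.map Nat.succ := by
        rw [← show 0 ::ₘ m.1 = m'.1.map Nat.succ from congrArg Subtype.val hm]
        exact Multiset.mem_cons_self 0 m.1
      simp at h0
    · have h0 : (0 : ℕ) ∈ m.1.map Nat.succ := by
        rw [show m.1.map Nat.succ = 0 ::ₘ m'.1 from congrArg Subtype.val hm]
        exact Multiset.mem_cons_self 0 m'.1
      simp at h0
    · have := Multiset.map_injective Nat.succ_injective (congrArg Subtype.val hm)
      rw [Subtype.ext this]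
  · rintro ⟨m, hm⟩
    by_cases h0 : 0 ∈ m
    · obtain ⟨m', rfl⟩ := Multiset.exists_cons_of_mem h0
      exact ⟨Sum.inl ⟨m', by simpa using hm⟩, rfl⟩
    · refine ⟨Sum.inr ⟨m.map Nat.pred, by simpa using hm⟩, Subtype.ext ?_⟩
      change (m.map Nat.pred).map Nat.succ = m
      rw [Multiset.map_map]
      conv_rhs => rw [← Multiset.map_id m]
      refine Multiset.map_congr rfl fun n hn => ?_
      exact Nat.succ_pred_eq_of_ne_zero fun hc => h0 (hc ▸ hn)

lemma hasSum_parts (a : ℕ) :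
    HasSum (fun m : PartsOf a => (X : PowerSeries ℤ) ^ size m.1) (parts a) := by
  have hs : ∀ a, Summable fun m : PartsOf a => (X : PowerSeries ℤ) ^ size m.1 := fun a =>
    (hasSum_X_pow _ fun n => Set.Finite.of_finite_image ((finite_size_le n).subset
      (by rintro _ ⟨m, hm, rfl⟩; exact le_of_eq hm)) Subtype.val_injective.injOn).summable
  have key : ∀ a, ∑' m : PartsOf a, (X : PowerSeries ℤ) ^ size m.1 = parts a := by
    intro a
    induction a with
    | zero =>
      have hu : ∀ m : PartsOf 0, m = ⟨0, rfl⟩ := fun m => Subtype.ext (Multiset.card_eq_zero.mp m.2)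
      rw [tsum_eq_single ⟨0, rfl⟩ fun m hm => absurd (hu m) hm]
      simp [parts, qFacInv_zero, size]
    | succ a ih =>
      set g := ∑' m : PartsOf (a + 1), (X : PowerSeries ℤ) ^ size m.1 with hg
      have h1 := (Equiv.ofBijective _ (splitParts_bijective a)).hasSum_iff.mpr (hs (a + 1)).hasSum
      have h2 : HasSum ((fun m : PartsOf (a + 1) => (X : PowerSeries ℤ) ^ size m.1) ∘
          splitParts a) (X * parts a + X ^ (a + 1) * g) := by
        refine HasSum.sum (M := PowerSeries ℤ) ?_ ?_
        · rw [← ih]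
          refine ((hs a).hasSum.mul_left X).congr_fun fun m => ?_
          simp only [Function.comp_apply, splitParts, size_cons]
          ring
        · refine ((hs (a + 1)).hasSum.mul_left (X ^ (a + 1))).congr_fun fun m => ?_
          simp only [Function.comp_apply, splitParts, size_map_succ, m.2]
          ring
      -- Partitions with a + 1 parts either contain a part 1, which is removed, or have every part
      -- decreased by 1.
      have h3 : g = X * parts a + X ^ (a + 1) * g := h1.unique h2
      have h4 : (1 - X ^ (a + 1) : PowerSeries ℤ) * (g - parts (a + 1)) = 0 := by
        have h5 := qFacInv_succ a
        rw [parts] at h3 ⊢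
        linear_combination h3 - X ^ (a + 1) * h5
      have hne : (1 - X ^ (a + 1) : PowerSeries ℤ) ≠ 0 := by
        intro hc
        have := congrArg (constantCoeff (R := ℤ)) hc
        simp at this
      exact sub_eq_zero.mp ((mul_eq_zero.mp h4).resolve_left hne)
  exact key a ▸ (hs a).hasSum

/-- Pairs of partitions whose numbers of parts satisfy a relation. -/
abbrev PartPairs (r : ℕ → ℕ → Prop) := {x : Multiset ℕ × Multiset ℕ // r x.1.card x.2.card}

lemma summable_partPairs (r : ℕ → ℕ → Prop) :
    Summable fun x : PartPairs r => (X : PowerSeries ℤ) ^ (size x.1.1 + size x.1.2) := by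
  refine (hasSum_X_pow _ fun n => Set.Finite.of_finite_image
    (((finite_size_le n).prod (finite_size_le n)).subset ?_)
    Subtype.val_injective.injOn).summable
  rintro _ ⟨x, hx, rfl⟩
  have hx : size x.1.1 + size x.1.2 = n := hx
  exact ⟨show size x.1.1 ≤ n by omega, show size x.1.2 ≤ n by omega⟩

lemma hasSum_partPairs (i : ℕ) :
    HasSum (fun x : PartPairs (fun a b => a = b + i) =>
      (X : PowerSeries ℤ) ^ (size x.1.1 + size x.1.2)) (partPairs i) := by
  let E : (Σ b : ℕ, PartsOf (b + i) × PartsOf b) ≃ PartPairs (fun a b => a = b + i) :=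
    { toFun := fun y => ⟨(y.2.1.1, y.2.2.1), by simp only [y.2.1.2, y.2.2.2]⟩
      invFun := fun x => ⟨x.1.2.card, ⟨x.1.1, x.2⟩, ⟨x.1.2, rfl⟩⟩
      left_inv := by
        rintro ⟨b, ⟨m, hm⟩, ⟨m', hm'⟩⟩
        obtain rfl := hm'
        rfl
      right_inv := fun x => rfl }
  have h1 := E.hasSum_iff.mpr (summable_partPairs (fun a b => a = b + i)).hasSum
  have h2 : ∀ b, HasSum (fun y : PartsOf (b + i) × PartsOf b =>
      (X : PowerSeries ℤ) ^ (size y.1.1 + size y.2.1)) (parts (b + i) * parts b) := by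
    intro b
    have h3 := (hasSum_parts (b + i)).mul (hasSum_parts b) (by
      refine (hasSum_X_pow (fun y : PartsOf (b + i) × PartsOf b => size y.1.1 + size y.2.1)
        fun n => ?_).summable.congr fun y => by rw [pow_add]
      refine Set.Finite.of_finite_image (f := fun y => (y.1.1, y.2.1))
        (((finite_size_le n).prod (finite_size_le n)).subset ?_) ?_
      · rintro _ ⟨x, hx, rfl⟩
        have hx : size x.1.1 + size x.2.1 = n := hx
        exact ⟨show size x.1.1 ≤ n by omega, show size x.2.1 ≤ n by omega⟩
      · intro x _ y _ hxy
        have := Prod.mk.inj hxy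
        exact Prod.ext (Subtype.ext this.1) (Subtype.ext this.2))
    exact h3.congr_fun fun y => by rw [pow_add]
  have h4 := h1.sigma h2
  rw [partPairs, h4.tsum_eq]
  exact (summable_partPairs _).hasSum

/-- The two partitions enter symmetrically, so only |i - s| matters; with truncated subtraction this
is i - s + (s - i). -/
lemma hasSum_partPairs_balanced (s i : ℕ) :
    HasSum (fun x : PartPairs (fun a b => a + s = b + i) =>
      (X : PowerSeries ℤ) ^ (size x.1.1 + size x.1.2)) (partPairs (i - s + (s - i))) := by
  rcases le_total s i with hi | hi
  · have e0 : i - s + (s - i) = i - s := by omega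
    have : (fun a b => a + s = b + i) = fun a b : ℕ => a = b + (i - s) := by
      ext a b; omega
    rw [e0, this]
    exact hasSum_partPairs _
  · have e0 : i - s + (s - i) = s - i := by omega
    rw [e0]
    let E : PartPairs (fun a b => a = b + (s - i)) ≃ PartPairs (fun a b => a + s = b + i) :=
      { toFun := fun x => ⟨x.1.swap, by
          have := x.2
          simp only [Prod.fst_swap, Prod.snd_swap]
          omega⟩
        invFun := fun x => ⟨x.1.swap, by
          have := x.2
          simp only [Prod.fst_swap, Prod.snd_swap]
          omega⟩
        left_inv := fun x => rfl
        right_inv := fun x => rfl }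
    rw [← E.hasSum_iff]
    exact (hasSum_partPairs (s - i)).congr_fun fun x => by
      simp only [Function.comp_apply]
      rw [add_comm]
      rfl

end QSeriesTools

/-! ### Vectors of weight zero as pairs of partitions -/

namespace ParafermionSl2

open PowerSeries QSeriesTools

/-- The indices of the vectors of `h(0)`-weight `0`. -/
abbrev ZeroWeightIdx (j : ℕ) := {t : VacIdx j // weight t.1.1 + ((j : ℂ) - 2 * t.1.2) = 0}

/-- The multiset of indices of a monomial in the modes of `e` and `f`. -/
def mergeEF (x : Multiset ℕ × Multiset ℕ) : Multiset Idx :=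
  x.1.map (fun n => toLex (1, n)) + x.2.map fun n => toLex (2, n)

lemma deg_mergeEF (x : Multiset ℕ × Multiset ℕ) : deg (mergeEF x) = size x.1 + size x.2 := by
  rw [← deg_map_toLex 1, ← deg_map_toLex 2]
  simp [deg, mergeEF]

lemma weight_mergeEF (x : Multiset ℕ × Multiset ℕ) :
    weight (mergeEF x) = 2 * ((x.1.card : ℂ) - x.2.card) := by
  rw [weight, mergeEF, Multiset.map_add, Multiset.sum_add, Multiset.map_map, Multiset.map_map]
  change (x.1.map fun _ => (2 : ℂ)).sum + (x.2.map fun _ => (-2 : ℂ)).sum = _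
  simp
  ring

lemma filter_mergeEF_one (x : Multiset ℕ × Multiset ℕ) :
    (mergeEF x).filter (fun i => (ofLex i).1 = 1) = x.1.map fun n => toLex (1, n) := by
  rw [mergeEF, Multiset.filter_add, Multiset.filter_eq_self.mpr, Multiset.filter_eq_nil.mpr,
    add_zero] <;> simp

lemma filter_mergeEF_two (x : Multiset ℕ × Multiset ℕ) :
    (mergeEF x).filter (fun i => (ofLex i).1 = 2) = x.2.map fun n => toLex (2, n) := by
  rw [mergeEF, Multiset.filter_add, add_comm, Multiset.filter_eq_self.mpr,
    Multiset.filter_eq_nil.mpr, add_zero] <;> simp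

lemma mergeEF_injective : Function.Injective mergeEF := by
  intro x y hxy
  refine Prod.ext (map_toLex_injective 1 ?_) (map_toLex_injective 2 ?_)
  · rw [← filter_mergeEF_one, hxy, filter_mergeEF_one]
  · rw [← filter_mergeEF_two, hxy, filter_mergeEF_two]

lemma exists_mergeEF (m : Multiset Idx) (hm : ∀ i ∈ m, (ofLex i).1 ≠ 0) :
    ∃ x, mergeEF x = m := by
  induction m using Multiset.induction with
  | empty => exact ⟨(0, 0), rfl⟩
  | cons a m ih =>
    obtain ⟨x, rfl⟩ := ih fun i hi => hm i (Multiset.mem_cons_of_mem hi)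
    obtain ⟨⟨c, n⟩, rfl⟩ := toLex.surjective a
    have hc : c ≠ 0 := hm _ (Multiset.mem_cons_self _ _)
    obtain rfl | rfl : c = 1 ∨ c = 2 := by revert hc; fin_cases c <;> simp
    · exact ⟨(n ::ₘ x.1, x.2), by simp [mergeEF]⟩
    · exact ⟨(x.1, n ::ₘ x.2), by simp [mergeEF]⟩

lemma zeroWeight_iff (s a b i : ℕ) :
    (2 * ((a : ℂ) - b) + (((2 * s : ℕ) : ℂ) - 2 * i) = 0) ↔ a + s = b + i := by
  rw [← Nat.cast_inj (R := ℂ)]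
  push_cast
  constructor
  · intro h1; linear_combination h1 / 2
  · intro h1; linear_combination 2 * h1

/-- The vectors of `h(0)`-weight `0` in terms of pairs of partitions. -/
def zeroWeightMap (s : ℕ)
    (y : Σ i : Fin (2 * s + 1), PartPairs (fun a b => a + s = b + i)) : ZeroWeightIdx (2 * s) :=
  ⟨⟨⟨mergeEF y.2.1, y.1⟩, fun i hi => by
      simp only [mergeEF, Multiset.mem_add, Multiset.mem_map] at hi
      rcases hi with ⟨n, -, rfl⟩ | ⟨n, -, rfl⟩ <;> simp⟩, by
    rw [weight_mergeEF, zeroWeight_iff]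
    exact y.2.2⟩

lemma zeroWeightMap_bijective (s : ℕ) : Function.Bijective (zeroWeightMap s) := by
  constructor
  · rintro ⟨i, x, hx⟩ ⟨i', x', hx'⟩ h0
    have h1 := congrArg (fun t : ZeroWeightIdx (2 * s) => t.1.1) h0
    simp only [zeroWeightMap, Sigma.mk.injEq, heq_eq_eq] at h1
    obtain ⟨h2, rfl⟩ := h1
    obtain rfl := mergeEF_injective h2
    rfl
  · rintro ⟨⟨⟨m, i⟩, hm⟩, hw⟩
    obtain ⟨x, rfl⟩ := exists_mergeEF m hm
    rw [weight_mergeEF, zeroWeight_iff] at hw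
    exact ⟨⟨i, x, hw⟩, rfl⟩

lemma mk_card_zeroWeight (s d : ℕ) :
    (mk fun n => (Nat.card {t : VacIdx (2 * s) //
      weight t.1.1 + (((2 * s : ℕ) : ℂ) - 2 * t.1.2) = 0 ∧ deg t.1.1 + d = n} : ℤ)) =
    X ^ d * ∑ i ∈ Finset.range (2 * s + 1), partPairs (i - s + (s - i)) := by
  have h1 : HasSum (fun t : ZeroWeightIdx (2 * s) => (X : PowerSeries ℤ) ^ (deg t.1.1.1 + d))
      (mk fun n => (Nat.card {t : ZeroWeightIdx (2 * s) // deg t.1.1.1 + d = n} : ℤ)) := by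
    refine hasSum_X_pow _ fun n => ?_
    refine Set.Finite.of_finite_image (f := fun t => (t.1.1.1, t.1.1.2))
      (((finite_deg_le n).prod Set.finite_univ).subset ?_) ?_
    · rintro _ ⟨t, ht, rfl⟩
      exact ⟨(Nat.le_add_right _ _).trans ht.le, Set.mem_univ _⟩
    · intro t _ t' _ htt
      have := Prod.mk.inj htt
      exact Subtype.ext (Subtype.ext (Sigma.ext this.1 (heq_of_eq this.2)))
  have h2 := (Equiv.ofBijective _ (zeroWeightMap_bijective s)).hasSum_iff.mpr h1
  have h3 := h2.sigma (g := fun i : Fin (2 * s + 1) => X ^ d * partPairs (i - s + (s - i)))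
    fun i => ((hasSum_partPairs_balanced s i).mul_left (X ^ d)).congr_fun fun x => by
      simp only [Function.comp_apply, Equiv.ofBijective_apply, zeroWeightMap, deg_mergeEF]
      rw [pow_add, mul_comm]
  have h4 := h3.unique (hasSum_fintype _)
  rw [Finset.sum_range, Finset.mul_sum, ← h4]
  congr 1
  ext1 n
  congr 1
  exact Nat.card_congr (Equiv.subtypeSubtypeEquivSubtypeInter _ _).symm

/-- The series `1 - 2 φ_{s + 1}`, up to the power of `q`, for the character of `N^k(2 s)`. -/
lemma qInf_sq_mul_card (s d : ℕ) :
    qInf ^ 2 * (mk fun n => (Nat.card {t : VacIdx (2 * s) //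
      weight t.1.1 + (((2 * s : ℕ) : ℂ) - 2 * t.1.2) = 0 ∧ deg t.1.1 + d = n} : ℤ)) =
    X ^ d * (1 - 2 * falseTheta (s + 1)) := by
  have h1 : ∑ i ∈ Finset.range (2 * s + 1),
      (falseTheta (i - s + (s - i)) - falseTheta (i - s + (s - i) + 1)) =
      1 - 2 * falseTheta (s + 1) := by
    rw [show 2 * s + 1 = s + (s + 1) by ring, Finset.sum_range_add]
    have e1 : ∀ i ∈ Finset.range (s + 1), falseTheta (s + i - s + (s - (s + i))) -
        falseTheta (s + i - s + (s - (s + i)) + 1) = falseTheta i - falseTheta (i + 1) := by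
      intro i _
      rw [show s + i - s + (s - (s + i)) = i by omega]
    -- The half i ≥ s telescopes to φ_0 - φ_{s+1}. The half i < s, reversed so that |i - s| runs
    -- through 1, …, s, telescopes to φ_1 - φ_{s+1}.
    have e2 : ∑ i ∈ Finset.range s,
        (falseTheta (i - s + (s - i)) - falseTheta (i - s + (s - i) + 1)) =
        ∑ i ∈ Finset.range s, (falseTheta (i + 1) - falseTheta (i + 1 + 1)) := by
      rw [← Finset.sum_range_reflect]
      refine Finset.sum_congr rfl fun i hi => ?_
      have := Finset.mem_range.mp hi
      rw [show s - 1 - i - s + (s - (s - 1 - i)) = i + 1 by omega]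
    rw [e2, Finset.sum_congr rfl e1, Finset.sum_range_sub', Finset.sum_range_sub']
    linear_combination falseTheta_zero_add_one
  rw [mk_card_zeroWeight, ← h1, mul_left_comm, Finset.mul_sum]
  simp only [qInf_sq_mul_partPairs]

end ParafermionSl2

/-! ### Formal sums of Hahn series coming from power series -/

namespace ParafermionSl2

open PowerSeries QSeriesTools

/-- Power series in `q` as formal series with rational exponents. -/
abbrev ofPS : PowerSeries ℤ →+* QSeries := HahnSeries.ofPowerSeries ℚ ℤ

lemma ofPS_coeff_of_notMem (p : PowerSeries ℤ) (g : ℚ) (hg : g ∉ Set.range (Nat.cast : ℕ → ℚ)) :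
    (ofPS p).coeff g = 0 := by
  rw [HahnSeries.ofPowerSeries_apply]
  refine HahnSeries.embDomain_of_notMem_range ?_
  rintro ⟨n, rfl⟩
  exact hg ⟨n, rfl⟩

lemma q_mul (a b : ℚ) : q a * q b = q (a + b) := by
  rw [q, q, q, HahnSeries.single_mul_single, one_mul]

lemma q_zero : q 0 = 1 := rfl

lemma ofPS_X_pow (n : ℕ) : ofPS (X ^ n) = q n := HahnSeries.ofPowerSeries_X_pow n

/-- A convergent sum of power series, viewed as a family of Hahn series. -/
def summableFamily {ι : Type} (p : ι → PowerSeries ℤ) (hp : Summable p) :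
    HahnSeries.SummableFamily ℚ ℤ ι where
  toFun i := ofPS (p i)
  isPWO_iUnion_support' := by
    have h1 : (Set.range (Nat.cast : ℕ → ℚ)).IsPWO := by
      rw [← Set.image_univ]
      exact (Set.isPWO_univ_iff.mpr inferInstance).image_of_monotone Nat.mono_cast
    refine h1.mono (Set.iUnion_subset fun i g hg => ?_)
    by_contra hc
    exact hg (ofPS_coeff_of_notMem _ _ hc)
  finite_co_support' g := by
    by_cases hg : g ∈ Set.range (Nat.cast : ℕ → ℚ)
    · obtain ⟨n, rfl⟩ := hg
      simp only [HahnSeries.ofPowerSeries_apply_coeff]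
      exact ((PowerSeries.WithPiTopology.summable_iff_summable_coeff _).mp hp n
        ).hasFiniteSupport_of_discreteTopology
    · simp [ofPS_coeff_of_notMem _ _ hg]

lemma hsum_summableFamily {ι : Type} {p : ι → PowerSeries ℤ} {P : PowerSeries ℤ}
    (hp : HasSum p P) : (summableFamily p hp.summable).hsum = ofPS P := by
  ext g
  rw [HahnSeries.SummableFamily.coeff_hsum]
  by_cases hg : g ∈ Set.range (Nat.cast : ℕ → ℚ)
  · obtain ⟨n, rfl⟩ := hg
    have h1 := (PowerSeries.WithPiTopology.hasSum_iff_hasSum_coeff _).mp hp n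
    rw [HahnSeries.ofPowerSeries_apply_coeff, ← h1.tsum_eq,
      tsum_eq_finsum h1.summable.hasFiniteSupport_of_discreteTopology]
    exact finsum_congr fun i => HahnSeries.ofPowerSeries_apply_coeff _ _
  · rw [ofPS_coeff_of_notMem _ _ hg]
    exact finsum_eq_zero_of_forall_eq_zero fun i => ofPS_coeff_of_notMem _ _ hg

/-- The factor q^c allows finitely negative exponents, which occur in the false theta functions. The
choice made in `formalSum` is harmless because a summable family is determined by its members. -/
lemma formallySummable_of_hasSum {ι : Type} {a : ι → QSeries} {p : ι → PowerSeries ℤ}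
    {P : PowerSeries ℤ} (c : ℚ) (hp : HasSum p P) (ha : ∀ i, a i = q c * ofPS (p i)) :
    FormallySummable a ∧ formalSum a = q c * ofPS P := by
  have h1 : ∀ i, (q c • summableFamily p hp.summable) i = a i := by
    intro i
    rw [HahnSeries.SummableFamily.smul_apply, HahnSeries.of_symm_smul_of_eq_mul, ha]
    rfl
  have hs : FormallySummable a := ⟨_, h1⟩
  refine ⟨hs, ?_⟩
  rw [formalSum, dif_pos hs, ← hsum_summableFamily hp, ← HahnSeries.SummableFamily.hsum_smul]
  congr 1
  exact HahnSeries.SummableFamily.ext fun i => (hs.choose_spec i).trans (h1 i).symm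

/-! ### False theta functions -/

/-- The monomial `X ^ z`, for `z ≥ 0`. -/
def xz (z : ℤ) : PowerSeries ℤ := X ^ z.toNat

lemma ofPS_xz {z : ℤ} (hz : 0 ≤ z) : ofPS (xz z) = q z := by
  rw [xz, ofPS_X_pow]
  congr 1
  exact_mod_cast Int.toNat_of_nonneg hz

lemma xz_add {a b : ℤ} (ha : 0 ≤ a) (hb : 0 ≤ b) : xz (a + b) = xz a * xz b := by
  rw [xz, xz, xz, ← pow_add, Int.toNat_add ha hb]

lemma xz_natCast (n : ℕ) : xz n = X ^ n := by rw [xz, Int.toNat_natCast]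

lemma summable_xz_mul (e : ℕ → ℤ) (he : ∀ n : ℕ, (n : ℤ) ≤ 2 * e n) (g : ℕ → PowerSeries ℤ) :
    Summable fun n => xz (e n) * g n := by
  refine summable_X_pow_mul (fun n => (e n).toNat) (fun N => ?_) g
  refine (Set.finite_Iic (2 * N)).subset fun n hn => ?_
  have h1 : (e n).toNat ≤ N := hn
  have h2 := he n
  rw [Set.mem_Iic]
  omega

lemma cast_tri (n : ℕ) : 2 * (tri n : ℤ) = n * (n + 1) := by exact_mod_cast two_mul_tri n

lemma formalSum_falseTheta (M : ℕ) : FormallySummable (falseThetaTerms (-(M : ℤ))) ∧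
    formalSum (falseThetaTerms (-(M : ℤ))) = ofPS (falseTheta M) := by
  -- The shift by M² makes all exponents nonnegative: 2 e(r) = r + (r - M)² + M². It is undone at
  -- the end by the factor q^{-M²}.
  set e : ℕ → ℤ := fun r => tri r - M * r + M ^ 2 with he
  have hpos : ∀ r : ℕ, (r : ℤ) ≤ 2 * e r := by
    intro r
    have h1 := cast_tri r
    simp only [he]
    nlinarith [sq_nonneg ((r : ℤ) - M), sq_nonneg (M : ℤ)]
  have hs := summable_xz_mul e hpos fun r => (-1) ^ r
  -- The reflection r ↦ 2M - 1 - r preserves the exponent and flips the sign. After these 2M terms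
  -- cancel, the tail r ↦ r + 2M is φ_M.
  have h0 : ∑ r ∈ Finset.range (2 * M), xz (e r) * (-1) ^ r = 0 := by
    have h1 := Finset.sum_range_reflect (fun r => xz (e r) * (-1) ^ r) (2 * M)
    have h2 : ∑ r ∈ Finset.range (2 * M), xz (e (2 * M - 1 - r)) * (-1) ^ (2 * M - 1 - r) =
        -∑ r ∈ Finset.range (2 * M), xz (e r) * (-1) ^ r := by
      rw [← Finset.sum_neg_distrib]
      refine Finset.sum_congr rfl fun r hr => ?_
      have hr := Finset.mem_range.mp hr
      obtain ⟨t, ht⟩ : ∃ t, 2 * M = t + r + 1 := ⟨2 * M - 1 - r, by omega⟩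
      have ht' : 2 * M - 1 - r = t := by omega
      have h3 : e t = e r := by
        have h4 := cast_tri r
        have h5 := cast_tri t
        have h6 : 2 * (M : ℤ) = t + r + 1 := by exact_mod_cast ht
        simp only [he]
        have h7 : 2 * ((tri t : ℤ) - M * t) = 2 * (tri r - M * r) := by
          linear_combination h5 - h4 - (t - r : ℤ) * h6
        linarith
      have h8 : ((-1) ^ t : PowerSeries ℤ) * (-1) ^ r = -1 := by
        rw [← pow_add]
        exact Odd.neg_one_pow ⟨M - 1, by omega⟩
      have h9 : ((-1) ^ r : PowerSeries ℤ) * (-1) ^ r = 1 := by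
        rw [← mul_pow]; simp
      rw [ht', h3]
      linear_combination xz (e r) * (-1) ^ r * h8 - xz (e r) * (-1) ^ t * h9
    have h3 : (2 : PowerSeries ℤ) * ∑ r ∈ Finset.range (2 * M), xz (e r) * (-1) ^ r = 0 := by
      linear_combination -h1 + h2
    refine (mul_eq_zero.mp h3).resolve_left fun hc => ?_
    have := congrArg (constantCoeff (R := ℤ)) hc
    rw [map_ofNat, map_zero] at this
    exact two_ne_zero this
  have hsum : HasSum (fun r => xz (e r) * (-1) ^ r) (xz (M ^ 2) * falseTheta M) := by
    have h1 := hs.hasSum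
    rw [← hs.sum_add_tsum_nat_add (2 * M), h0, zero_add] at h1
    convert h1 using 1
    rw [falseTheta, ← (summable_falseTheta M).tsum_mul_left]
    congr 1
    ext1 r
    have h2 : e (r + 2 * M) = M ^ 2 + ((tri r + (r + 1) * M : ℕ) : ℤ) := by
      have h4 := cast_tri r
      have h5 := cast_tri (r + 2 * M)
      simp only [he]
      push_cast at h5 ⊢
      have : 2 * ((tri (r + 2 * M) : ℤ) - M * (r + 2 * M)) = 2 * (tri r + (r + 1) * M) := by
        linear_combination h5 - h4
      linarith
    rw [h2, xz_add (by positivity) (by positivity), xz_natCast, pow_add (-1), pow_mul]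
    simp
    ring
  have h1 := formallySummable_of_hasSum (a := falseThetaTerms (-(M : ℤ))) (-(M : ℚ) ^ 2) hsum (by
    intro r
    have h2 := hpos r
    have h3 : 0 ≤ e r := by omega
    have h4 : ((tri r : ℤ) : ℚ) = r * (r + 1) / 2 := by
      have := congrArg (fun z : ℤ => (z : ℚ)) (cast_tri r)
      push_cast at this ⊢
      linarith
    rw [falseThetaTerms, map_mul, ofPS_xz h3, map_pow, map_neg, map_one, ← mul_assoc, q_mul,
      mul_comm]
    congr 2
    simp only [he]
    push_cast at h4 ⊢
    rw [h4]
    ring)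
  refine ⟨h1.1, ?_⟩
  rw [h1.2, map_mul, ofPS_xz (by positivity), ← mul_assoc, q_mul]
  push_cast
  rw [neg_add_cancel, q_zero, one_mul]

lemma Φ_neg (M : ℕ) : Φ (-(M : ℤ)) = ofPS (falseTheta M) := by
  rw [Φ, if_pos (by omega), (formalSum_falseTheta M).2]

end ParafermionSl2

/-! ### The series `G_s` -/

namespace ParafermionSl2

open PowerSeries QSeriesTools

lemma F_expand (m n : ℕ) (a : ℚ)
    (ha : a = 2 / 3 * (m : ℚ) ^ 2 + 2 / 3 * (n : ℚ) ^ 2 + 2 / 3 * (m : ℚ) * n - m - n) :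
    F m n = q a - q (a + m) - q (a + n) + q (a + 2 * m + n) + q (a + m + 2 * n) -
      q (a + 2 * m + 2 * n) := by
  have h0 : q ((m : ℚ) + n) = q m * q n := (q_mul _ _).symm
  have h1 : q (a + 2 * m + n) = q a * (q m * q m * q n) := by
    simp only [q_mul]; congr 1; ring
  have h2 : q (a + m + 2 * n) = q a * (q m * q n * q n) := by
    simp only [q_mul]; congr 1; ring
  have h3 : q (a + 2 * m + 2 * n) = q a * (q m * q m * q n * q n) := by
    simp only [q_mul]; congr 1; ring
  rw [F, ← ha, h0, h1, h2, h3, ← q_mul, ← q_mul]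
  ring

/-- The quadratic form in the exponents. -/
def qf (m d : ℤ) : ℤ := 2 * m ^ 2 + 6 * m * d + 6 * d ^ 2

/-- The power series `F_{m, m + 3 d}`. -/
def kernel (m d : ℤ) : PowerSeries ℤ :=
  xz (qf m d - 2 * m - 3 * d) - xz (qf m d - m - 3 * d) - xz (qf m d - m) + xz (qf m d + m) +
    xz (qf m d + m + 3 * d) - xz (qf m d + 2 * m + 3 * d)

lemma exponent_nonneg (m d : ℤ) : 0 ≤ 2 * m ^ 2 - 2 * m ∧ 0 ≤ 6 * d ^ 2 - 3 * d := by
  constructor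
  · rcases le_or_gt m 0 with h1 | h1 <;> nlinarith
  · rcases le_or_gt d 0 with h1 | h1 <;> nlinarith

lemma ofPS_kernel (m d : ℕ) : ofPS (kernel m d) =
    q (qf m d - 2 * m - 3 * d) - q (qf m d - m - 3 * d) - q (qf m d - m) + q (qf m d + m) +
    q (qf m d + m + 3 * d) - q (qf m d + 2 * m + 3 * d) := by
  have h1 := exponent_nonneg m d
  have h2 : (0 : ℤ) ≤ 6 * m * d := by positivity
  have h3 : (0 : ℤ) ≤ m := by positivity
  have h4 : (0 : ℤ) ≤ d := by positivity
  have h5 : 0 ≤ qf m d - 2 * m - 3 * d := by rw [qf]; linarith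
  rw [kernel, map_sub, map_add, map_add, map_sub, map_sub, ofPS_xz h5, ofPS_xz (by linarith),
    ofPS_xz (by linarith), ofPS_xz (by linarith), ofPS_xz (by linarith), ofPS_xz (by linarith)]
  push_cast
  rfl

/-- When the indices differ by a multiple of 3, the quadratic part of the exponent becomes 2m² + 6md
+ 6d², so only integral powers of q occur. -/
lemma F_eq_kernel (m d : ℕ) : F m (m + 3 * d) = ofPS (kernel m d) := by
  rw [ofPS_kernel, F_expand m (m + 3 * d) (qf m d - 2 * m - 3 * d)
    (by rw [qf]; push_cast; ring)]
  push_cast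
  ring_nf

lemma F_eq_kernel' (m d : ℕ) : F (m + 3 * d) m = ofPS (kernel m d) := by
  rw [ofPS_kernel, F_expand (m + 3 * d) m (qf m d - 2 * m - 3 * d)
    (by rw [qf]; push_cast; ring)]
  push_cast
  ring_nf

/-- The first term of the telescoping part of the sum of the kernel over `m ≥ S - d`. -/
def leadTerm (S d : ℕ) : PowerSeries ℤ := xz (qf (S - d) d - 2 * (S - d) - 3 * d)

/-- The second monomial of the kernel, for `m = S - d + n`. -/
def minusSeries (S d : ℕ) (n : ℕ) : PowerSeries ℤ :=
  xz (qf (S - d + n) d - (S - d + n) - 3 * d)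

/-- The third monomial of the kernel, for `m = S - d + n`. -/
def minusSeries' (S d : ℕ) (n : ℕ) : PowerSeries ℤ := xz (qf (S - d + n) d - (S - d + n))

/-- The fourth monomial of the kernel, for `m = S - d + n`. -/
def plusSeries (S d : ℕ) (n : ℕ) : PowerSeries ℤ := xz (qf (S - d + n) d + (S - d + n))

/-- The fifth monomial at (m, d) is the second at (m - 1, d + 1), and lowering m by one while
raising d keeps n fixed in m = S - d + n. So it cancels against the next value of d. -/
lemma minusSeries_succ (S d n : ℕ) :
    minusSeries S (d + 1) n = xz (qf (S - d + n) d + (S - d + n) + 3 * d) := by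
  rw [minusSeries]
  congr 1
  simp only [qf]
  push_cast
  ring

/-- The third monomial for d, apart from its first term, cancels against the fourth for d + 1. -/
lemma minusSeries'_succ (S d n : ℕ) : minusSeries' S d (n + 1) = plusSeries S (d + 1) n := by
  rw [minusSeries', plusSeries]
  congr 1
  simp only [qf]
  push_cast
  ring

lemma summable_xz (e : ℕ → ℤ) (he : ∀ n : ℕ, (n : ℤ) ≤ 2 * e n) : Summable fun n => xz (e n) := by
  simpa using summable_xz_mul e he fun _ => 1

lemma exponent_bound {S d : ℕ} (hd : d ≤ S) (n : ℕ) (c : ℤ) (hc : -1 ≤ c) :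
    (n : ℤ) ≤ 2 * (qf (S - d + n) d + c * (S - d + n) - 3 * d) := by
  have h0 : (d : ℤ) ≤ S := by exact_mod_cast hd
  obtain ⟨t, ht⟩ : ∃ t : ℕ, (S : ℤ) - d = t := ⟨S - d, by omega⟩
  rw [ht]
  have h1 := exponent_nonneg (t + n) d
  have h2 : (0 : ℤ) ≤ t * d := by positivity
  have h3 : (0 : ℤ) ≤ n * d := by positivity
  have h4 : (0 : ℤ) ≤ t := by positivity
  have h5 : 0 ≤ (c + 1) * ((t : ℤ) + n) := mul_nonneg (by linarith) (by positivity)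
  rw [qf]
  nlinarith

lemma summable_minusSeries {S d : ℕ} (hd : d ≤ S) : Summable (minusSeries S d) := by
  refine summable_xz _ fun n => ?_
  have := exponent_bound hd n (-1) le_rfl
  linarith

lemma summable_minusSeries' {S d : ℕ} (hd : d ≤ S) : Summable (minusSeries' S d) := by
  refine summable_xz _ fun n => ?_
  have := exponent_bound hd n (-1) le_rfl
  have h0 : (0 : ℤ) ≤ d := by positivity
  linarith

lemma summable_plusSeries {S d : ℕ} (hd : d ≤ S) : Summable (plusSeries S d) := by
  refine summable_xz _ fun n => ?_
  have := exponent_bound hd n 1 (by norm_num)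
  have h0 : (0 : ℤ) ≤ d := by positivity
  linarith

/-- The sum of the kernel over `m ≥ S - d`. -/
def kernelSum (S d : ℕ) : PowerSeries ℤ :=
  leadTerm S d - ∑' n, minusSeries S d n - ∑' n, minusSeries' S d n + ∑' n, plusSeries S d n +
    ∑' n, minusSeries S (d + 1) n

/-- The sixth monomial at m equals the first at m + 1, so these two telescope and contribute only
`leadTerm`. The condition d < S ensures m ≥ 1, which makes the exponents grow as required. -/
lemma hasSum_kernel {S d : ℕ} (hd : d < S) :
    HasSum (fun n : ℕ => kernel (S - d + n) d) (kernelSum S d) := by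
  have h1 : HasSum (fun n : ℕ => xz (qf (S - d + n) d - 2 * (S - d + n) - 3 * d) -
      xz (qf (S - d + n) d + 2 * (S - d + n) + 3 * d)) (leadTerm S d) := by
    have hs : Summable fun n : ℕ => xz (qf (S - d + n) d - 2 * (S - d + n) - 3 * d) := by
      refine summable_xz _ fun n => ?_
      obtain ⟨t, rfl⟩ : ∃ t : ℕ, S = t + 1 + d := ⟨S - d - 1, by omega⟩
      have h1 := exponent_nonneg (t + n) d
      push_cast
      have h2 : (0 : ℤ) ≤ t * d := by positivity
      have h3 : (0 : ℤ) ≤ n * d := by positivity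
      have h4 : (0 : ℤ) ≤ t := by positivity
      have h5 : (0 : ℤ) ≤ d := by positivity
      rw [qf]
      nlinarith
    have h2 := hs.hasSum.sub ((summable_nat_add_iff 1).mpr hs).hasSum
    rw [hs.tsum_eq_zero_add, add_sub_cancel_right] at h2
    rw [Nat.cast_zero, add_zero, ← leadTerm] at h2
    refine h2.congr_fun fun n => ?_
    congr 2
    simp only [qf]
    push_cast
    ring
  have h2 := (((h1.sub (summable_minusSeries hd.le).hasSum).sub
    (summable_minusSeries' hd.le).hasSum).add (summable_plusSeries hd.le).hasSum).add
    (summable_minusSeries (Nat.succ_le_of_lt hd)).hasSum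
  refine h2.congr_fun fun n => ?_
  rw [kernel, minusSeries_succ, minusSeries, minusSeries', plusSeries]
  ring

/-- The natural numbers as the integers `≥ i`. -/
def natEquivIci (i : ℕ) : ℕ ≃ Set.Ici i where
  toFun n := ⟨i + n, Nat.le_add_right i n⟩
  invFun m := m.1 - i
  left_inv n := Nat.add_sub_cancel_left i n
  right_inv m := Subtype.ext (Nat.add_sub_cancel' m.2)

lemma hasSum_kernel_Ici {S d : ℕ} (hd : d < S) :
    HasSum (fun m : Set.Ici (S - d) => kernel (m.1 : ℕ) d) (kernelSum S d) := by
  rw [← (natEquivIci (S - d)).hasSum_iff]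
  refine (hasSum_kernel hd).congr_fun fun n => ?_
  have h1 : (S : ℤ) - d + n = ((S - d + n : ℕ) : ℤ) := by omega
  rw [h1]
  rfl

lemma formalSum_diagonalTerms (s : ℕ) : FormallySummable (diagonalTerms s) ∧
    formalSum (diagonalTerms s) = ofPS (kernelSum (s + 1) 0) := by
  have h1 := formallySummable_of_hasSum (a := diagonalTerms s) 0
    (hasSum_kernel_Ici (Nat.succ_pos s)) fun m => by
      have := F_eq_kernel m.1 0
      rw [q_zero, one_mul, ← this]
      rfl
  rwa [q_zero, one_mul] at h1

lemma formalSum_offDiagonalTerms (s d : ℕ) (hd : d < s) :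
    FormallySummable (offDiagonalTerms s (s - d)) ∧
    formalSum (offDiagonalTerms s (s - d)) = ofPS (2 * kernelSum (s + 1) (d + 1)) := by
  have h0 : s + 1 - (d + 1) = s - d := by omega
  have hk := hasSum_kernel_Ici (show d + 1 < s + 1 by omega)
  rw [h0] at hk
  have h1 := formallySummable_of_hasSum (a := offDiagonalTerms s (s - d)) 0 (hk.mul_left 2)
    fun m => by
      have h2 : s + 1 - (s - d) = d + 1 := by omega
      rw [q_zero, one_mul, map_mul, map_ofNat, two_mul, offDiagonalTerms, h2, F_eq_kernel,
        F_eq_kernel']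
  rwa [q_zero, one_mul] at h1

/-- At d = 0 the second and third monomials coincide, as do the fourth and fifth, so the diagonal
sum, although counted once, joins the telescoping in d with the same factor 2 as the others. -/
lemma kernelSum_partial_sum (S N : ℕ) (hN : N ≤ S) :
    kernelSum S 0 + ∑ d ∈ Finset.range N, 2 * kernelSum S (d + 1) =
      leadTerm S 0 + 2 * (∑ d ∈ Finset.range N, leadTerm S (d + 1) -
        ∑ d ∈ Finset.range N, minusSeries' S d 0 + ∑' n, minusSeries S (N + 1) n -
        ∑' n, minusSeries' S N n) := by
  induction N with
  | zero =>
    have h1 : minusSeries S 0 = minusSeries' S 0 := by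
      ext1 n; simp [minusSeries, minusSeries']
    have h2 : plusSeries S 0 = minusSeries S (0 + 1) := by
      ext1 n; rw [minusSeries_succ, plusSeries]; simp
    rw [kernelSum, h1, h2, Finset.sum_range_zero, Finset.sum_range_zero, Finset.sum_range_zero]
    ring
  | succ N ih =>
    have h1 := (summable_minusSeries' (S := S) (d := N) (by omega)).tsum_eq_zero_add
    simp only [minusSeries'_succ] at h1
    rw [Finset.sum_range_succ, ← add_assoc, ih (by omega), h1, kernelSum, Finset.sum_range_succ,
      Finset.sum_range_succ]
    ring

/-- Term 2d of the shifted false theta series is the first third-monomial for d, and term 2d + 1 is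
minus the leading term for d + 1. The first s of each kind are the finite sums; the later ones are
the terms of the two boundary series. -/
lemma X_pow_mul_falseTheta (s : ℕ) : X ^ (2 * s * (s + 1)) * falseTheta (s + 1) =
    ∑ d ∈ Finset.range s, minusSeries' (s + 1) d 0 + ∑' n, minusSeries' (s + 1) s n -
    (∑ d ∈ Finset.range s, leadTerm (s + 1) (d + 1) + ∑' n, minusSeries (s + 1) (s + 1) n) := by
  set u : ℕ → PowerSeries ℤ := fun r =>
    X ^ (2 * s * (s + 1)) * (X ^ (tri r + (r + 1) * (s + 1)) * (-1) ^ r) with hu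
  have hu' : ∀ (r : ℕ) (z : ℤ),
      2 * z = 4 * s * (s + 1) + r * (r + 1) + 2 * (r + 1) * (s + 1) → u r = xz z * (-1) ^ r := by
    intro r z hz
    have h1 : z = ((2 * s * (s + 1) + (tri r + (r + 1) * (s + 1)) : ℕ) : ℤ) := by
      have := cast_tri r
      push_cast
      linarith
    rw [h1, xz_natCast, pow_add X]
    simp only [hu]
    ring
  have heven : ∀ d, u (2 * d) = minusSeries' (s + 1) d 0 := by
    intro d
    rw [hu' _ (qf ((s + 1 : ℕ) - d + (0 : ℕ)) d - ((s + 1 : ℕ) - d + (0 : ℕ)))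
      (by simp only [qf]; push_cast; ring)]
    simp [minusSeries']
  have hodd : ∀ d, u (2 * d + 1) = -leadTerm (s + 1) (d + 1) := by
    intro d
    rw [hu' _ (qf ((s + 1 : ℕ) - (d + 1 : ℕ)) (d + 1 : ℕ) -
      2 * ((s + 1 : ℕ) - (d + 1 : ℕ)) - 3 * (d + 1 : ℕ))
      (by simp only [qf]; push_cast; ring)]
    simp [leadTerm, pow_succ]
  -- Here m = 1 - n may be nonpositive on the left; the integer quadratic form gives the same
  -- exponent as at m = 1 + n, d = s.
  have heven' : ∀ n, minusSeries' (s + 1) (n + s) 0 = minusSeries' (s + 1) s n := by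
    intro n
    rw [minusSeries', minusSeries']
    congr 1
    simp only [qf]
    push_cast
    ring
  have hodd' : ∀ n, leadTerm (s + 1) (n + s + 1) = minusSeries (s + 1) (s + 1) n := by
    intro n
    rw [leadTerm, minusSeries]
    congr 1
    simp only [qf]
    push_cast
    ring
  have hse : Summable fun d => u (2 * d) :=
    (summable_nat_add_iff s).mp (by
      simp only [heven, heven']
      exact summable_minusSeries' (Nat.le_succ s))
  have hso : Summable fun d => leadTerm (s + 1) (d + 1) :=
    (summable_nat_add_iff s).mp (by
      simp only [hodd']
      exact summable_minusSeries le_rfl)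
  have hso' : Summable fun d => u (2 * d + 1) := by
    simp only [hodd]
    exact hso.neg
  rw [falseTheta, ← (summable_falseTheta (s + 1)).tsum_mul_left]
  change ∑' r, u r = _
  rw [← tsum_even_add_odd hse hso']
  simp only [hodd, tsum_neg]
  rw [← hso.sum_add_tsum_nat_add s, ← hse.sum_add_tsum_nat_add s]
  simp only [heven, heven', hodd']
  ring

lemma G_eq (s : ℕ) :
    G s = ofPS (X ^ (2 * s * (s + 1)) * (1 - 2 * falseTheta (s + 1))) := by
  have h1 : ∑ i ∈ Finset.Icc 1 s, formalSum (offDiagonalTerms s i) =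
      ∑ d ∈ Finset.range s, ofPS (2 * kernelSum (s + 1) (d + 1)) := by
    -- The index i corresponds to the shift 3(s + 1 - i) = 3(d + 1), so d = s - i.
    refine Finset.sum_nbij' (fun i => s - i) (fun d => s - d) ?_ ?_ ?_ ?_ ?_
    · intro i hi; simp only [Finset.mem_Icc, Finset.mem_range] at hi ⊢; omega
    · intro d hd; simp only [Finset.mem_Icc, Finset.mem_range] at hd ⊢; omega
    · intro i hi; simp only [Finset.mem_Icc] at hi; omega
    · intro d hd; simp only [Finset.mem_range] at hd; omega
    · intro i hi
      simp only [Finset.mem_Icc] at hi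
      have := (formalSum_offDiagonalTerms s (s - i) (by omega)).2
      rwa [show s - (s - i) = i by omega] at this
  have h2 : leadTerm (s + 1) 0 = X ^ (2 * s * (s + 1)) := by
    rw [leadTerm, ← xz_natCast]
    congr 1
    simp only [qf]
    push_cast
    ring
  rw [G, (formalSum_diagonalTerms s).2, h1, ← map_sum, ← map_add,
    kernelSum_partial_sum (s + 1) s (Nat.le_succ s), h2]
  congr 1
  linear_combination 2 * X_pow_mul_falseTheta s

lemma qPoch_sq_mul_ch (s : ℕ) : HasPowerSeriesCharacter (-3 / 2) (2 * s) ∧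
    qPoch ^ 2 * ch (-3 / 2) (2 * s) =
      ofPS (X ^ (2 * s * (s + 1)) * (1 - 2 * falseTheta (s + 1))) := by
  -- With k + 2 = 1/2 the lowest eigenvalue j(j + 2) / (4(k + 2)) at j = 2s is 2s(s + 1).
  obtain ⟨h1, h2⟩ := parafermion_character (-3 / 2) (by norm_num) (by norm_num) (2 * s)
    (2 * s * (s + 1)) (by push_cast; ring)
  refine ⟨h1, ?_⟩
  rw [← qInf_sq_mul_card s (2 * s * (s + 1)), map_mul, map_pow, ch]
  simp only [h2]
  rfl

end ParafermionSl2

end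

theorem proposition6p3 (s : ℕ) :
    ParafermionSl2.HasPowerSeriesCharacter (-3 / 2) (2 * s) ∧
    ParafermionSl2.FormallySummable (ParafermionSl2.diagonalTerms s) ∧
    (∀ i : ℕ, 1 ≤ i → i ≤ s →
      ParafermionSl2.FormallySummable (ParafermionSl2.offDiagonalTerms s i)) ∧
    ParafermionSl2.G s = ParafermionSl2.qPoch ^ 2 * ParafermionSl2.ch (-3 / 2) (2 * s) ∧
    (∀ m : ℤ, m ≤ 0 → ParafermionSl2.FormallySummable (ParafermionSl2.falseThetaTerms m)) ∧
    ParafermionSl2.G s =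
      ParafermionSl2.q (2 * (s : ℚ) * (s + 1)) *
        (ParafermionSl2.Φ 0 + ParafermionSl2.Φ (-1) - 2 * ParafermionSl2.Φ (-(s : ℤ) - 1)) := by
  open ParafermionSl2 QSeriesTools in
  refine ⟨(qPoch_sq_mul_ch s).1, (formalSum_diagonalTerms s).1, fun i h1 h2 => ?_,
    (G_eq s).trans (qPoch_sq_mul_ch s).2.symm, fun m hm => ?_, ?_⟩
  · have := (formalSum_offDiagonalTerms s (s - i) (by omega)).1
    rwa [show s - (s - i) = i by omega] at this
  · obtain ⟨M, rfl⟩ : ∃ M : ℕ, m = -(M : ℤ) := ⟨m.natAbs, by omega⟩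
    exact (formalSum_falseTheta M).1
  · have e0 := Φ_neg 0
    have e1 := Φ_neg 1
    have e2 := Φ_neg (s + 1)
    have e3 := ofPS_X_pow (2 * s * (s + 1))
    rw [show -((0 : ℕ) : ℤ) = 0 by simp] at e0
    rw [Nat.cast_one] at e1
    rw [show -((s + 1 : ℕ) : ℤ) = -(s : ℤ) - 1 by push_cast; ring] at e2
    push_cast at e3
    rw [G_eq, e0, e1, e2, ← e3, ← map_add, falseTheta_zero_add_one, map_mul, map_sub, map_mul,
      map_ofNat _ 2]
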